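/- **Conventions.** A hypergraph $P$ consists of sets $P_n$ ($n\ge 0$) of $n$-atoms and maps $(-)^-,(-)^+\colon P_{n+1}\to\mathrm{Pow}_{\mathrm{fin}}(P_n)$. For $S\subseteq P_{n+1}$ put $S^{\epsilon}=\bigcup_{s\in S}s^{\epsilon}$, $S^{\mp}=S^-\setminus S^+$, $S^{\pm}=S^+\setminus S^-$; $S$ *moves* $X$ to $Y$ if $S^{\mp}=X\setminus Y$ and $S^{\pm}=Y\setminus X$. A set $S\subseteq P_n$ is *fork-free* if $n=0$ and $S$ is a singleton, or $n\ge1$ and $u^-\cap v^-=u^+\cap v^+=\emptyset$ for all $u\ne v$ in $S$. An *$n$-cell* $c$ consists of finite fork-free sets $c_{-i},c_i\subseteq P_i$ ($0\le i\le n$), with $c_{-n}=c_n$, such that $c_{i+1}$ and $c_{-(i+1)}$ move $c_{-i}$ to $c_i$ for $0\le i<n$. The iterated source and target of $c$ are $\partial_{\epsilon i}c=(c_{-0},c_0,\dots,c_{-(i-1)},c_{i-1},c_{\epsilon i},c_{\epsilon i})$. If $\partial_i c=\partial_{-i}d$, then $d\circ_i c$ has components $c_{\epsilon j}=d_{\epsilon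 j}$ for $j<i$, $c_{-i}$ and $d_i$ in dimension $i$, and $c_{\epsilon j}\cup d_{\epsilon j}$ for $j>i$. For an $n$-atom $x$, $\langle x\rangle$ is given by $\langle x\rangle_{\pm n}=\{x\}$, $\langle x\rangle_{i-1}=(\langle x\rangle_i)^{\pm}$, $\langle x\rangle_{-(i-1)}=(\langle x\rangle_{-i})^{\mp}$. For $x,y\in P_n$, $n\ge1$, write $x\triangleleft_{n-1}y$ if $x^+\cap y^-\neq\emptyset$; for $X\subseteq P_n$ let $\triangleleft_X$ be the transitive closure of the restriction of $\triangleleft_{n-1}$ to $X$, and for subsets write $U\triangleleft_X V$ if $u\triangleleft_X v$ for some $u\in U$, $v\in V$. $P$ is a *torsion-free complex* if: (T0) $x^-$ and $x^+$ are nonempty for every atom $x$ of positive dimension; (T1) the transitive closure of each $\triangleleft_{n-1}$ is irreflexive; (T2) $\langle x\rangle$ is a cell for every atom $x$; (T3) for every $n$-cell $X$, every atom $x$ of dimension $>n$ and each sign $\epsilon$ with $\langle x\rangle_{\epsilon n}\subseteq X_n$, if $u\triangleleft_{X_n}v\triangleleft_{X_n}w$ with $u,w\in\langle x\rangle_{\epsilon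 n}$ then $v\in\langle x\rangle_{\epsilon n}$; (T4) for $n\ge1$ there are no $n$-cell $Z$ and atoms $x,y$ of dimension $>n$ with $\langle x\rangle_n,\langle y\rangle_{-n}\subseteq Z_n$ disjoint and both $\langle x\rangle_n\triangleleft_{Z_n}\langle y\rangle_{-n}$ and $\langle y\rangle_{-n}\triangleleft_{Z_n}\langle x\rangle_n$. The cells of $P$ form a strict $\omega$-category $FP$. Let $\mu$ be an $n$-cell of $P$, and let $\overline{\{\mu\}}$ be the smallest subcomplex (family of sets of atoms containing $x^-$ and $x^+$ with every $x$) containing all atoms of $\mu$. For $i\geq 1$ let $\approx_i$ be the equivalence relation on $(\partial_i\mu)_i$ generated by $a\approx_i b$ whenever $a,b\in\langle x\rangle_i$ for some atom $x\in\overline{\{\mu\}}$ of dimension $\ge i+1$, and let $\operatorname{At}_i(\mu)$ be the preorder on $(\partial_i\mu)_i$ generated by $\approx_i$ together with $a\le b$ whenever $a\triangleleft_{i-1}b$. We say that $\operatorname{At}_i(\mu)$ *is an equivalence relation* if it coincides with $\approx_i$. For $1\le k\le n$ let $\operatorname{Sd}_{\{k-1\}}(\mu)$ be the set, ordered by inclusion,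 of subcategories $\theta\subseteq F(\overline{\{\mu\}})$ with $\mu\in\theta$ that are isomorphic to an object of Joyal's category $\Theta_n$ assembled from its generating cells using only $\circ_{k-1}$ composition, excluding the trivial one consisting of $\mu$ and its iterated sources and targets. Let $\operatorname{Lin}(\operatorname{At}_k(\mu))$ be the set of linear (total) preorders on $(\partial_k\mu)_k$ that contain $\operatorname{At}_k(\mu)$ and are not codiscrete, ordered by reverse containment. For $\theta\in\operatorname{Sd}_{\{k-1\}}(\mu)$ let $L_k^\mu(\theta)$ be the preorder on $(\partial_k\mu)_k$ generated by declaring $a$ and $b$ equivalent if $a,b\in(\partial_k g)_k$ for one generating cell $g$ of $\theta$, and $a\le b$ if $a\in(\partial_k g)_k$, $b\in(\partial_k h)_k$ for generating cells $g,h$ of $\theta$ such that $h\circ_{k-1}g$ is defined. **Proposition.** Let $P$ be a torsion-free complex, $\mu$ an $n$-cell of $P$, and $1\le k\le n$ such that $\operatorname{At}_i(\mu)$ is an equivalence relation for all $i>k$. Then $L_k^\mu$ is a well-defined isomorphism of posets $$L_k^\mu\colon \operatorname{Sd}_{\{k-1\}}(\mu)\xrightarrow{\ \cong\ }\operatorname{Lin}(\operatorname{At}_k(\mu)).$$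 -/

import Mathlib

universe u

/-- The two signs: `neg` is the source (backward) side, `pos` the target (forward) side. -/
inductive Sgn
  | neg
  | pos

/-- A hypergraph: sets of `n`-atoms, and for every atom of positive dimension a finite set of
source faces and a finite set of target faces, one dimension lower. -/
structure OmegaHypergraph where
  Atom : ℕ → Type u
  face : Sgn → ∀ {n : ℕ}, Atom (n + 1) → Finset (Atom n)

namespace OmegaHypergraph

variable (P : OmegaHypergraph.{u})

/-- A pre-cell: subsets `c_{-i}` (`c .neg i`) and `c_i` (`c .pos i`) of the `i`-atoms, for all `i`.
A pre-`n`-cell is encoded by setting all its components of dimension above `n` to be empty.  With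
this encoding an `n`-cell and the identity `(n+1)`-cell on it are the same element, so that the
`ω`-category of cells is presented by a single set, as in the one-sorted definition of strict
`ω`-categories. -/
abbrev PreCell : Type u := Sgn → ∀ i : ℕ, Set (P.Atom i)

variable {P}

/-- `S^-` and `S^+`. -/
def faces (ε : Sgn) {n : ℕ} (S : Set (P.Atom (n + 1))) : Set (P.Atom n) :=
  {a | ∃ s ∈ S, a ∈ P.face ε s}

/-- `S^∓ = S^- \ S^+` (for `neg`) and `S^± = S^+ \ S^-` (for `pos`). -/
def outer : Sgn → ∀ {n : ℕ}, Set (P.Atom (n + 1)) → Set (P.Atom n)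
  | .neg, _, S => faces .neg S \ faces .pos S
  | .pos, _, S => faces .pos S \ faces .neg S

/-- `S` moves `X` to `Y`. -/
def Moves {n : ℕ} (S : Set (P.Atom (n + 1))) (X Y : Set (P.Atom n)) : Prop :=
  outer .neg S = X \ Y ∧ outer .pos S = Y \ X

/-- Fork-freeness. -/
def ForkFree : ∀ {n : ℕ}, Set (P.Atom n) → Prop
  | 0, S => ∃ a, S = {a}
  | _ + 1, S => ∀ u ∈ S, ∀ v ∈ S, u ≠ v → ∀ ε, ∀ a, a ∈ P.face ε u → a ∉ P.face ε v

/-- `c` is an `n`-cell. -/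
structure IsCell (n : ℕ) (c : P.PreCell) : Prop where
  empty_above : ∀ ε i, n < i → c ε i = ∅
  top_eq : c .neg n = c .pos n
  finite : ∀ ε i, (c ε i).Finite
  forkFree : ∀ ε i, i ≤ n → ForkFree (c ε i)
  moves : ∀ ε i, i < n → Moves (c ε (i + 1)) (c .neg i) (c .pos i)

/-- The `i`-dimensional source `∂_{-i} c` (for `neg`) or target `∂_i c` (for `pos`). -/
def bd (ε : Sgn) (i : ℕ) (c : P.PreCell) : P.PreCell := fun δ j =>
  if j < i then c δ j else if j = i then c ε j else ∅

/-- The composite `d ∘_i c`; meaningful when `∂_i c = ∂_{-i} d`. -/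
def comp (i : ℕ) (d c : P.PreCell) : P.PreCell := fun δ j =>
  if j < i then c δ j
  else if j = i then
    match δ with
    | .neg => c .neg j
    | .pos => d .pos j
  else c δ j ∪ d δ j

/-- `Descend ε m S i` is the set of `i`-atoms obtained from the set `S` of `m`-atoms by applying
`(-)^∓` (for `neg`) or `(-)^±` (for `pos`) `m - i` times; it is empty for `i > m`. -/
inductive Descend (ε : Sgn) : ∀ m : ℕ, Set (P.Atom m) → ∀ i : ℕ, P.Atom i → Prop
  | top {m : ℕ} {S : Set (P.Atom m)} {a : P.Atom m} (h : a ∈ S) : Descend ε m S m a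
  | step {m : ℕ} {S : Set (P.Atom (m + 1))} {i : ℕ} {a : P.Atom i}
      (h : Descend ε m (outer ε S) i a) : Descend ε (m + 1) S i a

/-- The pre-cell `⟨x⟩` of an atom `x`. -/
def atomCell {m : ℕ} (x : P.Atom m) : P.PreCell := fun ε i => {a | Descend ε m {x} i a}

/-- The relation `x ◁_{n-1} y` on `n`-atoms: some target face of `x` is a source face of `y`. -/
def Tri : ∀ {n : ℕ}, P.Atom n → P.Atom n → Prop
  | 0, _, _ => False
  | _ + 1, x, y => ∃ a, a ∈ P.face .pos x ∧ a ∈ P.face .neg y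

/-- `◁_X`: the transitive closure of the restriction of `◁` to a set `X` of `n`-atoms. -/
def TriIn {n : ℕ} (X : Set (P.Atom n)) : P.Atom n → P.Atom n → Prop :=
  Relation.TransGen fun x y => x ∈ X ∧ y ∈ X ∧ Tri x y

/-- `U ◁_X V` for subsets `U`, `V`. -/
def SetTriIn {n : ℕ} (X U V : Set (P.Atom n)) : Prop := ∃ u ∈ U, ∃ v ∈ V, TriIn X u v

/-- `U` is a segment for `◁_X`. -/
def IsSegment {n : ℕ} (X U : Set (P.Atom n)) : Prop :=
  ∀ u ∈ U, ∀ w ∈ U, ∀ v ∈ X, TriIn X u v → TriIn X v w → v ∈ U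

/-- `x` and `y` are in torsion with respect to the `n`-cell `Z`. -/
def InTorsion {i j : ℕ} (n : ℕ) (x : P.Atom i) (y : P.Atom j) (Z : P.PreCell) : Prop :=
  atomCell x .pos n ⊆ Z .pos n ∧ atomCell y .neg n ⊆ Z .pos n ∧
    atomCell x .pos n ∩ atomCell y .neg n = ∅ ∧
    SetTriIn (Z .pos n) (atomCell x .pos n) (atomCell y .neg n) ∧
    SetTriIn (Z .pos n) (atomCell y .neg n) (atomCell x .pos n)

variable (P) in
/-- Forest's axioms for torsion-free complexes. -/
structure IsTorsionFreeComplex : Prop where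
  nonempty : ∀ (n : ℕ) (x : P.Atom (n + 1)) (ε : Sgn), (P.face ε x).Nonempty
  acyclic : ∀ (n : ℕ) (x : P.Atom n), ¬ Relation.TransGen Tri x x
  relevance : ∀ (n : ℕ) (x : P.Atom n), IsCell n (atomCell x)
  segment : ∀ (n m : ℕ) (x : P.Atom m) (X : P.PreCell) (ε : Sgn), n < m → IsCell n X →
    atomCell x ε n ⊆ X .pos n → IsSegment (X .pos n) (atomCell x ε n)
  torsionFree : ∀ (n i j : ℕ) (x : P.Atom i) (y : P.Atom j) (Z : P.PreCell),
    0 < n → n < i → n < j → IsCell n Z → ¬ InTorsion n x y Z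

/-- The atoms of the smallest subcomplex containing (all atoms occurring in) `c`. -/
inductive InClosure (c : P.PreCell) : ∀ {i : ℕ}, P.Atom i → Prop
  | base {i : ℕ} {a : P.Atom i} (ε : Sgn) (h : a ∈ c ε i) : InClosure c a
  | face {i : ℕ} {x : P.Atom (i + 1)} {a : P.Atom i} (ε : Sgn) (hx : InClosure c x)
      (h : a ∈ P.face ε x) : InClosure c a

/-- `c` is a cell of the `ω`-category freely generated by the smallest subcomplex containing
`μ`. -/
def IsCellBelow (μ c : P.PreCell) : Prop :=
  (∃ m, IsCell m c) ∧ ∀ ε i, ∀ a ∈ c ε i, InClosure μ a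

/-- `θ` is a subcategory of that `ω`-category. -/
structure IsSubcategory (μ : P.PreCell) (θ : Set P.PreCell) : Prop where
  cell : ∀ c ∈ θ, IsCellBelow μ c
  bd_mem : ∀ c ∈ θ, ∀ ε i, bd ε i c ∈ θ
  comp_mem : ∀ c ∈ θ, ∀ d ∈ θ, ∀ i, bd .pos i c = bd .neg i d → comp i d c ∈ θ

end OmegaHypergraph

/-- The objects of Joyal's category `Θ`: `pt` is the terminal category `[0]` and `cons A T` is the
wedge sum `ΣA ∨ T`, gluing the sink of the suspension `ΣA` to the source of `T`.  Thus
`ΣA₁ ∨ ⋯ ∨ ΣAₘ` is `cons A₁ (cons A₂ (⋯ (cons Aₘ pt)))`. -/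
inductive ThetaShape
  | pt
  | cons (A T : ThetaShape)

namespace ThetaShape

mutual
/-- The cells of the strict `ω`-category `T` whose `0`-dimensional source is the first object of
`T`: either that object, or, for `T = ΣA ∨ T'`, the composite along `∘_0` of the suspension of a
cell `a` of `A` and a cell `p` of `T'` starting at the first object of `T'`. -/
inductive Path : ThetaShape → Type
  | here {T : ThetaShape} : Path T
  | step {A T : ThetaShape} (a : Cell A) (p : Path T) : Path (cons A T)
/-- The cells (of all dimensions, identities not distinguished from what they are identities of)
of the strict `ω`-category `T`: a cell which starts at the first object, or, for `T = ΣA ∨ T'`, a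
cell of `T'`. -/
inductive Cell : ThetaShape → Type
  | start {T : ThetaShape} (p : Path T) : Cell T
  | skip {A T : ThetaShape} (c : Cell T) : Cell (cons A T)
end

/-- The `0`-dimensional target of a path. -/
def Path.last : ∀ {T : ThetaShape}, Path T → Cell T
  | _, .here => .start .here
  | _, .step _ p => .skip p.last

mutual
/-- The `(i+1)`-dimensional source or target of a path. -/
def Path.bdSucc (ε : Sgn) (i : ℕ) : ∀ {T : ThetaShape}, Path T → Path T
  | _, .here => .here
  | _, .step a p => .step (Cell.bd ε i a) (Path.bdSucc ε i p)
/-- The `i`-dimensional source or target of a cell. -/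
def Cell.bd (ε : Sgn) (i : ℕ) : ∀ {T : ThetaShape}, Cell T → Cell T
  | _, .start p =>
    match i, ε with
    | 0, .neg => .start .here
    | 0, .pos => p.last
    | i + 1, ε => .start (Path.bdSucc ε i p)
  | _, .skip c => .skip (Cell.bd ε i c)
end

/-- Concatenation of a path with a cell which starts where the path ends (junk otherwise). -/
def Path.append : ∀ {T : ThetaShape}, Path T → Cell T → Path T
  | _, .here, .start q => q
  | _, .here, .skip _ => .here
  | _, .step a p, .skip c => .step a (p.append c)
  | _, .step a p, .start _ => .step a p

mutual
/-- The composite `q ∘_{i+1} p` of two parallel paths. -/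
def Path.compSucc (i : ℕ) : ∀ {T : ThetaShape}, Path T → Path T → Path T
  | _, .step b q, .step a p => .step (Cell.comp i b a) (Path.compSucc i q p)
  | _, .here, p => p
  | _, .step b q, .here => .step b q
/-- The composite `d ∘_i c`; meaningful when `∂_i c = ∂_{-i} d` (junk otherwise). -/
def Cell.comp (i : ℕ) : ∀ {T : ThetaShape}, Cell T → Cell T → Cell T
  | _, .skip d, .skip c => .skip (Cell.comp i d c)
  | _, .start q, .start p =>
    match i with
    | 0 => .start (p.append (.start q))
    | i + 1 => .start (Path.compSucc i q p)
  | _, .skip d, .start p =>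
    match i with
    | 0 => .start (p.append (.skip d))
    | _ + 1 => .start p
  | _, .start _, .skip c => .skip c
end

/-- `T` is an object of `Θ_{n,S}`: it has dimension at most `n` and is assembled from its
generating cells using `∘_i` only for `i ∈ S`, i.e. nontrivial wedge sums may occur under an
`i`-fold suspension only if `i ∈ S`. -/
def InTheta : ℕ → Set ℕ → ThetaShape → Prop
  | _, _, pt => True
  | n, S, cons A T =>
    0 < n ∧ InTheta (n - 1) {i | i + 1 ∈ S} A ∧ InTheta n S T ∧ (T = pt ∨ 0 ∈ S)

end ThetaShape

namespace OmegaHypergraph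

variable {P : OmegaHypergraph.{u}}

/-- The set `θ` of cells, with the operations of the `ω`-category of cells, is isomorphic to the
strict `ω`-category `T`. -/
def IsoToShape (θ : Set P.PreCell) (T : ThetaShape) : Prop :=
  ∃ f : T.Cell → P.PreCell, Function.Injective f ∧ Set.range f = θ ∧
    (∀ ε i x, f (x.bd ε i) = bd ε i (f x)) ∧
    ∀ i (x y : T.Cell), x.bd .pos i = y.bd .neg i → f (.comp i y x) = comp i (f y) (f x)

/-- The subcategory consisting of the `n`-cell `μ` and its iterated sources and targets (recall
`∂_n μ = μ`). -/
def globe (μ : P.PreCell) : Set P.PreCell := {c | ∃ ε i, c = bd ε i μ}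

/-- The poset (under inclusion) of proper decompositions of the `n`-cell `μ` using only `∘_i`
composition for `i ∈ S`: subcategories `θ`, containing `μ`, of the `ω`-category generated by the
subcomplex spanned by `μ`, which are isomorphic to an object of `Θ_{n,S}`, apart from the trivial
decomposition `μ`. -/
def Sd (n : ℕ) (S : Set ℕ) (μ : P.PreCell) : Set (Set P.PreCell) :=
  {θ | IsSubcategory μ θ ∧ μ ∈ θ ∧ (∃ T : ThetaShape, T.InTheta n S ∧ IsoToShape θ T) ∧
    θ ≠ globe μ}

/-- The equivalence relation on `(∂_k μ)_k` generated by declaring two elements equivalent if both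
lie in `(∂_k ⟨x⟩)_k` for some atom `x`, of dimension at least `k + 1`, of the subcomplex spanned by
`μ`. -/
def AtEquiv (μ : P.PreCell) (k : ℕ) : μ .pos k → μ .pos k → Prop :=
  Relation.EqvGen fun a b => ∃ (m : ℕ) (x : P.Atom m), k < m ∧ InClosure μ x ∧
    a.1 ∈ atomCell x .pos k ∧ b.1 ∈ atomCell x .pos k

/-- The preorder `At_k(μ)` on `(∂_k μ)_k`, generated by the equivalence `AtEquiv μ k` and by
declaring `a ≤ b` if `a ◁_{k-1} b`. -/
def At (μ : P.PreCell) (k : ℕ) : μ .pos k → μ .pos k → Prop :=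
  Relation.ReflTransGen fun a b => AtEquiv μ k a b ∨ Tri a.1 b.1

/-- `At_k(μ)` is an equivalence relation: the preorder is nothing more than the equivalence
relation which is declared to generate its equivalence classes. -/
def AtIsEquivalence (μ : P.PreCell) (k : ℕ) : Prop :=
  ∀ a b : μ .pos k, At μ k a b ↔ AtEquiv μ k a b

/-- A linear preorder which refines the relation `r` and is not codiscrete. -/
structure Lin {S : Type u} (r : S → S → Prop) where
  le : S → S → Prop
  refl : ∀ a, le a a
  trans : ∀ a b c, le a b → le b c → le a c
  total : ∀ a b, le a b ∨ le b a
  refines : ∀ a b, r a b → le a b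
  not_codiscrete : ¬ ∀ a b, le a b

theorem Lin.le_injective {S : Type u} {r : S → S → Prop} :
    Function.Injective (Lin.le : Lin r → S → S → Prop) := by
  rintro ⟨l, _, _, _, _, _⟩ ⟨l', _, _, _, _, _⟩ h
  cases h
  rfl

/-- Linear preorders are ordered by reverse refinement (reverse containment). -/
instance {S : Type u} {r : S → S → Prop} : PartialOrder (Lin r) where
  le L L' := ∀ a b, L'.le a b → L.le a b
  le_refl _ _ _ h := h
  le_trans _ _ _ h h' a b x := h a b (h' a b x)
  le_antisymm _ _ h h' :=
    Lin.le_injective (funext fun a => funext fun b => propext ⟨h' a b, h a b⟩)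

/-- The generating cells of a subcategory `θ`: cells which do not decompose nontrivially in `θ`
(a composition `d ∘_i c` is trivial if `c` or `d` is an identity on an `i`-cell). -/
def IsGenerator (θ : Set P.PreCell) (g : P.PreCell) : Prop :=
  g ∈ θ ∧ ∀ i, ∀ c ∈ θ, ∀ d ∈ θ, bd .pos i c = bd .neg i d → comp i d c = g →
    bd .pos i c = c ∨ bd .neg i d = d

/-- The preorder `L_k^μ(θ)` on `(∂_k μ)_k`, generated by declaring `a` and `b` to be equivalent if
they are in the support `(∂_k g)_k` of the same generator `g` of `θ`, and `a` to be below `b` if `a`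
and `b` are in the supports of generators `g` and `h` for which `h ∘_{k-1} g` is defined. -/
def L (μ : P.PreCell) (k : ℕ) (θ : Set P.PreCell) : μ .pos k → μ .pos k → Prop :=
  Relation.ReflTransGen fun a b =>
    (∃ g, IsGenerator θ g ∧ a.1 ∈ g .pos k ∧ b.1 ∈ g .pos k) ∨
    ∃ g h, IsGenerator θ g ∧ IsGenerator θ h ∧ a.1 ∈ g .pos k ∧ b.1 ∈ h .pos k ∧
      bd .pos (k - 1) g = bd .neg (k - 1) h

end OmegaHypergraph

-- The engine is a gluing theorem. If a finite fork-free set S of (n+1)-atoms has its outer source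
-- faces in the top component of an n-cell X, then the target faces of S are new, and applying S to
-- X gives an n-cell again (`Gluing`). It is proved by induction on n, for the hypergraph and its
-- opposite together. Acyclicity reduces it to a single atom x. The segment axiom then cuts X into
-- what precedes x^-, x^- itself and the rest, so that x^- can be replaced by x^+ without clashes
-- (`gluing_succ`). It follows that every atom in the closure of a cell lies in a cell parallel to
-- its boundary (`exists_parallel`), that ∘_i-composable cells have no atoms above dimension i in
-- common, even after closure (`disjoint_closure`), and that composites are cells.
--
-- The hypothesis on At_i for i > k enters through the maximal atoms of μ, those lying both in its
-- source and in its target. Descend from dimension n to k. If comparable target atoms are always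
-- equivalent, then faces of different maximal atoms never cancel, so taking outer faces commutes
-- with the union over the maximal atoms. Hence in dimensions at least k the cell μ is the disjoint
-- union of the cells ⟨z⟩ of its maximal atoms z (`isSplit`).
--
-- Write k = q + 1. A factorization μ = d ∘_q c is now determined by the set U of k-atoms in the
-- target of c; such a U is closed under ◁-predecessors and consists of whole sets ⟨z⟩_k (`cut`).
-- Conversely two nested sets U ⊆ V of this kind bound a cell, `piece μ q U V` (`isCell_piece`).
--
-- A shape using only ∘_q is a string of globes glued along q-cells (`exists_isString`), so θ
-- amounts to a chain ∅ = U_0 ⊂ ... ⊂ U_r = μ_k with r ≥ 2 (`exists_isDecomposition`). The pieces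
-- between neighbours are generators, and every generator with k-atoms lives in one layer. Therefore
-- a ≤ b in L(θ) exactly when each U_p containing b contains a (`L_iff`): a linear preorder
-- containing At_k, and not codiscrete because r ≥ 2. Conversely, the initial segments of a linear
-- preorder containing At_k form such a chain, which is realized by a wedge of globes suspended q
-- times (`exists_mem_Sd`). The preorder and its chain of initial segments determine each other, and
-- θ ⊆ θ' means that the chain of θ is part of that of θ', that is, L(θ') is contained in L(θ).

/-- The opposite sign. -/
def Sgn.flip : Sgn → Sgn
  | .neg => .pos
  | .pos => .neg

@[simp] theorem Sgn.flip_flip (ε : Sgn) : ε.flip.flip = ε := by cases ε <;> rfl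

namespace OmegaHypergraph

variable {P : OmegaHypergraph.{u}}

variable (P) in
/-- The axioms of a torsion-free complex other than the absence of torsion. -/
structure IsRegular : Prop where
  nonempty : ∀ (n : ℕ) (x : P.Atom (n + 1)) (ε : Sgn), (P.face ε x).Nonempty
  acyclic : ∀ (n : ℕ) (x : P.Atom n), ¬ Relation.TransGen Tri x x
  relevance : ∀ (n : ℕ) (x : P.Atom n), IsCell n (atomCell x)
  segment : ∀ (n m : ℕ) (x : P.Atom m) (X : P.PreCell) (ε : Sgn), n < m → IsCell n X →
    atomCell x ε n ⊆ X .pos n → IsSegment (X .pos n) (atomCell x ε n)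

theorem IsTorsionFreeComplex.isRegular (h : P.IsTorsionFreeComplex) : P.IsRegular :=
  ⟨h.nonempty, h.acyclic, h.relevance, h.segment⟩

/-! ### Faces and outer faces -/

theorem mem_faces {ε : Sgn} {n : ℕ} {S : Set (P.Atom (n + 1))} {a : P.Atom n} :
    a ∈ faces ε S ↔ ∃ s ∈ S, a ∈ P.face ε s := Iff.rfl

theorem faces_mono {ε : Sgn} {n : ℕ} {S T : Set (P.Atom (n + 1))} (h : S ⊆ T) :
    faces ε S ⊆ faces ε T := fun _ ⟨s, hs, ha⟩ => ⟨s, h hs, ha⟩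

theorem faces_union {ε : Sgn} {n : ℕ} (S T : Set (P.Atom (n + 1))) :
    faces ε (S ∪ T) = faces ε S ∪ faces ε T := by
  ext a; simp only [mem_faces, Set.mem_union]; grind

@[simp] theorem faces_empty {ε : Sgn} {n : ℕ} :
    faces ε (∅ : Set (P.Atom (n + 1))) = ∅ := by
  ext a; simp [mem_faces]

theorem faces_singleton {ε : Sgn} {n : ℕ} (x : P.Atom (n + 1)) :
    faces ε {x} = (P.face ε x : Set (P.Atom n)) := by
  ext a; simp [mem_faces]

theorem outer_eq (ε : Sgn) {n : ℕ} (S : Set (P.Atom (n + 1))) :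
    outer ε S = faces ε S \ faces ε.flip S := by cases ε <;> rfl

@[simp] theorem outer_empty (ε : Sgn) {n : ℕ} : outer ε (∅ : Set (P.Atom (n + 1))) = ∅ := by
  simp [outer_eq]

theorem outer_subset_faces (ε : Sgn) {n : ℕ} (S : Set (P.Atom (n + 1))) :
    outer ε S ⊆ faces ε S := by rw [outer_eq]; exact Set.sdiff_subset

/-- The outer faces of a union of sets without common source faces and without common target faces
depend only on the outer faces of the sets. -/
theorem outer_union (ε : Sgn) {n : ℕ} {S T : Set (P.Atom (n + 1))}
    (h : ∀ δ, ∀ a ∈ faces δ S, a ∉ faces δ T) :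
    outer ε (S ∪ T) = (outer ε S \ outer ε.flip T) ∪ (outer ε T \ outer ε.flip S) := by
  ext a
  have h1 := h ε a
  have h2 := h ε.flip a
  simp only [outer_eq, faces_union, Set.mem_union, Set.mem_sdiff, Sgn.flip_flip]
  tauto

/-- The outer faces of a union of a family of sets with no common source faces and no common target
faces. -/
theorem mem_outer_iUnion {ι : Type*} (ε : Sgn) {n : ℕ} (I : Set ι)
    (S : ι → Set (P.Atom (n + 1)))
    (h : ∀ δ, ∀ i ∈ I, ∀ j ∈ I, i ≠ j → ∀ a ∈ faces δ (S i), a ∉ faces δ (S j)) (a : P.Atom n) :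
    a ∈ outer ε {x | ∃ i ∈ I, x ∈ S i} ↔
      (∃ i ∈ I, a ∈ outer ε (S i)) ∧ ∀ i ∈ I, a ∉ outer ε.flip (S i) := by
  simp only [outer_eq, Set.mem_sdiff, mem_faces, Set.mem_ofPred_eq, Sgn.flip_flip]
  constructor
  · rintro ⟨⟨s, ⟨i, hi, hs⟩, ha⟩, hn⟩
    refine ⟨⟨i, hi, ⟨s, hs, ha⟩, fun ⟨t, ht, hta⟩ => hn ⟨t, ⟨i, hi, ht⟩, hta⟩⟩, ?_⟩
    rintro j hj ⟨⟨t, ht, hta⟩, -⟩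
    exact hn ⟨t, ⟨j, hj, ht⟩, hta⟩
  · rintro ⟨⟨i, hi, ⟨s, hs, ha⟩, hn⟩, hall⟩
    refine ⟨⟨s, ⟨i, hi, hs⟩, ha⟩, ?_⟩
    rintro ⟨t, ⟨j, hj, ht⟩, hta⟩
    refine hall j hj ⟨⟨t, ht, hta⟩, ?_⟩
    by_cases hij : i = j
    · subst hij; exact absurd ⟨t, ht, hta⟩ hn
    · exact h ε i hi j hj hij a ⟨s, hs, ha⟩

theorem forkFree_succ {n : ℕ} {S : Set (P.Atom (n + 1))} :
    ForkFree S ↔ ∀ u ∈ S, ∀ v ∈ S, ∀ ε a, a ∈ P.face ε u → a ∈ P.face ε v → u = v := by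
  constructor
  · intro h u hu v hv ε a ha hb
    by_contra huv
    exact h u hu v hv huv ε a ha hb
  · intro h u hu v hv huv ε a ha hb
    exact huv (h u hu v hv ε a ha hb)

theorem ForkFree.subset {n : ℕ} {S T : Set (P.Atom (n + 1))} (h : ForkFree T) (hST : S ⊆ T) :
    ForkFree S := fun u hu v hv => h u (hST hu) v (hST hv)

theorem forkFree_empty {n : ℕ} : ForkFree (∅ : Set (P.Atom (n + 1))) := fun _ hu => hu.elim

theorem ForkFree.union {n : ℕ} {S T : Set (P.Atom (n + 1))} (hS : ForkFree S) (hT : ForkFree T)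
    (h : ∀ δ, ∀ a ∈ faces δ S, a ∉ faces δ T) : ForkFree (S ∪ T) := by
  rw [forkFree_succ] at *
  rintro u (hu | hu) v (hv | hv) ε a hau hav
  · exact hS u hu v hv ε a hau hav
  · exact absurd ⟨v, hv, hav⟩ (h ε a ⟨u, hu, hau⟩)
  · exact absurd ⟨u, hu, hau⟩ (h ε a ⟨v, hv, hav⟩)
  · exact hT u hu v hv ε a hau hav

theorem ForkFree.eq {n : ℕ} {S : Set (P.Atom (n + 1))} (h : ForkFree S) {u v : P.Atom (n + 1)}
    (hu : u ∈ S) (hv : v ∈ S) {ε : Sgn} {a : P.Atom n} (ha : a ∈ P.face ε u)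
    (hb : a ∈ P.face ε v) : u = v := forkFree_succ.1 h u hu v hv ε a ha hb

theorem IsCell.outer {m i : ℕ} {c : P.PreCell} (h : IsCell m c) (hi : i < m) (ε δ : Sgn) :
    outer δ (c ε (i + 1)) = c δ i \ c δ.flip i := by
  cases δ
  · exact (h.moves ε i hi).1
  · exact (h.moves ε i hi).2

/-! ### Acyclicity -/

theorem IsRegular.not_tri_self (hP : P.IsRegular) {n : ℕ} (x : P.Atom n) : ¬ Tri x x :=
  fun h => hP.acyclic n x (.single h)

theorem IsRegular.disjoint_face (hP : P.IsRegular) {n : ℕ} {x : P.Atom (n + 1)} {a : P.Atom n}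
    (h : a ∈ P.face .neg x) : a ∉ P.face .pos x := fun h' => hP.not_tri_self x ⟨a, h', h⟩

/-- The transitive closure of ◁ is a strict order by acyclicity, hence well-founded on a finite set.
-/
theorem IsRegular.exists_minimal (hP : P.IsRegular) {n : ℕ} {S : Set (P.Atom n)} (hS : S.Finite)
    (hne : S.Nonempty) : ∃ x ∈ S, ∀ y ∈ S, ¬ Tri y x := by
  have : IsStrictOrder (P.Atom n) (Relation.TransGen Tri) :=
    { irrefl := hP.acyclic n, trans := fun _ _ _ => Relation.TransGen.trans }
  obtain ⟨⟨x, hx⟩, -, hmin⟩ := (hS.wellFoundedOn (r := Relation.TransGen Tri)).has_min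
    Set.univ ⟨⟨_, hne.some_mem⟩, trivial⟩
  exact ⟨x, hx, fun y hy hyx => hmin ⟨y, hy⟩ trivial (.single hyx)⟩

/-! ### The opposite hypergraph -/

/-- The hypergraph with sources and targets interchanged in all dimensions. -/
abbrev op (P : OmegaHypergraph.{u}) : OmegaHypergraph.{u} where
  Atom := P.Atom
  face ε _ x := P.face ε.flip x

/-- A pre-cell of `P`, as a pre-cell of the opposite hypergraph. -/
def opCell (c : P.PreCell) : P.op.PreCell := fun ε i => c ε.flip i

/-- A pre-cell of the opposite hypergraph, as a pre-cell of `P`. -/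
def unopCell (c : P.op.PreCell) : P.PreCell := fun ε i => c ε.flip i

theorem opCell_unopCell (c : P.op.PreCell) : opCell (unopCell c) = c := by
  funext ε i; simp only [opCell, unopCell, Sgn.flip_flip]

theorem outer_op (ε : Sgn) {n : ℕ} (S : Set (P.Atom (n + 1))) :
    outer (P := P.op) ε S = outer (P := P) ε.flip S := by cases ε <;> rfl

theorem forkFree_op {n : ℕ} {S : Set (P.Atom n)} :
    ForkFree (P := P.op) S ↔ ForkFree (P := P) S := by
  cases n with
  | zero => exact Iff.rfl
  | succ n =>
    constructor
    · intro h u hu v hv huv ε a ha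
      have := h u hu v hv huv ε.flip a
      simp only [op, Sgn.flip_flip] at this
      exact this ha
    · intro h u hu v hv huv ε a ha
      exact h u hu v hv huv ε.flip a ha

theorem moves_op {n : ℕ} {S : Set (P.Atom (n + 1))} {X Y : Set (P.Atom n)} :
    Moves (P := P.op) S X Y ↔ Moves (P := P) S Y X := and_comm

theorem isCell_op {n : ℕ} {c : P.PreCell} : IsCell n (opCell c) ↔ IsCell n c := by
  have e : ∀ ε i, c ε i = opCell c ε.flip i := fun ε i => by simp [opCell]
  constructor
  · intro h
    refine ⟨fun ε i hi => ?_, h.top_eq.symm, fun ε i => ?_, fun ε i hi => ?_, fun ε i hi => ?_⟩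
    · rw [e]; exact h.empty_above _ i hi
    · rw [e]; exact h.finite _ i
    · rw [e]; exact forkFree_op.1 (h.forkFree _ i hi)
    · rw [e ε]; exact moves_op.1 (h.moves _ i hi)
  · intro h
    exact ⟨fun ε i hi => h.empty_above _ i hi, h.top_eq.symm, fun ε i => h.finite _ i,
      fun ε i hi => forkFree_op.2 (h.forkFree _ i hi), fun ε i hi => moves_op.2 (h.moves _ i hi)⟩

theorem isCell_unop {n : ℕ} {c : P.op.PreCell} : IsCell n (unopCell c) ↔ IsCell n c := by
  rw [← isCell_op, opCell_unopCell]

theorem tri_op {n : ℕ} {x y : P.Atom n} : Tri (P := P.op) x y ↔ Tri (P := P) y x := by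
  cases n with
  | zero => exact Iff.rfl
  | succ n => exact exists_congr fun a => and_comm

theorem triIn_op {n : ℕ} {X : Set (P.Atom n)} {x y : P.Atom n} :
    TriIn (P := P.op) X x y ↔ TriIn (P := P) X y x := by
  have : (fun x y => x ∈ X ∧ y ∈ X ∧ Tri (P := P.op) x y) =
      Function.swap fun x y => x ∈ X ∧ y ∈ X ∧ Tri (P := P) x y := by
    funext x y
    simp only [Function.swap, tri_op, eq_iff_iff]
    tauto
  change Relation.TransGen _ x y ↔ Relation.TransGen _ y x
  rw [this, Relation.transGen_swap]

theorem Descend.le {ε : Sgn} {m : ℕ} {S : Set (P.Atom m)} {i : ℕ} {a : P.Atom i}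
    (h : Descend ε m S i a) : i ≤ m := by
  induction h with
  | top h => exact le_rfl
  | step _ ih => exact ih.trans (Nat.le_succ _)

theorem descend_self {ε : Sgn} {m : ℕ} {S : Set (P.Atom m)} {a : P.Atom m} :
    Descend ε m S m a ↔ a ∈ S := by
  refine ⟨fun h => ?_, .top⟩
  cases m with
  | zero => cases h with | top h => exact h
  | succ m =>
    cases h with
    | top h => exact h
    | step h => exact absurd h.le (by omega)

theorem descend_succ {ε : Sgn} {m : ℕ} {S : Set (P.Atom (m + 1))} {i : ℕ} {a : P.Atom i}
    (hi : i ≤ m) : Descend ε (m + 1) S i a ↔ Descend ε m (outer ε S) i a := by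
  refine ⟨fun h => ?_, .step⟩
  cases h with
  | top h => omega
  | step h => exact h

theorem descend_op {ε : Sgn} {m : ℕ} {S : Set (P.Atom m)} {i : ℕ} {a : P.Atom i} :
    @Descend P.op ε m S i a ↔ @Descend P ε.flip m S i a := by
  induction m with
  | zero =>
    rcases Nat.eq_zero_or_pos i with rfl | hi
    · rw [descend_self, descend_self]
    · exact iff_of_false (fun h => by have := h.le; omega) (fun h => by have := h.le; omega)
  | succ m ih =>
    rcases lt_trichotomy i (m + 1) with hi | rfl | hi
    · rw [descend_succ (Nat.lt_succ_iff.1 hi), descend_succ (Nat.lt_succ_iff.1 hi), ih, outer_op]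
    · rw [descend_self, descend_self]
    · exact iff_of_false (fun h => by have := h.le; omega) (fun h => by have := h.le; omega)

theorem atomCell_op {m : ℕ} (x : P.Atom m) :
    atomCell (P := P.op) x = opCell (atomCell (P := P) x) := by
  funext ε i
  ext a
  exact descend_op (P := P) (ε := ε) (m := m) (S := {x}) (i := i) (a := a)

/-- Duality turns results about sources into results about targets. The segment axiom mentions only
the target component in the top dimension; for a cell this equals the source component, so reversing
the cell does no harm. -/
theorem IsRegular.op (hP : P.IsRegular) : P.op.IsRegular where
  nonempty n x ε := hP.nonempty n x ε.flip
  acyclic n x h := by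
    refine hP.acyclic n x ((Relation.transGen_swap (r := Tri (P := P))).1 ?_)
    exact Relation.TransGen.mono (fun a b h => tri_op.1 h) _ _ h
  relevance n x := (congrArg (IsCell n) (atomCell_op (P := P) x)).mpr
    (isCell_op.2 (hP.relevance n x))
  segment n m x X ε hnm hX hsub := by
    have e : atomCell (P := P.op) x ε n = atomCell (P := P) x ε.flip n :=
      congrFun (congrFun (atomCell_op (P := P) x) ε) n
    have htop : unopCell X .pos n = X .pos n := (isCell_unop.2 hX).top_eq.symm
    have h := hP.segment n m x (unopCell X) ε.flip hnm (isCell_unop.2 hX)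
      (fun a ha => htop.symm ▸ hsub (e.symm ▸ ha))
    rw [htop] at h
    intro u hu w hw v hv huv hvw
    exact e.symm ▸ h w (e ▸ hw) u (e ▸ hu) v hv (triIn_op.1 hvw) (triIn_op.1 huv)

/-- A source face of a ◁-minimal element is a target face of no element of S. The other sign is the
same argument in the opposite hypergraph. -/
theorem IsRegular.outer_nonempty (hP : P.IsRegular) {n : ℕ} {S : Set (P.Atom (n + 1))}
    (hS : S.Finite) (hne : S.Nonempty) (ε : Sgn) : (outer ε S).Nonempty := by
  have key : ∀ {P : OmegaHypergraph.{u}}, P.IsRegular → ∀ {S : Set (P.Atom (n + 1))}, S.Finite →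
      S.Nonempty → (outer .neg S).Nonempty := by
    intro P hP S hS hne
    obtain ⟨x, hx, hmin⟩ := hP.exists_minimal hS hne
    obtain ⟨a, ha⟩ := hP.nonempty n x .neg
    exact ⟨a, ⟨x, hx, ha⟩, fun ⟨y, hy, hya⟩ => hmin y hy ⟨a, hya, ha⟩⟩
  cases ε
  · exact key hP hS hne
  · exact key hP.op hS hne

/-! ### Boundaries of cells and cells of atoms -/

/-- `Descend` peels from the top dimension; this is the recursion at the lower end, as in the usual
definition of ⟨x⟩. -/
theorem descend_eq_outer {ε : Sgn} {m : ℕ} {S : Set (P.Atom m)} {i : ℕ} (hi : i < m) :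
    {a | Descend ε m S i a} = outer ε {a | Descend ε m S (i + 1) a} := by
  induction m with
  | zero => omega
  | succ m ih =>
    have e : {a | Descend ε (m + 1) S i a} = {a | Descend ε m (outer ε S) i a} := by
      ext a; exact descend_succ (by omega)
    rw [e]
    rcases Nat.lt_succ_iff_lt_or_eq.1 hi with h | rfl
    · rw [ih h]
      congr 1
      ext a; exact (descend_succ h).symm
    · have h1 : {a | Descend ε i (outer ε S) i a} = outer ε S := by ext a; exact descend_self
      have h2 : {a | Descend ε (i + 1) S (i + 1) a} = S := by ext a; exact descend_self
      rw [h1, h2]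

theorem atomCell_self {m : ℕ} (x : P.Atom m) (ε : Sgn) : atomCell x ε m = {x} := by
  ext a; exact descend_self

theorem atomCell_of_lt {m i : ℕ} (x : P.Atom m) (ε : Sgn) (h : m < i) : atomCell x ε i = ∅ := by
  ext a; exact iff_of_false (fun hd => by have := Descend.le hd; omega) (fun h => h)

theorem atomCell_eq_outer {m i : ℕ} (x : P.Atom m) (ε : Sgn) (h : i < m) :
    atomCell x ε i = outer ε (atomCell x ε (i + 1)) := descend_eq_outer h

theorem IsRegular.atomCell_face (hP : P.IsRegular) {m : ℕ} (x : P.Atom (m + 1)) (ε : Sgn) :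
    atomCell x ε m = (P.face ε x : Set (P.Atom m)) := by
  rw [atomCell_eq_outer x ε (Nat.lt_succ_self m), atomCell_self, outer_eq, faces_singleton,
    faces_singleton]
  ext a
  have := @hP.disjoint_face P m x a
  cases ε <;> simp only [Sgn.flip, Set.mem_sdiff, Finset.mem_coe] <;> tauto

/-- Outer faces of the components of the cell of an atom. -/
theorem IsRegular.outer_atomCell (hP : P.IsRegular) {m i : ℕ} (x : P.Atom m) (ε δ : Sgn)
    (h : i < m) : outer δ (atomCell x ε (i + 1)) = atomCell x δ i := by
  rw [atomCell_eq_outer x δ h]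
  rw [(hP.relevance m x).outer h, (hP.relevance m x).outer h]

theorem IsRegular.disjoint_atomCell (hP : P.IsRegular) {m i : ℕ} (x : P.Atom m) (ε : Sgn)
    (h : i < m) {a : P.Atom i} (ha : a ∈ atomCell x ε i) : a ∉ atomCell x ε.flip i := by
  rw [atomCell_eq_outer x ε h, (hP.relevance m x).outer h] at ha
  exact ha.2

/-- Identities on a cell are not distinguished from the cell, so cells of different dimensions can
be brought to a common one. -/
theorem IsCell.mono {m n : ℕ} {c : P.PreCell} (h : IsCell m c) (hmn : m ≤ n) : IsCell n c := by
  rcases hmn.eq_or_lt with rfl | hlt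
  · exact h
  refine ⟨fun ε i hi => h.empty_above ε i (by omega), ?_, h.finite, fun ε i hi => ?_,
    fun ε i hi => ?_⟩
  · rw [h.empty_above _ n hlt, h.empty_above _ n hlt]
  · rcases le_or_gt i m with him | him
    · exact h.forkFree ε i him
    · rw [h.empty_above ε i him]
      obtain ⟨j, rfl⟩ : ∃ j, i = j + 1 := ⟨i - 1, by omega⟩
      exact forkFree_empty
  · rcases lt_or_ge i m with him | him
    · exact h.moves ε i him
    · rw [h.empty_above ε (i + 1) (by omega)]
      have : c .neg i = c .pos i := by
        rcases him.eq_or_lt with rfl | him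
        · exact h.top_eq
        · rw [h.empty_above _ i him, h.empty_above _ i him]
      constructor <;> simp [this]

theorem bd_of_lt {ε δ : Sgn} {i j : ℕ} {c : P.PreCell} (h : j < i) : bd ε i c δ j = c δ j := by
  simp [bd, h]

@[simp] theorem bd_self {ε δ : Sgn} {i : ℕ} {c : P.PreCell} : bd ε i c δ i = c ε i := by
  simp [bd]

theorem bd_of_gt {ε δ : Sgn} {i j : ℕ} {c : P.PreCell} (h : i < j) : bd ε i c δ j = ∅ := by
  simp [bd, h.not_gt, h.ne']

theorem IsCell.bd {m i : ℕ} {c : P.PreCell} (h : IsCell m c) (him : i ≤ m) (ε : Sgn) :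
    IsCell i (bd ε i c) := by
  refine ⟨fun δ j hj => bd_of_gt hj, by simp, fun δ j => ?_, fun δ j hj => ?_, fun δ j hj => ?_⟩
  · rcases lt_trichotomy j i with hj | rfl | hj
    · rw [bd_of_lt hj]; exact h.finite _ _
    · rw [bd_self]; exact h.finite _ _
    · rw [bd_of_gt hj]; exact Set.finite_empty
  · rcases hj.lt_or_eq with hj | rfl
    · rw [bd_of_lt hj]; exact h.forkFree _ _ (by omega)
    · rw [bd_self]; exact h.forkFree _ _ (by omega)
  · rw [bd_of_lt hj, bd_of_lt hj]
    rcases (Nat.succ_le_of_lt hj).lt_or_eq with hj' | rfl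
    · rw [bd_of_lt hj']; exact h.moves _ _ (by omega)
    · rw [bd_self]; exact h.moves _ _ (by omega)

/-! ### The gluing theorem -/

/-- The result of applying the set `S` of `(n+1)`-atoms to the set `X` of `n`-atoms. -/
def act {n : ℕ} (X : Set (P.Atom n)) (S : Set (P.Atom (n + 1))) : Set (P.Atom n) :=
  (X ∪ faces .pos S) \ faces .neg S

theorem mem_act {n : ℕ} {X : Set (P.Atom n)} {S : Set (P.Atom (n + 1))} {a : P.Atom n} :
    a ∈ act X S ↔ (a ∈ X ∨ a ∈ faces .pos S) ∧ a ∉ faces .neg S := Iff.rfl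

@[simp] theorem act_empty {n : ℕ} {X : Set (P.Atom n)} :
    act X (∅ : Set (P.Atom (n + 1))) = X := by
  ext a; simp [mem_act]

/-- When the target faces are new, the effect of S depends only on its outer faces. This is what
makes x^- and x^+ interchangeable later. -/
theorem act_eq {n : ℕ} {X : Set (P.Atom n)} {S : Set (P.Atom (n + 1))}
    (h : ∀ b ∈ faces .pos S, b ∉ X) : act X S = (X \ outer .neg S) ∪ outer .pos S := by
  ext b
  have := h b
  simp only [mem_act, outer, Set.mem_union, Set.mem_sdiff]
  tauto

theorem faces_finite {n : ℕ} {S : Set (P.Atom (n + 1))} (hS : S.Finite) (ε : Sgn) :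
    (faces ε S).Finite := by
  have : faces ε S = ⋃ s ∈ S, (P.face ε s : Set (P.Atom n)) := by
    ext a; simp [mem_faces]
  rw [this]
  exact hS.biUnion fun s _ => Finset.finite_toSet _

theorem act_finite {n : ℕ} {X : Set (P.Atom n)} {S : Set (P.Atom (n + 1))} (hX : X.Finite)
    (hS : S.Finite) : (act X S).Finite := (hX.union (faces_finite hS _)).sdiff

variable (P) in
/-- The gluing property in dimension `n`: a finite fork-free set of `(n+1)`-atoms can be applied to
every `n`-cell that contains its outer source faces. -/
def Gluing (n : ℕ) : Prop :=
  ∀ (X : P.PreCell) (S : Set (P.Atom (n + 1))), IsCell n X → S.Finite → ForkFree S →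
    outer .neg S ⊆ X .pos n → (∀ b ∈ faces .pos S, b ∉ X .pos n) ∧
      ∃ Y : P.PreCell, IsCell n Y ∧ (∀ ε j, j < n → Y ε j = X ε j) ∧
        Y .pos n = act (X .pos n) S

/-- The dual of the gluing property. -/
theorem Gluing.dual {n : ℕ} (h : Gluing P.op n) {X : P.PreCell} {S : Set (P.Atom (n + 1))}
    (hX : IsCell n X) (hfin : S.Finite) (hS : ForkFree S) (hsub : outer .pos S ⊆ X .pos n) :
    (∀ b ∈ faces .neg S, b ∉ X .pos n) ∧
      ∃ Y : P.PreCell, IsCell n Y ∧ (∀ ε j, j < n → Y ε j = X ε j) ∧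
        Y .pos n = (X .pos n ∪ faces .neg S) \ faces .pos S := by
  obtain ⟨h1, Y, hY, hlow, htop⟩ := h (opCell X) S (isCell_op.2 hX) hfin (forkFree_op.2 hS)
    (by rw [outer_op]; exact fun a ha => hX.top_eq.symm.subset (hsub ha))
  refine ⟨fun b hb hbX => h1 b hb (hX.top_eq.symm.subset hbX), unopCell Y, isCell_unop.2 hY, fun ε j hj => ?_, ?_⟩
  · exact (hlow ε.flip j hj).trans (congrFun (congrArg X (Sgn.flip_flip ε)) j)
  · exact (isCell_unop.2 hY).top_eq.symm.trans (htop.trans (by rw [← hX.top_eq]; rfl))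

/-- If the target faces of `U` and the source faces of `Z` fit on the same cell then the faces of
`U` and `Z` do not interfere. -/
theorem Gluing.disjoint_faces (hP : P.IsRegular) {n : ℕ} (hG : Gluing P n) (hG' : Gluing P.op n)
    {A : P.PreCell} (hA : IsCell n A) {U Z : Set (P.Atom (n + 1))} (hUf : U.Finite)
    (hZf : Z.Finite) (hU : ForkFree U) (hZ : ForkFree Z) (hUA : outer .pos U ⊆ A .pos n)
    (hZA : outer .neg Z ⊆ A .pos n) :
    (∀ b ∈ faces .neg U, b ∉ faces .pos Z) ∧ ∀ δ, ∀ b ∈ faces δ U, b ∉ faces δ Z := by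
  have key : ∀ b ∈ faces .neg U, b ∉ faces .pos Z := by
    rintro b ⟨u, hu, hbu⟩ ⟨z, hz, hbz⟩
    -- Here z ◁ u through b. The part of U reachable from u can be undone from A first, giving a
    -- cell B that contains b. By acyclicity the part of Z leading to z still fits on B; but b is
    -- one of its target faces, which gluing says are not in B.
    let U₁ := {u' | u' ∈ U ∧ Relation.ReflTransGen Tri u u'}
    let Z₁ := {z' | z' ∈ Z ∧ Relation.ReflTransGen Tri z' z}
    have hzu : Tri z u := ⟨b, hbz, hbu⟩
    have hcyc : ∀ u' ∈ U₁, ∀ z' ∈ Z₁, ¬ Tri u' z' := fun u' hu' z' hz' h =>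
      hP.acyclic _ z ((Relation.TransGen.single hzu).trans_left hu'.2 |>.tail h |>.trans_left hz'.2)
    have hU₁ : U₁ ⊆ U := fun _ h => h.1
    have hZ₁ : Z₁ ⊆ Z := fun _ h => h.1
    have hU₁A : outer .pos U₁ ⊆ A .pos n := by
      rintro c ⟨⟨v, hv, hcv⟩, hn⟩
      refine hUA ⟨⟨v, hv.1, hcv⟩, ?_⟩
      rintro ⟨w, hw, hcw⟩
      exact hn ⟨w, ⟨hw, hv.2.tail ⟨c, hcv, hcw⟩⟩, hcw⟩
    have hZ₁A : outer .neg Z₁ ⊆ A .pos n := by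
      rintro c ⟨⟨v, hv, hcv⟩, hn⟩
      refine hZA ⟨⟨v, hv.1, hcv⟩, ?_⟩
      rintro ⟨w, hw, hcw⟩
      exact hn ⟨w, ⟨hw, hv.2.head ⟨c, hcw, hcv⟩⟩, hcw⟩
    obtain ⟨-, B, hB, -, htop⟩ := hG'.dual hA (hUf.subset hU₁) (hU.subset hU₁) hU₁A
    have hZ₁B : outer .neg Z₁ ⊆ B .pos n := by
      intro c hc
      rw [htop]
      refine ⟨.inl (hZ₁A hc), ?_⟩
      obtain ⟨⟨v, hv, hcv⟩, -⟩ := hc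
      rintro ⟨w, hw, hcw⟩
      exact hcyc w hw v hv ⟨c, hcw, hcv⟩
    refine (hG B Z₁ hB (hZf.subset hZ₁) (hZ.subset hZ₁) hZ₁B).1 b ⟨z, ⟨hz, .refl⟩, hbz⟩ ?_
    rw [htop]
    refine ⟨.inr ⟨u, ⟨hu, .refl⟩, hbu⟩, ?_⟩
    rintro ⟨w, hw, hbw⟩
    exact hP.acyclic _ u (Relation.TransGen.tail' hw.2 ⟨b, hbw, hbu⟩)
  have hUA' := (hG'.dual hA hUf hU hUA).1
  have hZA' := (hG A Z hA hZf hZ hZA).1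
  -- A common source face is no target of Z by `key`, so it is an outer source of Z and lies in A,
  -- whereas no source of U does. Common targets are excluded symmetrically.
  refine ⟨key, fun δ b hbU hbZ => ?_⟩
  cases δ
  · exact key b hbU (by_contra fun h => hUA' b hbU (hZA ⟨hbZ, h⟩))
  · exact key b (by_contra fun h => hZA' b hbZ (hUA ⟨hbU, h⟩)) hbZ

/-- The gluing property for a single atom implies the gluing property. -/
theorem Gluing.of_singleton (hP : P.IsRegular) {n : ℕ}
    (h : ∀ (X : P.PreCell) (x : P.Atom (n + 1)), IsCell n X →
      (∀ b ∈ P.face .neg x, b ∈ X .pos n) → (∀ b ∈ P.face .pos x, b ∉ X .pos n) ∧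
        ∃ Y : P.PreCell, IsCell n Y ∧ (∀ ε j, j < n → Y ε j = X ε j) ∧
          Y .pos n = act (X .pos n) {x}) : Gluing P n := by
  intro X S hX hfin
  induction hs : S.ncard generalizing X S with
  | zero =>
    rw [Set.ncard_eq_zero hfin] at hs
    subst hs
    exact fun _ _ => ⟨by simp, X, hX, fun _ _ _ => rfl, by simp⟩
  | succ m ih =>
    intro hS hsub
    have hne : S.Nonempty := by
      rw [← Set.ncard_pos hfin]; omega
    -- By minimality the source faces of x are outer in S, so they all lie in X and x can be applied
    -- first.
    obtain ⟨x, hx, hmin⟩ := hP.exists_minimal hfin hne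
    have hx1 : ∀ b ∈ P.face .neg x, b ∉ faces .pos S := fun b hb ⟨y, hy, hby⟩ =>
      hmin y hy ⟨b, hby, hb⟩
    obtain ⟨hd, X', hX', hlow', htop'⟩ := h X x hX fun b hb => hsub ⟨⟨x, hx, hb⟩, hx1 b hb⟩
    have hS' : S \ {x} ⊆ S := Set.sdiff_subset
    have hxS : ∀ δ, ∀ b ∈ P.face δ x, b ∉ faces δ (S \ {x}) := fun δ b hb ⟨y, hy, hby⟩ =>
      hy.2 (hS.eq hy.1 hx hby hb)
    have hSx : ∀ δ b, b ∈ faces δ S ↔ b ∈ P.face δ x ∨ b ∈ faces δ (S \ {x}) := by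
      intro δ b
      conv_lhs => rw [← Set.union_sdiff_cancel (Set.singleton_subset_iff.2 hx)]
      rw [faces_union, faces_singleton]; rfl
    obtain ⟨hd2, Y, hY, hlow, htop⟩ := ih X' (S \ {x}) hX' (hfin.subset hS')
      (by rw [Set.ncard_sdiff_singleton_of_mem hx, hs]; rfl) (hS.subset hS') (by
        rintro b ⟨hb, hnb⟩
        rw [htop', mem_act, faces_singleton, faces_singleton]
        refine ⟨?_, fun hbx => hxS .neg b hbx hb⟩
        by_cases hbS : b ∈ faces .pos S
        · exact .inr (((hSx .pos b).1 hbS).resolve_right hnb)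
        · exact .inl (hsub ⟨faces_mono hS' hb, hbS⟩))
    have hdis : ∀ b ∈ faces .pos S, b ∉ X .pos n := by
      intro b hb hbX
      rcases (hSx .pos b).1 hb with hbx | hbS
      · exact hd b hbx hbX
      · refine hd2 b hbS ?_
        rw [htop', mem_act, faces_singleton, faces_singleton]
        exact ⟨.inl hbX, fun hbx => hx1 b hbx hb⟩
    refine ⟨hdis, Y, hY, fun ε j hj => (hlow ε j hj).trans (hlow' ε j hj), ?_⟩
    rw [htop, htop']
    ext b
    have e1 := hSx .neg b
    have e2 := hSx .pos b
    have e3 := hxS .pos b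
    have e4 := hx1 b
    simp only [mem_act, faces_singleton, Finset.mem_coe] at *
    tauto

/-- By relevance a 1-atom has one source point and one target point, and they differ; applying it
replaces the point of a 0-cell. -/
theorem gluing_zero (hP : P.IsRegular) : Gluing P 0 := by
  refine Gluing.of_singleton hP fun X x hX hsub => ?_
  obtain ⟨a, ha⟩ := hX.forkFree .pos 0 le_rfl
  have hx := hP.relevance 1 x
  obtain ⟨s, hs⟩ := hx.forkFree .neg 0 (by omega)
  obtain ⟨t, ht⟩ := hx.forkFree .pos 0 (by omega)
  rw [hP.atomCell_face] at hs ht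
  have hsa : s = a := by
    have : s ∈ X .pos 0 := hsub s (by rw [← Finset.mem_coe, hs]; rfl)
    rw [ha] at this; exact this
  subst hsa
  have hst : t ≠ s := by
    rintro rfl
    refine hP.disjoint_face (x := x) (a := t) ?_ ?_ <;> rw [← Finset.mem_coe]
    · rw [hs]; rfl
    · rw [ht]; rfl
  have hact : act (X .pos 0) {x} = {t} := by
    ext b
    simp only [mem_act, faces_singleton, hs, ht, ha, Set.mem_singleton_iff]
    grind
  refine ⟨fun b hb => ?_, fun _ => Function.update (X .pos) 0 (act (X .pos 0) {x}), ?_,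
    fun ε j hj => by omega, by simp⟩
  · rw [← Finset.mem_coe, ht] at hb
    rw [ha, hb]; exact hst
  · rw [hact]
    refine ⟨fun ε i hi => ?_, rfl, fun ε i => ?_, fun ε i hi => ?_, fun ε i hi => by omega⟩
    · rw [Function.update_of_ne hi.ne']; exact hX.empty_above _ _ hi
    · rcases Nat.eq_zero_or_pos i with rfl | hi
      · simp
      · rw [Function.update_of_ne hi.ne']; exact hX.finite _ _
    · obtain rfl : i = 0 := by omega
      exact ⟨t, by simp⟩

/-- One dimension down, the atoms of X sweep from its source to its target. The sweep can be
arranged as U, then x^-, then V. Since x^+ has the same outer faces as x^-, it can take the middle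
place, and gluing in dimension n shows that it does not clash with U or V. -/
theorem gluing_succ (hP : P.IsRegular) {n : ℕ} (hG : Gluing P n) (hG' : Gluing P.op n) :
    Gluing P (n + 1) := by
  refine Gluing.of_singleton hP fun X x hX hsub => ?_
  have htop : X .neg (n + 1) = X .pos (n + 1) := hX.top_eq
  have hXf : ForkFree (X .pos (n + 1)) := hX.forkFree _ _ le_rfl
  have hout : ∀ δ, outer δ (X .pos (n + 1)) = X δ n \ X δ.flip n := hX.outer (Nat.lt_succ_self n) _
  have hcx := hP.relevance _ x
  -- the source and target faces of `x`
  have hF : ∀ δ, ForkFree (P.face δ x : Set (P.Atom (n + 1))) := fun δ => by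
    rw [← hP.atomCell_face]; exact hcx.forkFree _ _ (by omega)
  have houtx : ∀ δ, outer δ (P.face .pos x : Set (P.Atom (n + 1))) =
      outer δ (P.face .neg x : Set (P.Atom (n + 1))) := fun δ => by
    rw [← hP.atomCell_face, ← hP.atomCell_face, hP.outer_atomCell _ _ _ (by omega),
      hP.outer_atomCell _ _ _ (by omega)]
  have hseg : IsSegment (X .pos (n + 1)) (P.face .neg x : Set (P.Atom (n + 1))) := by
    rw [← hP.atomCell_face]
    refine hP.segment (n + 1) _ x X .neg (by omega) hX ?_
    rw [hP.atomCell_face]; exact hsub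
  set M : Set (P.Atom (n + 1)) := (P.face .neg x : Set (P.Atom (n + 1))) with hM
  set N : Set (P.Atom (n + 1)) := (P.face .pos x : Set (P.Atom (n + 1))) with hN
  have hMX : M ⊆ X .pos (n + 1) := hsub
  -- U is what must happen before M, and V is the rest. Because M is a segment, nothing in U comes
  -- after M, so U is closed under predecessors and M can directly follow it.
  let U : Set (P.Atom (n + 1)) :=
    {v | v ∈ X .pos (n + 1) ∧ v ∉ M ∧ ∃ w ∈ M, TriIn (X .pos (n + 1)) v w}
  let V : Set (P.Atom (n + 1)) := {v | v ∈ X .pos (n + 1) ∧ v ∉ M ∧ v ∉ U}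
  have hUX : U ⊆ X .pos (n + 1) := fun v hv => hv.1
  have hVX : V ⊆ X .pos (n + 1) := fun v hv => hv.1
  have hcases : ∀ v ∈ X .pos (n + 1), v ∈ U ∨ v ∈ M ∨ v ∈ V := fun v hv => by
    by_cases h1 : v ∈ M
    · exact .inr (.inl h1)
    · by_cases h2 : v ∈ U
      · exact .inl h2
      · exact .inr (.inr ⟨hv, h1, h2⟩)
  -- predecessors
  have hpreU : ∀ v ∈ X .pos (n + 1), ∀ w ∈ U, Tri v w → v ∈ U := by
    rintro v hv w ⟨hw, hwM, z, hz, hwz⟩ hvw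
    have hvw' : TriIn (X .pos (n + 1)) v w := .single ⟨hv, hw, hvw⟩
    refine ⟨hv, fun hvM => hwM (hseg v hvM z hz w hw hvw' hwz), z, hz, hvw'.trans hwz⟩
  have hpreM : ∀ v ∈ X .pos (n + 1), ∀ w ∈ M, Tri v w → v ∈ U ∨ v ∈ M := by
    intro v hv w hw hvw
    by_cases hvM : v ∈ M
    · exact .inr hvM
    · exact .inl ⟨hv, hvM, w, hw, .single ⟨hv, hMX hw, hvw⟩⟩
  have hA0 : IsCell n (bd .neg n X) := hX.bd (by omega) _
  have hA0top : bd .neg n X .pos n = X .neg n := bd_self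
  have hXin : ∀ b ∈ faces .neg (X .pos (n + 1)), b ∉ faces .pos (X .pos (n + 1)) → b ∈ X .neg n :=
    fun b hb hb' => ((hout .neg).subset ⟨hb, hb'⟩).1
  have hUA0 : outer .neg U ⊆ bd .neg n X .pos n := by
    rw [hA0top]
    rintro b ⟨⟨u, hu, hbu⟩, hn⟩
    refine hXin b ⟨u, hUX hu, hbu⟩ ?_
    rintro ⟨v, hv, hbv⟩
    exact hn ⟨v, hpreU v hv u hu ⟨b, hbv, hbu⟩, hbv⟩
  have hUfin : U.Finite := (hX.finite _ _).subset hUX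
  have hVfin : V.Finite := (hX.finite _ _).subset hVX
  have hMfin : M.Finite := Finset.finite_toSet _
  have hNfin : N.Finite := Finset.finite_toSet _
  have hUff := hXf.subset hUX
  have hVff := hXf.subset hVX
  obtain ⟨-, A, hA, hAlow, hAtop⟩ := hG _ U hA0 hUfin hUff hUA0
  rw [hA0top] at hAtop
  have hUA : outer .pos U ⊆ A .pos n := fun b hb => by
    rw [hAtop]; exact ⟨.inr hb.1, hb.2⟩
  have hMA : outer .neg M ⊆ A .pos n := by
    rintro b ⟨⟨w, hw, hbw⟩, hn⟩
    rw [hAtop]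
    refine ⟨?_, fun ⟨u, hu, hbu⟩ => hu.2.1 (hXf.eq hu.1 (hMX hw) hbu hbw ▸ hw)⟩
    by_cases h : b ∈ faces .pos (X .pos (n + 1))
    · obtain ⟨v, hv, hbv⟩ := h
      rcases hpreM v hv w hw ⟨b, hbv, hbw⟩ with hvU | hvM
      · exact .inr ⟨v, hvU, hbv⟩
      · exact absurd ⟨v, hvM, hbv⟩ hn
    · exact .inl (hXin b ⟨w, hMX hw, hbw⟩ h)
  have hNA : outer .neg N ⊆ A .pos n := by rw [houtx]; exact hMA
  obtain ⟨hMdis, -⟩ := hG _ M hA hMfin (hF _) hMA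
  obtain ⟨hNdis, B, hB, hBlow, hBtop⟩ := hG _ N hA hNfin (hF _) hNA
  -- M and N have equal outer faces and both are new over A, so they lead to the same cell B.
  have hBtop' : B .pos n = act (A .pos n) M := by
    rw [hBtop, act_eq hNdis, act_eq hMdis, houtx, houtx]
  have hNB : outer .pos N ⊆ B .pos n := fun b hb => by
    rw [hBtop]; exact ⟨.inr hb.1, hb.2⟩
  have hVB : outer .neg V ⊆ B .pos n := by
    rintro b ⟨⟨w, hw, hbw⟩, hn⟩
    have hbU : b ∉ faces .neg U := fun ⟨u, hu, hbu⟩ =>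
      hw.2.2 (hXf.eq hu.1 hw.1 hbu hbw ▸ hu)
    have hbM : b ∉ faces .neg M := fun ⟨u, hu, hbu⟩ =>
      hw.2.1 (hXf.eq (hMX hu) hw.1 hbu hbw ▸ hu)
    rw [hBtop', mem_act, hAtop, mem_act]
    refine ⟨?_, hbM⟩
    by_cases h : b ∈ faces .pos (X .pos (n + 1))
    · obtain ⟨v, hv, hbv⟩ := h
      rcases hcases v hv with hvU | hvM | hvV
      · exact .inl ⟨.inr ⟨v, hvU, hbv⟩, hbU⟩
      · exact .inr ⟨v, hvM, hbv⟩
      · exact absurd ⟨v, hvV, hbv⟩ hn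
    · exact .inl ⟨.inl (hXin b ⟨w, hVX hw, hbw⟩ h), hbU⟩
  obtain ⟨-, hUN⟩ := hG.disjoint_faces hP hG' hA hUfin hNfin hUff (hF _) hUA hNA
  obtain ⟨-, hNV⟩ := hG.disjoint_faces hP hG' hB hNfin hVfin (hF _) hVff hNB hVB
  -- An atom b common to x^+ and X is not in M, so it lies in U or V. It has a source face by (T0),
  -- and this face would be shared by N and U, or by N and V.
  have hdis : ∀ b ∈ P.face .pos x, b ∉ X .pos (n + 1) := by
    intro b hb hbX
    obtain ⟨c, hc⟩ := hP.nonempty n b .neg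
    rcases hcases b hbX with h | h | h
    · exact hUN .neg c ⟨b, h, hc⟩ ⟨b, hb, hc⟩
    · exact hP.disjoint_face h hb
    · exact hNV .neg c ⟨b, hb, hc⟩ ⟨b, h, hc⟩
  have hact : act (X .pos (n + 1)) {x} = (U ∪ V) ∪ N := by
    ext b
    have h1 := hcases b
    have h2 := hdis b
    have h3 : b ∈ N → b ∉ M := fun h h' => hP.disjoint_face h' h
    have h4 : b ∈ U → b ∈ X .pos (n + 1) ∧ b ∉ M := fun h => ⟨h.1, h.2.1⟩
    have h5 : b ∈ V → b ∈ X .pos (n + 1) ∧ b ∉ M := fun h => ⟨h.1, h.2.1⟩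
    rw [mem_act, faces_singleton, faces_singleton, Set.mem_union, Set.mem_union, ← hM, ← hN]
    tauto
  have hXeq : X .pos (n + 1) = (U ∪ V) ∪ M := by
    ext b
    have h1 := hcases b
    have h4 : b ∈ U → b ∈ X .pos (n + 1) := fun h => h.1
    have h5 : b ∈ V → b ∈ X .pos (n + 1) := fun h => h.1
    have h6 := @hMX b
    rw [Set.mem_union, Set.mem_union]
    tauto
  have hUVX : U ∪ V ⊆ X .pos (n + 1) := Set.union_subset hUX hVX
  have hUVN : ∀ δ, ∀ a ∈ faces δ (U ∪ V), a ∉ faces δ N := by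
    intro δ a ha haN
    rw [faces_union] at ha
    rcases ha with ha | ha
    · exact hUN δ a ha haN
    · exact hNV δ a haN ha
  have hUVM : ∀ δ, ∀ a ∈ faces δ (U ∪ V), a ∉ faces δ M := by
    rintro δ a ⟨u, hu, hau⟩ ⟨v, hv, hav⟩
    have := hXf.eq (hUVX hu) (hMX hv) hau hav
    subst this
    rcases hu with hu | hu
    · exact hu.2.1 hv
    · exact hu.2.1 hv
  have hYf : ForkFree (act (X .pos (n + 1)) {x}) := by
    rw [hact]
    exact (hXf.subset hUVX).union (hF _) hUVN
  have hYout : ∀ δ, outer δ (act (X .pos (n + 1)) {x}) = X δ n \ X δ.flip n := by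
    intro δ
    rw [← hout, hact, hXeq, outer_union _ hUVN, outer_union _ hUVM, houtx, houtx]
  refine ⟨hdis, fun ε => Function.update (X ε) (n + 1) (act (X .pos (n + 1)) {x}), ?_,
    fun ε j hj => Function.update_of_ne hj.ne _ _, Function.update_self _ _ _⟩
  refine ⟨fun ε i hi => ?_, by simp, fun ε i => ?_, fun ε i hi => ?_, fun ε i hi => ?_⟩
  · rw [Function.update_of_ne hi.ne']; exact hX.empty_above _ _ hi
  · rcases eq_or_ne i (n + 1) with rfl | hi
    · rw [Function.update_self]; exact act_finite (hX.finite _ _) (Set.finite_singleton x)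
    · rw [Function.update_of_ne hi]; exact hX.finite _ _
  · rcases eq_or_ne i (n + 1) with rfl | hi'
    · rw [Function.update_self]; exact hYf
    · rw [Function.update_of_ne hi']; exact hX.forkFree _ _ hi
  · rw [Function.update_of_ne hi.ne, Function.update_of_ne hi.ne]
    rcases eq_or_ne (i + 1) (n + 1) with hi' | hi'
    · obtain rfl : i = n := by omega
      rw [Function.update_self]
      exact ⟨hYout .neg, hYout .pos⟩
    · rw [Function.update_of_ne hi']
      exact hX.moves _ _ hi

theorem IsRegular.gluing (hP : P.IsRegular) (n : ℕ) : Gluing P n := by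
  induction n generalizing P with
  | zero => exact gluing_zero hP
  | succ n ih => exact gluing_succ hP (ih hP) (ih hP.op)

/-! ### Cells through a given atom -/

theorem IsRegular.faces_pos_disjoint (hP : P.IsRegular) {m i : ℕ} {c : P.PreCell}
    (h : IsCell m c) (hi : i < m) (ε : Sgn) : ∀ b ∈ faces .pos (c ε (i + 1)), b ∉ c .neg i := by
  have := (hP.gluing i (bd .neg i c) (c ε (i + 1)) (h.bd hi.le _) (h.finite _ _)
    (h.forkFree _ _ hi) (by rw [bd_self, h.outer hi]; exact Set.sdiff_subset)).1
  rwa [bd_self] at this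

/-- `Moves` fixes only the two differences of source and target; newness of the target faces
upgrades this to an equation for the target. -/
theorem IsRegular.pos_eq_act (hP : P.IsRegular) {m i : ℕ} {c : P.PreCell}
    (h : IsCell m c) (hi : i < m) (ε : Sgn) : c .pos i = act (c .neg i) (c ε (i + 1)) := by
  rw [act_eq (hP.faces_pos_disjoint h hi ε), h.outer hi, h.outer hi]
  ext b
  simp only [Sgn.flip, Set.mem_union, Set.mem_sdiff]
  tauto

/-- Every face of an atom of a cell `c` lies in a cell parallel to the boundary of `c`. -/
theorem IsRegular.exists_parallel_of_face (hP : P.IsRegular) {i : ℕ} {c : P.PreCell}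
    (hc : IsCell (i + 1) c) {x : P.Atom (i + 1)} (hx : x ∈ c .pos (i + 1)) (ε : Sgn) :
    ∃ c' : P.PreCell, IsCell i c' ∧ (∀ δ j, j < i → c' δ j = c δ j) ∧
      ∀ a ∈ P.face ε x, a ∈ c' .pos i := by
  have hcf : ForkFree (c .pos (i + 1)) := hc.forkFree _ _ le_rfl
  have hout : ∀ δ, outer δ (c .pos (i + 1)) = c δ i \ c δ.flip i := hc.outer (Nat.lt_succ_self i) _
  -- After applying exactly the predecessors of x, all source faces of x are present; applying x
  -- then makes all its target faces present.
  let U : Set (P.Atom (i + 1)) := {u | u ∈ c .pos (i + 1) ∧ Relation.TransGen Tri u x}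
  have hUc : U ⊆ c .pos (i + 1) := fun u hu => hu.1
  have hxU : x ∉ U := fun h => hP.acyclic _ x h.2
  have hbd : bd .neg i c .pos i = c .neg i := bd_self
  have hin : ∀ b ∈ faces .neg (c .pos (i + 1)), b ∉ faces .pos (c .pos (i + 1)) → b ∈ c .neg i :=
    fun b hb hb' => ((hout .neg).subset ⟨hb, hb'⟩).1
  obtain ⟨-, A, hA, hAlow, hAtop⟩ := hP.gluing i (bd .neg i c) U (hc.bd (by omega) _)
    ((hc.finite _ _).subset hUc) (hcf.subset hUc) (by
      rw [hbd]
      rintro b ⟨⟨u, hu, hbu⟩, hn⟩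
      refine hin b ⟨u, hu.1, hbu⟩ ?_
      rintro ⟨v, hv, hbv⟩
      exact hn ⟨v, ⟨hv, hu.2.head ⟨b, hbv, hbu⟩⟩, hbv⟩)
  rw [hbd] at hAtop
  have hAlow' : ∀ δ j, j < i → A δ j = c δ j := fun δ j hj => (hAlow δ j hj).trans (bd_of_lt hj)
  have hxA : ∀ a ∈ P.face .neg x, a ∈ A .pos i := by
    intro a ha
    rw [hAtop, mem_act]
    refine ⟨?_, fun ⟨u, hu, hau⟩ => hxU (hcf.eq hu.1 hx hau ha ▸ hu)⟩
    by_cases h : a ∈ faces .pos (c .pos (i + 1))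
    · obtain ⟨v, hv, hav⟩ := h
      exact .inr ⟨v, ⟨hv, .single ⟨a, hav, ha⟩⟩, hav⟩
    · exact .inl (hin a ⟨x, hx, ha⟩ h)
  cases ε
  · exact ⟨A, hA, hAlow', hxA⟩
  · obtain ⟨-, B, hB, hBlow, hBtop⟩ := hP.gluing i A {x} hA (Set.finite_singleton x)
      (hcf.subset (Set.singleton_subset_iff.2 hx))
      (by rintro a ⟨⟨y, rfl, ha⟩, -⟩; exact hxA a ha)
    refine ⟨B, hB, fun δ j hj => (hBlow δ j hj).trans (hAlow' δ j hj), fun a ha => ?_⟩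
    rw [hBtop, mem_act, faces_singleton, faces_singleton]
    exact ⟨.inr ha, fun h => hP.disjoint_face h ha⟩

theorem InClosure.le_dim {n : ℕ} {c : P.PreCell} (hc : IsCell n c) {i : ℕ} {a : P.Atom i}
    (h : InClosure c a) : i ≤ n := by
  induction h with
  | base ε h =>
    by_contra hi
    rw [hc.empty_above _ _ (by omega)] at h
    exact h
  | face ε _ _ ih => omega

/-- Every `i`-atom in the closure of a cell `c` lies in an `i`-cell parallel to the `i`-dimensional
boundary of `c`. -/
theorem IsRegular.exists_parallel (hP : P.IsRegular) {n : ℕ} {c : P.PreCell} (hc : IsCell n c)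
    {i : ℕ} {a : P.Atom i} (h : InClosure c a) :
    ∃ c' : P.PreCell, IsCell i c' ∧ (∀ δ j, j < i → c' δ j = c δ j) ∧ a ∈ c' .pos i := by
  induction h with
  | @base i a ε h =>
    refine ⟨bd ε i c, hc.bd (InClosure.le_dim hc (.base ε h)) _, fun δ j hj => bd_of_lt hj, ?_⟩
    rwa [bd_self]
  | @face i x a ε _ ha ih =>
    obtain ⟨c', hc', hlow, hx⟩ := ih
    obtain ⟨d, hd, hdlow, htop⟩ := hP.exists_parallel_of_face hc' hx ε
    exact ⟨d, hd, fun δ j hj => (hdlow δ j hj).trans (hlow δ j (by omega)), htop a ha⟩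

/-- An `i`-atom in the closure of `c` that is not a target of `c` can be moved to the target. -/
theorem IsRegular.mem_pos_or (hP : P.IsRegular) {n : ℕ} {c : P.PreCell} (hc : IsCell n c)
    {i : ℕ} {a : P.Atom i} (h : InClosure c a) :
    a ∈ c .pos i ∨ ∃ S : Set (P.Atom (i + 1)), S.Finite ∧ ForkFree S ∧ outer .pos S ⊆ c .pos i ∧
      a ∈ faces .neg S := by
  have hin := h.le_dim hc
  cases h with
  | base ε h =>
    rcases hin.eq_or_lt with rfl | hlt
    · cases ε
      · exact .inl (hc.top_eq ▸ h)
      · exact .inl h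
    · cases ε
      · by_cases ha : a ∈ c .pos i
        · exact .inl ha
        · refine .inr ⟨c .pos (i + 1), hc.finite _ _, hc.forkFree _ _ hlt, ?_, ?_⟩
          · rw [hc.outer hlt]; exact Set.sdiff_subset
          · refine outer_subset_faces _ _ ?_
            rw [hc.outer hlt]; exact ⟨h, ha⟩
      · exact .inl h
  | @face _ x _ ε hx ha =>
    obtain ⟨c', hc', hlow, hxc⟩ := hP.exists_parallel hc hx
    -- The cell c' through the parent atom x agrees with c below dimension i + 1, so its top set
    -- ends in the target of c and serves as S.
    have hout : outer .pos (c' .pos (i + 1)) ⊆ c .pos i := by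
      rw [hc'.outer (Nat.lt_succ_self i), hlow _ _ (Nat.lt_succ_self i)]
      exact Set.sdiff_subset
    by_cases h : a ∈ faces .neg (c' .pos (i + 1))
    · exact .inr ⟨c' .pos (i + 1), hc'.finite _ _, hc'.forkFree _ _ le_rfl, hout, h⟩
    · refine .inl (hout ⟨⟨x, hxc, ?_⟩, h⟩)
      cases ε
      · exact absurd ⟨x, hxc, ha⟩ h
      · exact ha

/-! ### Composites of cells -/

theorem Gluing.noninterfering (hP : P.IsRegular) {m i : ℕ} {c d : P.PreCell}
    (hc : IsCell m c) (hd : IsCell m d) (hi : i < m) (h : c .pos i = d .neg i) (ε ε' : Sgn) :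
    (∀ b ∈ faces .neg (c ε (i + 1)), b ∉ faces .pos (d ε' (i + 1))) ∧
      ∀ δ, ∀ b ∈ faces δ (c ε (i + 1)), b ∉ faces δ (d ε' (i + 1)) := by
  refine (hP.gluing i).disjoint_faces hP (hP.op.gluing i) (hc.bd hi.le .pos) (hc.finite _ _)
    (hd.finite _ _) (hc.forkFree _ _ hi) (hd.forkFree _ _ hi) ?_ ?_
  · rw [bd_self, hc.outer hi]; exact Set.sdiff_subset
  · rw [bd_self, hd.outer hi, h]; exact Set.sdiff_subset

theorem bd_eq_bd_iff {i : ℕ} {c d : P.PreCell} {ε δ : Sgn} :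
    bd ε i c = bd δ i d ↔ (∀ γ j, j < i → c γ j = d γ j) ∧ c ε i = d δ i := by
  constructor
  · intro h
    refine ⟨fun γ j hj => ?_, ?_⟩
    · have := congrFun (congrFun h γ) j
      rwa [bd_of_lt hj, bd_of_lt hj] at this
    · have := congrFun (congrFun h .neg) i
      rwa [bd_self, bd_self] at this
  · rintro ⟨h1, h2⟩
    funext γ j
    rcases lt_trichotomy j i with hj | rfl | hj
    · rw [bd_of_lt hj, bd_of_lt hj, h1 _ _ hj]
    · rw [bd_self, bd_self, h2]
    · rw [bd_of_gt hj, bd_of_gt hj]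

/-- A common atom has a source face by (T0), and this face lies in cells parallel to the boundaries
of both cells. Descending in this way reaches dimension i + 1, where the common atom would give a
common source face, against noninterference. -/
theorem IsRegular.disjoint_top (hP : P.IsRegular) {j i : ℕ} (hij : i < j) {c d : P.PreCell}
    (hc : IsCell j c) (hd : IsCell j d) (h : bd .pos i c = bd .neg i d) {a : P.Atom j}
    (hac : a ∈ c .pos j) : a ∉ d .pos j := by
  intro had
  induction j generalizing c d with
  | zero => omega
  | succ j ih =>
    obtain ⟨b, hb⟩ := hP.nonempty j a .neg
    rcases (Nat.lt_succ_iff.1 hij).eq_or_lt with rfl | hlt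
    · exact (Gluing.noninterfering hP hc hd hij (bd_eq_bd_iff.1 h).2 .pos .pos).2 .neg b
        ⟨a, hac, hb⟩ ⟨a, had, hb⟩
    · obtain ⟨c', hc', hclow, hbc⟩ := hP.exists_parallel_of_face hc hac .neg
      obtain ⟨d', hd', hdlow, hbd⟩ := hP.exists_parallel_of_face hd had .neg
      refine ih hlt hc' hd' ?_ (hbc b hb) (hbd b hb)
      rw [bd_eq_bd_iff] at h ⊢
      refine ⟨fun γ l hl => ?_, ?_⟩
      · rw [hclow _ _ (by omega), hdlow _ _ (by omega), h.1 _ _ hl]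
      · rw [hclow _ _ hlt, hdlow _ _ hlt, h.2]

/-- Cells that are composable along `i`-cells have no atoms of dimension above `i` in common, even
after adding iterated faces. -/
theorem IsRegular.disjoint_closure (hP : P.IsRegular) {i m m' : ℕ} {c d : P.PreCell}
    (hc : IsCell m c) (hd : IsCell m' d) (h : bd .pos i c = bd .neg i d) {j : ℕ} (hij : i < j)
    {a : P.Atom j} (hac : InClosure c a) : ¬ InClosure d a := by
  intro had
  obtain ⟨c', hc', hclow, hac'⟩ := hP.exists_parallel hc hac
  obtain ⟨d', hd', hdlow, had'⟩ := hP.exists_parallel hd had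
  refine hP.disjoint_top hij hc' hd' ?_ hac' had'
  rw [bd_eq_bd_iff] at h ⊢
  refine ⟨fun γ l hl => ?_, ?_⟩
  · rw [hclow _ _ (by omega), hdlow _ _ (by omega), h.1 _ _ hl]
  · rw [hclow _ _ hij, hdlow _ _ hij, h.2]

theorem comp_of_lt {i j : ℕ} {c d : P.PreCell} {δ : Sgn} (h : j < i) :
    comp i d c δ j = c δ j := by simp [comp, h]

@[simp] theorem comp_neg {i : ℕ} {c d : P.PreCell} : comp i d c .neg i = c .neg i := by
  simp [comp]

@[simp] theorem comp_pos {i : ℕ} {c d : P.PreCell} : comp i d c .pos i = d .pos i := by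
  simp [comp]

theorem comp_of_gt {i j : ℕ} {c d : P.PreCell} {δ : Sgn} (h : i < j) :
    comp i d c δ j = c δ j ∪ d δ j := by simp [comp, h.not_gt, h.ne']

theorem faces_subset_closure {c : P.PreCell} {ε δ : Sgn} {j : ℕ} {a : P.Atom j}
    (h : a ∈ faces δ (c ε (j + 1))) : InClosure c a := by
  obtain ⟨s, hs, ha⟩ := h
  exact .face δ (.base ε hs) ha

/-- The composite of two cells is a cell. -/
theorem IsRegular.isCell_comp (hP : P.IsRegular) {i m m' : ℕ} {c d : P.PreCell}
    (hc : IsCell m c) (hd : IsCell m' d) (h : bd .pos i c = bd .neg i d) :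
    IsCell (max (max m m') (i + 1)) (comp i d c) := by
  set M := max (max m m') (i + 1) with hM
  replace hc : IsCell M c := hc.mono (by omega)
  replace hd : IsCell M d := hd.mono (by omega)
  have hiM : i < M := by omega
  clear_value M
  have hbd := bd_eq_bd_iff.1 h
  have hfaces : ∀ ε δ j, i ≤ j → j < M → ∀ a ∈ faces δ (c ε (j + 1)), a ∉ faces δ (d ε (j + 1)) := by
    intro ε δ j hij hj a hac had
    rcases hij.eq_or_lt with rfl | hij
    · exact (Gluing.noninterfering hP hc hd hiM hbd.2 ε ε).2 δ a hac had
    · exact hP.disjoint_closure hc hd h hij (faces_subset_closure hac) (faces_subset_closure had)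
  have hmoves : ∀ ε δ j, j < M → outer δ (comp i d c ε (j + 1)) =
      comp i d c δ j \ comp i d c δ.flip j := by
    intro ε δ j hj
    rcases lt_trichotomy j i with hji | rfl | hij
    · rw [comp_of_lt hji, comp_of_lt hji]
      rcases (Nat.succ_le_of_lt hji).lt_or_eq with h' | rfl
      · rw [comp_of_lt h', hc.outer hj]
      · cases ε
        · rw [comp_neg, hc.outer hj]
        · rw [comp_pos, hd.outer hj, hbd.1 _ _ hji, hbd.1 _ _ hji]
    · rw [comp_of_gt (Nat.lt_succ_self _), outer_union _ (fun δ => hfaces ε δ j le_rfl hj),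
        hc.outer hj, hc.outer hj, hd.outer hj, hd.outer hj]
      ext a
      cases δ <;> simp only [Sgn.flip, comp_neg, comp_pos, ← hbd.2, Set.mem_union, Set.mem_sdiff] <;>
        tauto
    · rw [comp_of_gt hij, comp_of_gt hij, comp_of_gt (by omega),
        outer_union _ (fun δ => hfaces ε δ j hij.le hj),
        hc.outer hj, hc.outer hj, hd.outer hj, hd.outer hj]
      ext a
      have key : ∀ δ δ', a ∈ c δ j → a ∉ d δ' j := fun δ δ' hac had =>
        hP.disjoint_closure hc hd h hij (.base δ hac) (.base δ' had)
      have k1 := key δ δ.flip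
      have k2 := key δ.flip δ
      simp only [Set.mem_union, Set.mem_sdiff, Sgn.flip_flip]
      tauto
  refine ⟨fun ε j hj => ?_, ?_, fun ε j => ?_, fun ε j hj => ?_, fun ε j hj =>
    ⟨hmoves ε .neg j hj, hmoves ε .pos j hj⟩⟩
  · rw [comp_of_gt (by omega), hc.empty_above _ _ hj, hd.empty_above _ _ hj, Set.union_empty]
  · rw [comp_of_gt hiM, comp_of_gt hiM, hc.top_eq, hd.top_eq]
  · rcases lt_trichotomy j i with hji | rfl | hij
    · rw [comp_of_lt hji]; exact hc.finite _ _
    · cases ε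
      · rw [comp_neg]; exact hc.finite _ _
      · rw [comp_pos]; exact hd.finite _ _
    · rw [comp_of_gt hij]; exact (hc.finite _ _).union (hd.finite _ _)
  · rcases lt_trichotomy j i with hji | rfl | hij
    · rw [comp_of_lt hji]; exact hc.forkFree _ _ hj
    · cases ε
      · rw [comp_neg]; exact hc.forkFree _ _ hj
      · rw [comp_pos]; exact hd.forkFree _ _ hj
    · rw [comp_of_gt hij]
      obtain ⟨l, rfl⟩ : ∃ l, j = l + 1 := ⟨j - 1, by omega⟩
      exact (hc.forkFree _ _ hj).union (hd.forkFree _ _ hj)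
        fun δ => hfaces ε δ l (by omega) (by omega)

/-! ### Closures -/

theorem InClosure.trans {c d : P.PreCell} (hd : ∀ ε i, ∀ a ∈ d ε i, InClosure c a) {i : ℕ}
    {a : P.Atom i} (h : InClosure d a) : InClosure c a := by
  induction h with
  | base ε h => exact hd ε _ _ h
  | face ε _ ha ih => exact .face ε ih ha

theorem InClosure.of_bd {ε : Sgn} {i : ℕ} {c : P.PreCell} {j : ℕ} {a : P.Atom j}
    (h : InClosure (bd ε i c) a) : InClosure c a := by
  refine InClosure.trans (fun δ l b hb => ?_) h
  rcases lt_trichotomy l i with hl | rfl | hl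
  · rw [bd_of_lt hl] at hb; exact .base _ hb
  · rw [bd_self] at hb; exact .base _ hb
  · rw [bd_of_gt hl] at hb; exact hb.elim

theorem InClosure.of_comp {i : ℕ} {c d : P.PreCell} {j : ℕ} {a : P.Atom j}
    (h : InClosure (comp i d c) a) (hij : i ≤ j) : InClosure c a ∨ InClosure d a := by
  induction h with
  | @base j a ε h =>
    rcases hij.eq_or_lt with rfl | hij
    · cases ε
      · rw [comp_neg] at h; exact .inl (.base _ h)
      · rw [comp_pos] at h; exact .inr (.base _ h)
    · rw [comp_of_gt hij] at h
      exact h.imp (.base _) (.base _)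
  | face ε _ ha ih => exact (ih (by omega)).imp (.face ε · ha) (.face ε · ha)

theorem Descend.inClosure {c : P.PreCell} {ε : Sgn} {m : ℕ} {S : Set (P.Atom m)} {i : ℕ}
    {a : P.Atom i} (h : Descend ε m S i a) (hS : ∀ x ∈ S, InClosure c x) : InClosure c a := by
  induction h with
  | top h => exact hS _ h
  | step _ ih =>
    refine ih fun b hb => ?_
    obtain ⟨s, hs, hbs⟩ := outer_subset_faces _ _ hb
    exact .face _ (hS s hs) hbs

theorem InClosure.of_atomCell {c : P.PreCell} {m : ℕ} {x : P.Atom m} (hx : InClosure c x) {j : ℕ}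
    {a : P.Atom j} (h : InClosure (atomCell x) a) : InClosure c a :=
  h.trans fun _ _ _ hb => Descend.inClosure hb fun _ hy => by cases hy; exact hx

/-! ### Nonempty components -/

theorem IsRegular.nonempty_below (hP : P.IsRegular) {n : ℕ} {c : P.PreCell} (hc : IsCell n c)
    {i : ℕ} {ε : Sgn} (h : (c ε i).Nonempty) {j : ℕ} (hj : j < i) (δ : Sgn) :
    (c δ j).Nonempty := by
  have hin : i ≤ n := by
    by_contra hi
    rw [hc.empty_above _ _ (by omega)] at h
    exact h.ne_empty rfl
  obtain ⟨l, rfl⟩ := Nat.exists_eq_add_of_lt hj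
  induction l generalizing ε with
  | zero =>
    have := hP.outer_nonempty (hc.finite ε (j + 1)) h δ
    rw [hc.outer (by omega)] at this
    exact this.mono Set.sdiff_subset
  | succ l ih =>
    have := hP.outer_nonempty (hc.finite ε (j + (l + 1) + 1)) h .neg
    rw [hc.outer (by omega)] at this
    exact ih (this.mono Set.sdiff_subset) (by omega) (by omega)

/-- A cell without atoms above dimension `i` is an identity on an `i`-cell. -/
theorem bd_eq_self_of_empty {n : ℕ} {c : P.PreCell} (hc : IsCell n c) {i : ℕ}
    (h : ∀ δ j, i < j → c δ j = ∅) (ε : Sgn) : bd ε i c = c := by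
  have htop : c .neg i = c .pos i := by
    rcases lt_or_ge i n with hi | hi
    · have h1 := hc.outer hi .neg .neg
      have h2 := hc.outer hi .neg .pos
      rw [h _ _ (Nat.lt_succ_self i), outer_empty] at h1 h2
      exact Set.Subset.antisymm (Set.sdiff_eq_empty.1 h1.symm) (Set.sdiff_eq_empty.1 h2.symm)
    · rcases hi.eq_or_lt with rfl | hi
      · exact hc.top_eq
      · rw [hc.empty_above _ _ hi, hc.empty_above _ _ hi]
  funext δ j
  rcases lt_trichotomy j i with hj | rfl | hj
  · exact bd_of_lt hj
  · rw [bd_self]; cases ε <;> cases δ <;> simp [htop]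
  · rw [bd_of_gt hj, h _ _ hj]

/-- If the source and target in dimension `i` agree then the cell has no atoms above dimension
`i`. -/
theorem IsRegular.empty_of_neg_eq_pos (hP : P.IsRegular) {n : ℕ} {c : P.PreCell}
    (hc : IsCell n c) {i : ℕ} (h : c .neg i = c .pos i) (δ : Sgn) {j : ℕ} (hj : i < j) :
    c δ j = ∅ := by
  by_contra hne
  have h1 : (c .neg (i + 1)).Nonempty := by
    rcases (Nat.succ_le_of_lt hj).eq_or_lt with rfl | hj'
    · have := hP.outer_nonempty (hc.finite δ (i + 1)) (Set.nonempty_iff_ne_empty.2 hne) .neg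
      rcases lt_or_ge i n with hi | hi
      · rw [hc.outer hi, Sgn.flip, h, sdiff_self] at this
        exact absurd rfl this.ne_empty
      · exact absurd (hc.empty_above _ _ (by omega)) hne
    · exact hP.nonempty_below hc (Set.nonempty_iff_ne_empty.2 hne) hj' _
  have := hP.outer_nonempty (hc.finite .neg (i + 1)) h1 .neg
  rcases lt_or_ge i n with hi | hi
  · rw [hc.outer hi, Sgn.flip, h, sdiff_self] at this
    exact absurd rfl this.ne_empty
  · rw [hc.empty_above _ (i + 1) (by omega)] at h1
    exact absurd rfl h1.ne_empty

theorem IsRegular.atomCell_nonempty (hP : P.IsRegular) {m i : ℕ} (x : P.Atom m) (ε : Sgn)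
    (h : i ≤ m) : (atomCell x ε i).Nonempty := by
  rcases h.eq_or_lt with rfl | h
  · rw [atomCell_self]; exact ⟨x, rfl⟩
  · exact hP.nonempty_below (hP.relevance m x) (i := m) (ε := .pos)
      (by rw [atomCell_self]; exact ⟨x, rfl⟩) h ε

/-! ### Maximal atoms of a cell -/

/-- The atoms of all dimensions that lie both in the source and in the target of `μ`. -/
def maxAtoms (μ : P.PreCell) : Set (Σ i, P.Atom i) := {z | z.2 ∈ μ .neg z.1 ∧ z.2 ∈ μ .pos z.1}

/-- In dimensions at least `k`, the cell `μ` is the disjoint union of the cells of its maximal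
atoms. -/
structure IsSplit (μ : P.PreCell) (k : ℕ) : Prop where
  mem_iff : ∀ j, k ≤ j → ∀ ε (a : P.Atom j),
    a ∈ μ ε j ↔ ∃ z ∈ maxAtoms μ, a ∈ atomCell z.2 ε j
  unique : ∀ j, k ≤ j → ∀ ε (a : P.Atom j), ∀ z ∈ maxAtoms μ, ∀ w ∈ maxAtoms μ,
    a ∈ atomCell z.2 ε j → a ∈ atomCell w.2 ε j → z = w

theorem le_dim_of_mem_atomCell {m i : ℕ} {x : P.Atom m} {ε : Sgn} {a : P.Atom i}
    (h : a ∈ atomCell x ε i) : i ≤ m := Descend.le h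

theorem mem_atomCell_self {m : ℕ} (x : P.Atom m) (ε : Sgn) : x ∈ atomCell x ε m := by
  rw [atomCell_self]; rfl

theorem eq_of_mem_atomCell {i : ℕ} {x a : P.Atom i} {ε : Sgn} (h : a ∈ atomCell x ε i) :
    a = x := by
  rw [atomCell_self] at h; exact h

/-- In dimension n source and target agree, so each n-atom is maximal. -/
theorem isSplit_top {n : ℕ} {μ : P.PreCell} (hμ : IsCell n μ) : IsSplit μ n := by
  have hdim : ∀ z ∈ maxAtoms μ, z.1 ≤ n := fun z hz => by
    by_contra h
    have := hz.1
    rw [hμ.empty_above _ _ (by omega)] at this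
    exact this
  have key : ∀ j, n ≤ j → ∀ ε (a : P.Atom j), ∀ z ∈ maxAtoms μ, a ∈ atomCell z.2 ε j →
      j = n ∧ z = ⟨j, a⟩ := by
    rintro j hj ε a ⟨i, z⟩ hz ha
    have h1 := le_dim_of_mem_atomCell ha
    have h2 : i ≤ n := hdim _ hz
    have h3 : i = j := by simp only at h1; omega
    subst h3
    exact ⟨by omega, by rw [eq_of_mem_atomCell ha]⟩
  refine ⟨fun j hj ε a => ⟨fun ha => ?_, ?_⟩, fun j hj ε a z hz w hw haz haw => ?_⟩
  · have : j = n := by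
      by_contra h
      rw [hμ.empty_above _ _ (by omega)] at ha
      exact ha
    subst this
    refine ⟨⟨j, a⟩, ?_, mem_atomCell_self a ε⟩
    have := hμ.top_eq
    cases ε
    · exact ⟨ha, this ▸ ha⟩
    · exact ⟨this ▸ ha, ha⟩
  · rintro ⟨z, hz, ha⟩
    obtain ⟨rfl, rfl⟩ := key j hj ε a z hz ha
    cases ε
    · exact hz.1
    · exact hz.2
  · rw [(key j hj ε a z hz haz).2, (key j hj ε a w hw haw).2]

theorem maxAtoms.inClosure {μ : P.PreCell} {z : Σ i, P.Atom i} (hz : z ∈ maxAtoms μ) :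
    InClosure μ z.2 := .base .neg hz.1

theorem IsSplit.exists_closure {μ : P.PreCell} {k : ℕ} (h : IsSplit μ k) {m : ℕ} {x : P.Atom m}
    (hx : InClosure μ x) (hkm : k ≤ m) : ∃ z ∈ maxAtoms μ, InClosure (atomCell z.2) x := by
  induction hx with
  | base ε hx =>
    obtain ⟨z, hz, hxz⟩ := (h.mem_iff _ hkm ε _).1 hx
    exact ⟨z, hz, .base ε hxz⟩
  | face ε _ ha ih =>
    obtain ⟨z, hz, hxz⟩ := ih (by omega)
    exact ⟨z, hz, .face ε hxz ha⟩

/-- Otherwise a is a source face of a set of (k+1)-atoms ending in ⟨z⟩_k, which is part of μ_k; dual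
gluing says that such source faces are not in μ_k. -/
theorem IsSplit.mem_atomCell (hP : P.IsRegular) {n : ℕ} {μ : P.PreCell} (hμ : IsCell n μ) {k : ℕ}
    (h : IsSplit μ k) (hkn : k ≤ n) {z : Σ i, P.Atom i} (hz : z ∈ maxAtoms μ)
    {a : P.Atom k} (haμ : a ∈ μ .pos k) (ha : InClosure (atomCell z.2) a) :
    a ∈ atomCell z.2 .pos k := by
  rcases hP.mem_pos_or (hP.relevance z.1 z.2) ha with ha | ⟨S, hfin, hff, hout, haS⟩
  · exact ha
  · exfalso
    refine (Gluing.dual (hP.op.gluing k) (hμ.bd hkn .pos) hfin hff (hout.trans ?_)).1 a haS ?_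
    · intro b hb
      rw [bd_self, h.mem_iff k le_rfl]
      exact ⟨z, hz, hb⟩
    · rwa [bd_self]

/-- Related `k`-atoms of `μ` belong to the same maximal atom. -/
theorem IsSplit.eq_of_atEquiv (hP : P.IsRegular) {n : ℕ} {μ : P.PreCell} (hμ : IsCell n μ)
    {k : ℕ} (h : IsSplit μ k) (hkn : k ≤ n) {a b : μ .pos k} (hab : AtEquiv μ k a b) :
    ∀ z ∈ maxAtoms μ, a.1 ∈ atomCell z.2 .pos k ↔ b.1 ∈ atomCell z.2 .pos k := by
  induction hab with
  | rel a b hab =>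
    obtain ⟨m, x, hkm, hx, hax, hbx⟩ := hab
    obtain ⟨w, hw, hxw⟩ := h.exists_closure hx hkm.le
    have hmem : ∀ c : μ .pos k, c.1 ∈ atomCell x .pos k → c.1 ∈ atomCell w.2 .pos k :=
      fun c hc => h.mem_atomCell hP hμ hkn hw c.2 (.of_atomCell hxw (.base .pos hc))
    intro z hz
    constructor
    · intro ha
      rw [h.unique k le_rfl .pos a.1 z hz w hw ha (hmem a hax)]
      exact hmem b hbx
    · intro hb
      rw [h.unique k le_rfl .pos b.1 z hz w hw hb (hmem b hbx)]
      exact hmem a hax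
  | refl => exact fun _ _ => Iff.rfl
  | symm a b _ ih => exact fun z hz => (ih z hz).symm
  | trans a b c _ _ ih1 ih2 => exact fun z hz => (ih1 z hz).trans (ih2 z hz)

/-- The splitting passes down by taking outer faces. This commutes with the union over maximal atoms
once no face of one of them is cancelled by a face of another, and the hypothesis on At_{k+1}
supplies that. -/
theorem IsSplit.step (hP : P.IsRegular) {n : ℕ} {μ : P.PreCell} (hμ : IsCell n μ) {k : ℕ}
    (h : IsSplit μ (k + 1)) (hkn : k < n) (hAt : AtIsEquivalence μ (k + 1)) : IsSplit μ k := by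
  have hout : ∀ ε δ, outer δ (μ ε (k + 1)) = μ δ k \ μ δ.flip k := hμ.outer hkn
  have hff : ∀ ε, ForkFree (μ ε (k + 1)) := fun ε => hμ.forkFree ε _ hkn
  have hsub : ∀ ε, ∀ z ∈ maxAtoms μ, atomCell z.2 ε (k + 1) ⊆ μ ε (k + 1) := fun ε z hz a ha =>
    (h.mem_iff _ le_rfl ε a).2 ⟨z, hz, ha⟩
  -- comparable target atoms belong to the same maximal atom
  have hpos : ∀ z ∈ maxAtoms μ, ∀ w ∈ maxAtoms μ, ∀ u ∈ atomCell z.2 .pos (k + 1),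
      ∀ v ∈ atomCell w.2 .pos (k + 1), Tri u v → z = w := by
    intro z hz w hw u hu v hv huv
    have hequiv := (hAt ⟨u, hsub _ z hz hu⟩ ⟨v, hsub _ w hw hv⟩).1 (.single (.inr huv))
    have hv' := (h.eq_of_atEquiv hP hμ hkn hequiv z hz).1 hu
    exact h.unique _ le_rfl _ v z hz w hw hv' hv
  have hlevel : ∀ ε δ, ∀ z ∈ maxAtoms μ, k < z.1 →
      outer δ (atomCell z.2 ε (k + 1)) = atomCell z.2 δ k :=
    fun ε δ z _ hkz => hP.outer_atomCell z.2 ε δ hkz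
  have hface : ∀ ε δ, ∀ z ∈ maxAtoms μ, k < z.1 → ∀ b ∈ atomCell z.2 δ k,
      ∃ u ∈ atomCell z.2 ε (k + 1), b ∈ P.face δ u := fun ε δ z hz hkz b hb => by
    rw [← hlevel ε δ z hz hkz] at hb
    exact outer_subset_faces _ _ hb
  -- Proved with (k+1)-atoms of the target, where the hypothesis applies. The conclusion involves
  -- only k-dimensional boundaries, so it transfers to the source side below.
  have hno : ∀ z ∈ maxAtoms μ, ∀ w ∈ maxAtoms μ, k < z.1 → k < w.1 →
      ∀ b ∈ atomCell z.2 .pos k, b ∉ atomCell w.2 .neg k := by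
    intro z hz w hw hkz hkw b hbz hbw
    obtain ⟨u, hu, hbu⟩ := hface .pos .pos z hz hkz b hbz
    obtain ⟨v, hv, hbv⟩ := hface .pos .neg w hw hkw b hbw
    obtain rfl := hpos z hz w hw u hu v hv ⟨b, hbu, hbv⟩
    exact hP.disjoint_atomCell z.2 .pos hkz hbz hbw
  -- the comparison of faces between different maximal atoms
  have htri : ∀ ε, ∀ z ∈ maxAtoms μ, ∀ w ∈ maxAtoms μ, ∀ u ∈ atomCell z.2 ε (k + 1),
      ∀ v ∈ atomCell w.2 ε (k + 1), Tri u v → z = w := by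
    rintro ε z hz w hw u hu v hv ⟨b, hbu, hbv⟩
    by_contra hzw
    have hbz : b ∉ faces .neg (atomCell z.2 ε (k + 1)) := by
      rintro ⟨v', hv', hbv'⟩
      have := (hff ε).eq (hsub _ z hz hv') (hsub _ w hw hv) hbv' hbv
      subst this
      exact hzw (h.unique _ le_rfl _ _ z hz w hw hv' hv)
    have hbw : b ∉ faces .pos (atomCell w.2 ε (k + 1)) := by
      rintro ⟨v', hv', hbv'⟩
      have := (hff ε).eq (hsub _ w hw hv') (hsub _ z hz hu) hbv' hbu
      subst this
      exact hzw (h.unique _ le_rfl _ _ z hz w hw hu hv')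
    have hkz : k < z.1 := le_dim_of_mem_atomCell hu
    have hkw : k < w.1 := le_dim_of_mem_atomCell hv
    refine hno z hz w hw hkz hkw b ?_ ?_
    · rw [← hlevel ε .pos z hz hkz]; exact ⟨⟨u, hu, hbu⟩, hbz⟩
    · rw [← hlevel ε .neg w hw hkw]; exact ⟨⟨v, hv, hbv⟩, hbw⟩
  have hmem_outer : ∀ ε, ∀ z ∈ maxAtoms μ, k < z.1 → ∀ a ∈ atomCell z.2 ε k,
      a ∈ outer ε (μ ε (k + 1)) := by
    intro ε z hz hkz a ha
    obtain ⟨u, hu, hau⟩ := hface ε ε z hz hkz a ha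
    rw [outer_eq]
    refine ⟨⟨u, hsub _ z hz hu, hau⟩, ?_⟩
    rintro ⟨v, hv, hav⟩
    obtain ⟨w, hw, hvw⟩ := (h.mem_iff _ le_rfl _ v).1 hv
    have hzw : z = w := by
      cases ε
      · exact (htri _ w hw z hz v hvw u hu ⟨a, hav, hau⟩).symm
      · exact htri _ z hz w hw u hu v hvw ⟨a, hau, hav⟩
    subst hzw
    rw [← hlevel ε ε z hz hkz, outer_eq] at ha
    exact ha.2 ⟨v, hvw, hav⟩
  have hsubk : ∀ ε, ∀ z ∈ maxAtoms μ, ∀ a ∈ atomCell z.2 ε k, a ∈ μ ε k := by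
    intro ε z hz a ha
    rcases (le_dim_of_mem_atomCell ha).eq_or_lt with hkz | hkz
    · obtain ⟨i, z⟩ := z
      simp only at hkz
      subst hkz
      rw [eq_of_mem_atomCell ha]
      cases ε
      · exact hz.1
      · exact hz.2
    · have := hmem_outer ε z hz hkz a ha
      rw [hout] at this
      exact this.1
  -- A maximal atom of dimension k lies in both k-boundaries of μ, so it is not an outer face of the
  -- (k+1)-atoms.
  have hmix : ∀ ε, ∀ z ∈ maxAtoms μ, ∀ w ∈ maxAtoms μ, z.1 = k → k < w.1 →
      ∀ a ∈ atomCell z.2 ε k, a ∉ atomCell w.2 ε k := by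
    rintro ε ⟨i, z⟩ hz w hw rfl hkw a haz haw
    have := hmem_outer ε w hw hkw a haw
    rw [hout, eq_of_mem_atomCell haz] at this
    cases ε
    · exact this.2 hz.2
    · exact this.2 hz.1
  refine ⟨fun j hj ε a => ?_, fun j hj ε a z hz w hw haz haw => ?_⟩
  · rcases hj.eq_or_lt with rfl | hj
    · refine ⟨fun ha => ?_, fun ⟨z, hz, ha⟩ => hsubk ε z hz a ha⟩
      by_cases hmax : a ∈ μ ε.flip k
      · refine ⟨⟨k, a⟩, ?_, mem_atomCell_self _ _⟩
        cases ε
        · exact ⟨ha, hmax⟩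
        · exact ⟨hmax, ha⟩
      · have haout : a ∈ outer ε (μ ε (k + 1)) := by rw [hout]; exact ⟨ha, hmax⟩
        rw [outer_eq] at haout
        obtain ⟨⟨u, hu, hau⟩, hn⟩ := haout
        obtain ⟨z, hz, huz⟩ := (h.mem_iff _ le_rfl _ u).1 hu
        refine ⟨z, hz, ?_⟩
        rw [← hlevel ε ε z hz (le_dim_of_mem_atomCell huz), outer_eq]
        exact ⟨⟨u, huz, hau⟩, fun h' => hn (faces_mono (hsub _ z hz) h')⟩
    · exact h.mem_iff j hj ε a
  · rcases hj.eq_or_lt with rfl | hj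
    · rcases (le_dim_of_mem_atomCell haz).eq_or_lt with hkz | hkz <;>
        rcases (le_dim_of_mem_atomCell haw).eq_or_lt with hkw | hkw
      · obtain ⟨i, z⟩ := z
        obtain ⟨i', w⟩ := w
        simp only at hkz hkw
        subst hkz
        subst hkw
        have hz' : a = z := eq_of_mem_atomCell haz
        have hw' : a = w := eq_of_mem_atomCell haw
        rw [← hz', ← hw']
      · exact absurd haw (hmix ε z hz w hw hkz.symm hkw a haz)
      · exact absurd haz (hmix ε w hw z hz hkw.symm hkz a haw)
      · obtain ⟨u, hu, hau⟩ := hface ε ε z hz hkz a haz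
        obtain ⟨v, hv, hav⟩ := hface ε ε w hw hkw a haw
        have := (hff ε).eq (hsub _ z hz hu) (hsub _ w hw hv) hau hav
        subst this
        exact h.unique _ le_rfl _ _ z hz w hw hu hv
    · exact h.unique j hj ε a z hz w hw haz haw

/-- If no further compositions are possible above dimension `k` then `μ` splits into its maximal
atoms in dimensions at least `k`. -/
theorem isSplit (hP : P.IsRegular) {n : ℕ} {μ : P.PreCell} (hμ : IsCell n μ) {k : ℕ} (hkn : k ≤ n)
    (hAt : ∀ i, k < i → AtIsEquivalence μ i) : IsSplit μ k := by
  induction hkn using Nat.decreasingInduction with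
  | self => exact isSplit_top hμ
  | of_succ k hk ih =>
    exact (ih fun i hi => hAt i (by omega)).step hP hμ hk (hAt _ (Nat.lt_succ_self k))

/-! ### Pieces of a cell -/

/-- The maximal atoms of `μ` whose `k`-dimensional target lies in `V` but not in `U`. -/
def atomsBetween (μ : P.PreCell) {k : ℕ} (U V : Set (P.Atom k)) : Set (Σ i, P.Atom i) :=
  {z | z ∈ maxAtoms μ ∧ atomCell z.2 .pos k ⊆ V \ U}

/-- The part of `μ` between the initial segments `U` and `V` of the set of `(q+1)`-atoms of the
target of `μ`. -/
def piece (μ : P.PreCell) (q : ℕ) (U V : Set (P.Atom (q + 1))) : P.PreCell := fun ε =>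
  Function.update (fun j => if j < q then μ ε j else
    {a | ∃ z ∈ atomsBetween μ U V, a ∈ atomCell z.2 ε j}) q
    (act (μ .neg q) (match ε with | .neg => U | .pos => V))

theorem piece_of_lt {μ : P.PreCell} {q j : ℕ} {U V : Set (P.Atom (q + 1))} {ε : Sgn} (h : j < q) :
    piece μ q U V ε j = μ ε j :=
  (Function.update_of_ne h.ne _ _).trans (if_pos h)

@[simp] theorem piece_neg {μ : P.PreCell} {q : ℕ} {U V : Set (P.Atom (q + 1))} :
    piece μ q U V .neg q = act (μ .neg q) U := Function.update_self _ _ _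

@[simp] theorem piece_pos {μ : P.PreCell} {q : ℕ} {U V : Set (P.Atom (q + 1))} :
    piece μ q U V .pos q = act (μ .neg q) V := Function.update_self _ _ _

theorem piece_of_gt {μ : P.PreCell} {q j : ℕ} {U V : Set (P.Atom (q + 1))} {ε : Sgn} (h : q < j) :
    piece μ q U V ε j = {a | ∃ z ∈ atomsBetween μ U V, a ∈ atomCell z.2 ε j} :=
  (Function.update_of_ne h.ne' _ _).trans (if_neg h.not_gt)

theorem mem_piece {μ : P.PreCell} {q j : ℕ} {U V : Set (P.Atom (q + 1))} {ε : Sgn} (h : q < j)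
    {a : P.Atom j} :
    a ∈ piece μ q U V ε j ↔ ∃ z ∈ atomsBetween μ U V, a ∈ atomCell z.2 ε j := by
  rw [piece_of_gt h]; rfl

/-- An initial segment of the set of `(q+1)`-atoms of the target of `μ`. -/
structure IsInitial (μ : P.PreCell) {k : ℕ} (U : Set (P.Atom k)) : Prop where
  subset : U ⊆ μ .pos k
  tri : ∀ a ∈ μ .pos k, ∀ b ∈ U, Tri a b → a ∈ U
  atom : ∀ z ∈ maxAtoms μ, ∀ a ∈ U, a ∈ atomCell z.2 .pos k → atomCell z.2 .pos k ⊆ U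

theorem isInitial_empty {μ : P.PreCell} {k : ℕ} : IsInitial μ (∅ : Set (P.Atom k)) :=
  ⟨Set.empty_subset _, fun _ _ _ h => h.elim, fun _ _ _ h => h.elim⟩

theorem IsSplit.isInitial_univ {μ : P.PreCell} {k : ℕ} (h : IsSplit μ k) :
    IsInitial μ (μ .pos k) :=
  ⟨subset_rfl, fun _ ha _ _ _ => ha, fun z hz _ _ _ b hb => (h.mem_iff k le_rfl _ b).2 ⟨z, hz, hb⟩⟩

section

variable {μ : P.PreCell} {n q : ℕ} {U V W : Set (P.Atom (q + 1))}

theorem IsInitial.outer_subset (hμ : IsCell n μ) (hqn : q < n) (hU : IsInitial μ U) :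
    outer .neg U ⊆ μ .neg q := by
  rintro b ⟨⟨u, hu, hbu⟩, hn⟩
  refine ((hμ.outer hqn .pos .neg).subset ⟨⟨u, hU.subset hu, hbu⟩, ?_⟩).1
  rintro ⟨v, hv, hbv⟩
  exact hn ⟨v, hU.tri v hv u hu ⟨b, hbv, hbu⟩, hbv⟩

theorem IsInitial.gluing (hP : P.IsRegular) (hμ : IsCell n μ) (hqn : q < n) (hU : IsInitial μ U) :
    (∀ b ∈ faces .pos U, b ∉ μ .neg q) ∧ ∃ Y : P.PreCell, IsCell q Y ∧
      (∀ ε j, j < q → Y ε j = μ ε j) ∧ Y .pos q = act (μ .neg q) U := by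
  obtain ⟨h1, Y, hY, hlow, htop⟩ := hP.gluing q (bd .neg q μ) U (hμ.bd hqn.le _)
    ((hμ.finite _ _).subset hU.subset) ((hμ.forkFree _ _ hqn).subset hU.subset)
    (by rw [bd_self]; exact hU.outer_subset hμ hqn)
  rw [bd_self] at h1 htop
  exact ⟨h1, Y, hY, fun ε j hj => (hlow ε j hj).trans (bd_of_lt hj), htop⟩

/-- The layer between U and V moves the slice at U to the slice at V. No target of the layer is a
source of U, since U contains its predecessors, and fork-freeness excludes common sources and common
targets. -/
theorem IsInitial.outer_sdiff (hP : P.IsRegular) (hμ : IsCell n μ) (hqn : q < n)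
    (hU : IsInitial μ U) (hV : IsInitial μ V) (hUV : U ⊆ V) :
    outer .neg (V \ U) = act (μ .neg q) U \ act (μ .neg q) V ∧
      outer .pos (V \ U) = act (μ .neg q) V \ act (μ .neg q) U := by
  have hff : ForkFree V := (hμ.forkFree _ _ hqn).subset hV.subset
  have hVA := (hV.gluing hP hμ hqn).1
  have hV0 := hV.outer_subset hμ hqn
  have hno : ∀ b ∈ faces .pos (V \ U), b ∉ faces .neg U := by
    rintro b ⟨v, hv, hbv⟩ ⟨u, hu, hbu⟩
    exact hv.2 (hU.tri v (hV.subset hv.1) u hu ⟨b, hbv, hbu⟩)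
  have hsame : ∀ δ, ∀ b ∈ faces δ (V \ U), b ∉ faces δ U := by
    rintro δ b ⟨v, hv, hbv⟩ ⟨u, hu, hbu⟩
    exact hv.2 (hff.eq hv.1 (hUV hu) hbv hbu ▸ hu)
  have hV' : ∀ δ b, b ∈ faces δ V ↔ b ∈ faces δ U ∨ b ∈ faces δ (V \ U) := by
    intro δ b
    rw [← Set.mem_union, ← faces_union, Set.union_sdiff_cancel hUV]
  constructor <;> ext b
  all_goals
    have h1 := hVA b
    have h2 := hno b
    have h3 := hsame .neg b
    have h4 := hsame .pos b
    have h5 := hV' .neg b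
    have h6 := hV' .pos b
    have h7 := @hV0 b
    simp only [outer, mem_act, Set.mem_sdiff] at h7 ⊢
    grind

/-- U \ (U ∩ V) and V \ (U ∩ V) move the same slice to the same slice, so their outer sources agree.
By fork-freeness a source face determines its atom, but the two sets are disjoint; hence both are
empty. -/
theorem IsInitial.act_injective (hP : P.IsRegular) (hμ : IsCell n μ) (hqn : q < n)
    (hU : IsInitial μ U) (hV : IsInitial μ V)
    (h : act (μ .neg q) U = act (μ .neg q) V) : U = V := by
  have hI : IsInitial μ (U ∩ V) :=
    ⟨fun a ha => hU.subset ha.1, fun a ha b hb hab => ⟨hU.tri a ha b hb.1 hab, hV.tri a ha b hb.2 hab⟩,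
      fun z hz a ha haz => Set.subset_inter (hU.atom z hz a ha.1 haz) (hV.atom z hz a ha.2 haz)⟩
  have hff := hμ.forkFree .pos _ hqn
  have key : ∀ U V : Set (P.Atom (q + 1)), IsInitial μ U → IsInitial μ V → IsInitial μ (U ∩ V) →
      act (μ .neg q) U = act (μ .neg q) V → U ⊆ V := by
    intro U V hU hV hI h
    have h1 := (hI.outer_sdiff hP hμ hqn hU Set.inter_subset_left).1
    have h2 := (hI.outer_sdiff hP hμ hqn hV Set.inter_subset_right).1
    rw [h, ← h2] at h1
    by_contra hUV
    obtain ⟨v, hvU, hvV⟩ := Set.not_subset.1 hUV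
    obtain ⟨b, hb⟩ := hP.outer_nonempty (S := U \ (U ∩ V)) ((hμ.finite _ _).subset
      (Set.sdiff_subset.trans hU.subset)) ⟨v, hvU, fun h => hvV h.2⟩ .neg
    obtain ⟨x, hx, hbx⟩ := outer_subset_faces _ _ hb
    rw [h1] at hb
    obtain ⟨y, hy, hby⟩ := outer_subset_faces _ _ hb
    have := hff.eq (hU.subset hx.1) (hV.subset hy.1) hbx hby
    subst this
    exact hx.2 ⟨hx.1, hy.1⟩
  exact Set.Subset.antisymm (key U V hU hV hI h)
    (key V U hV hU (by rwa [Set.inter_comm]) h.symm)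

theorem bd_piece_of_lt {i : ℕ} (h : i < q) (ε : Sgn) : bd ε i (piece μ q U V) = bd ε i μ :=
  bd_eq_bd_iff.2 ⟨fun _ _ hj => piece_of_lt (hj.trans h), piece_of_lt h⟩

theorem piece_self_of_gt (hP : P.IsRegular) {j : ℕ} (h : q < j) (ε : Sgn) :
    piece μ q U U ε j = ∅ := by
  rw [Set.eq_empty_iff_forall_notMem]
  intro a ha
  obtain ⟨z, ⟨-, hz⟩, ha⟩ := (mem_piece h).1 ha
  obtain ⟨b, hb⟩ := hP.atomCell_nonempty z.2 .pos (h.trans_le (le_dim_of_mem_atomCell ha) : q + 1 ≤ _)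
  exact (hz hb).2 (hz hb).1

/-- The degenerate piece from U to U is the identity on the slice at U. These q-cells stand for the
cuts throughout. -/
theorem bd_neg_piece (hP : P.IsRegular) : bd .neg q (piece μ q U V) = piece μ q U U := by
  funext δ j
  rcases lt_trichotomy j q with hj | rfl | hj
  · rw [bd_of_lt hj, piece_of_lt hj, piece_of_lt hj]
  · rw [bd_self]; cases δ <;> simp
  · rw [bd_of_gt hj, piece_self_of_gt hP hj]

theorem bd_pos_piece (hP : P.IsRegular) : bd .pos q (piece μ q U V) = piece μ q V V := by
  funext δ j
  rcases lt_trichotomy j q with hj | rfl | hj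
  · rw [bd_of_lt hj, piece_of_lt hj, piece_of_lt hj]
  · rw [bd_self]; cases δ <;> simp
  · rw [bd_of_gt hj, piece_self_of_gt hP hj]

theorem piece_injective (hP : P.IsRegular) (hμ : IsCell n μ) (hqn : q < n)
    (hU : IsInitial μ U) (hV : IsInitial μ V) (h : piece μ q U U = piece μ q V V) : U = V := by
  refine hU.act_injective hP hμ hqn hV ?_
  have := congrFun (congrFun h .neg) q
  rwa [piece_neg, piece_neg] at this

/-- V contains ⟨z⟩_{q+1} as soon as it meets it, so each maximal atom between U and W falls entirely
on one side of V. -/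
theorem comp_piece (hV : IsInitial μ V) (hUV : U ⊆ V) (hVW : V ⊆ W) :
    comp q (piece μ q V W) (piece μ q U V) = piece μ q U W := by
  funext δ j
  rcases lt_trichotomy j q with hj | rfl | hj
  · rw [comp_of_lt hj, piece_of_lt hj, piece_of_lt hj]
  · cases δ <;> simp
  · rw [comp_of_gt hj]
    ext a
    rw [Set.mem_union, mem_piece hj, mem_piece hj, mem_piece hj]
    constructor
    · rintro (⟨z, ⟨hz, hzs⟩, ha⟩ | ⟨z, ⟨hz, hzs⟩, ha⟩)
      · exact ⟨z, ⟨hz, fun b hb => ⟨hVW (hzs hb).1, (hzs hb).2⟩⟩, ha⟩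
      · exact ⟨z, ⟨hz, fun b hb => ⟨(hzs hb).1, fun h => (hzs hb).2 (hUV h)⟩⟩, ha⟩
    · rintro ⟨z, ⟨hz, hzs⟩, ha⟩
      by_cases h : ∃ b ∈ V, b ∈ atomCell z.2 .pos (q + 1)
      · obtain ⟨b, hbV, hb⟩ := h
        exact .inl ⟨z, ⟨hz, fun c hc => ⟨hV.atom z hz b hbV hb hc, (hzs hc).2⟩⟩, ha⟩
      · exact .inr ⟨z, ⟨hz, fun c hc => ⟨(hzs hc).1, fun hcV => h ⟨c, hcV, hc⟩⟩⟩, ha⟩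

theorem IsSplit.piece_univ (hP : P.IsRegular) (hμ : IsCell n μ) (hqn : q < n)
    (hs : IsSplit μ (q + 1)) : piece μ q ∅ (μ .pos (q + 1)) = μ := by
  funext δ j
  rcases lt_trichotomy j q with hj | rfl | hj
  · rw [piece_of_lt hj]
  · cases δ
    · rw [piece_neg, act_empty]
    · rw [piece_pos, ← hP.pos_eq_act hμ hqn]
  · ext a
    rw [mem_piece hj, hs.mem_iff j hj]
    refine exists_congr fun z => and_congr_left fun _ => ⟨fun h => h.1, fun h => ⟨h, fun b hb => ?_⟩⟩
    exact ⟨(hs.mem_iff _ le_rfl _ b).2 ⟨z, h, hb⟩, fun h => h⟩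

theorem IsSplit.piece_top (hs : IsSplit μ (q + 1)) (hU : IsInitial μ U) (hV : IsInitial μ V) :
    piece μ q U V .pos (q + 1) = V \ U := by
  ext a
  rw [mem_piece (Nat.lt_succ_self q)]
  constructor
  · rintro ⟨z, ⟨-, hz⟩, ha⟩
    exact hz ha
  · rintro ⟨haV, haU⟩
    obtain ⟨z, hz, ha⟩ := (hs.mem_iff _ le_rfl _ a).1 (hV.subset haV)
    exact ⟨z, ⟨hz, fun b hb => ⟨hV.atom z hz a haV ha hb, fun hbU =>
      haU (hU.atom z hz b hbU hb ha)⟩⟩, ha⟩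

theorem IsSplit.piece_subset (hs : IsSplit μ (q + 1)) {j : ℕ} (hj : q < j) (ε : Sgn) :
    piece μ q U V ε j ⊆ μ ε j := by
  intro a ha
  obtain ⟨z, hz, ha⟩ := (mem_piece hj).1 ha
  exact (hs.mem_iff j hj ε a).2 ⟨z, hz.1, ha⟩

theorem IsSplit.inClosure_piece (hs : IsSplit μ (q + 1)) (hU : IsInitial μ U) (hV : IsInitial μ V)
    {ε : Sgn} {j : ℕ} {a : P.Atom j} (ha : a ∈ piece μ q U V ε j) : InClosure μ a := by
  rcases lt_trichotomy j q with hj | rfl | hj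
  · rw [piece_of_lt hj] at ha; exact .base _ ha
  · have key : ∀ W : Set (P.Atom (j + 1)), IsInitial μ W → a ∈ act (μ .neg j) W →
        InClosure μ a := by
      rintro W hW ⟨ha | ⟨w, hw, ha⟩, -⟩
      · exact .base _ ha
      · exact .face _ (.base _ (hW.subset hw)) ha
    cases ε
    · rw [piece_neg] at ha; exact key U hU ha
    · rw [piece_pos] at ha; exact key V hV ha
  · exact .base _ (hs.piece_subset hj ε ha)

theorem outer_atomCell_congr (hP : P.IsRegular) {m i : ℕ} (x : P.Atom m) (ε ε' δ : Sgn) :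
    outer δ (atomCell x ε (i + 1)) = outer δ (atomCell x ε' (i + 1)) := by
  rcases lt_or_ge i m with h | h
  · rw [hP.outer_atomCell x ε δ h, hP.outer_atomCell x ε' δ h]
  · rw [atomCell_of_lt x ε (by omega), atomCell_of_lt x ε' (by omega)]

theorem IsSplit.mem_outer_piece (hμ : IsCell n μ) (hs : IsSplit μ (q + 1)) {j : ℕ} (hqj : q ≤ j)
    (hj : j < n) (ε δ : Sgn) (a : P.Atom j) : a ∈ outer δ (piece μ q U V ε (j + 1)) ↔
      (∃ z ∈ atomsBetween μ U V, a ∈ outer δ (atomCell z.2 ε (j + 1))) ∧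
        ∀ z ∈ atomsBetween μ U V, a ∉ outer δ.flip (atomCell z.2 ε (j + 1)) := by
  rw [piece_of_gt (by omega)]
  refine mem_outer_iUnion δ _ (fun z : Σ i, P.Atom i => atomCell z.2 ε (j + 1)) ?_ a
  rintro γ z hz w hw hzw b ⟨u, hu, hbu⟩ ⟨v, hv, hbv⟩
  have hmem := hs.mem_iff (j + 1) (by omega) ε
  have := (hμ.forkFree ε (j + 1) hj).eq ((hmem u).2 ⟨z, hz.1, hu⟩) ((hmem v).2 ⟨w, hw.1, hv⟩) hbu hbv
  subst this
  exact hzw (hs.unique (j + 1) (by omega) ε u z hz.1 w hw.1 hu hv)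

/-- Below dimension q the moves are those of the two slices, which are cells by gluing. In dimension
q they are the moves of the layer V \ U. Above q the piece is a disjoint union of cells of atoms,
sharing no source faces and no target faces. -/
theorem IsSplit.isCell_piece (hP : P.IsRegular) (hμ : IsCell n μ) (hqn : q < n)
    (hs : IsSplit μ (q + 1)) (hU : IsInitial μ U) (hV : IsInitial μ V) (hUV : U ⊆ V) :
    IsCell n (piece μ q U V) := by
  obtain ⟨-, A, hA, hAlow, hAtop⟩ := hU.gluing hP hμ hqn
  obtain ⟨-, B, hB, hBlow, hBtop⟩ := hV.gluing hP hμ hqn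
  have hq : ∀ ε, ∃ C : P.PreCell, IsCell q C ∧ (∀ δ j, j < q → C δ j = μ δ j) ∧
      C .pos q = piece μ q U V ε q := by
    intro ε
    cases ε
    · exact ⟨A, hA, hAlow, by rw [hAtop, piece_neg]⟩
    · exact ⟨B, hB, hBlow, by rw [hBtop, piece_pos]⟩
  have houtq : ∀ δ, outer δ (piece μ q U V .pos (q + 1)) =
      piece μ q U V δ q \ piece μ q U V δ.flip q := by
    have h := hU.outer_sdiff hP hμ hqn hV hUV
    intro δ
    rw [hs.piece_top hU hV]
    cases δ
    · simp only [Sgn.flip, piece_neg, piece_pos]; exact h.1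
    · simp only [Sgn.flip, piece_neg, piece_pos]; exact h.2
  have hmoves : ∀ ε δ j, j < n → outer δ (piece μ q U V ε (j + 1)) =
      piece μ q U V δ j \ piece μ q U V δ.flip j := by
    intro ε δ j hj
    rcases lt_trichotomy j q with hjq | rfl | hqj
    · obtain ⟨C, hC, hlow, htop⟩ := hq ε
      rw [piece_of_lt hjq, piece_of_lt hjq]
      rcases (Nat.succ_le_of_lt hjq).lt_or_eq with h | rfl
      · rw [piece_of_lt h, hμ.outer hj]
      · rw [← htop, hC.outer (Nat.lt_succ_self j), hlow _ _ hjq, hlow _ _ hjq]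
    · rw [← houtq]
      ext a
      rw [hs.mem_outer_piece hμ le_rfl hj, hs.mem_outer_piece hμ le_rfl hj]
      simp only [outer_atomCell_congr hP _ ε .pos]
    · ext a
      rw [hs.mem_outer_piece hμ hqj.le hj, Set.mem_sdiff, mem_piece hqj, mem_piece hqj]
      have hout : ∀ z ∈ atomsBetween μ U V, ∀ γ, a ∈ outer γ (atomCell z.2 ε (j + 1)) →
          a ∈ atomCell z.2 γ j := by
        intro z hz γ ha
        rcases lt_or_ge j z.1 with h | h
        · rwa [hP.outer_atomCell z.2 ε γ h] at ha
        · rw [atomCell_of_lt z.2 ε (by omega), outer_empty] at ha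
          exact ha.elim
      constructor
      · rintro ⟨⟨z, hz, ha⟩, hall⟩
        refine ⟨⟨z, hz, hout z hz δ ha⟩, ?_⟩
        rintro ⟨w, hw, haw⟩
        rcases (le_dim_of_mem_atomCell haw).lt_or_eq with hjw | hjw
        · refine hall w hw ?_
          rwa [hP.outer_atomCell w.2 ε δ.flip hjw]
        -- Now a is itself the maximal atom w, and z = w by uniqueness; but an atom of dimension j
        -- has no (j+1)-component for a to be an outer face of.
        · obtain ⟨i, w⟩ := w
          simp only at hjw
          subst hjw
          have hw' : a = w := eq_of_mem_atomCell haw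
          subst hw'
          have := hs.unique j hqj δ a z hz.1 ⟨j, a⟩ hw.1 (hout z hz δ ha) (mem_atomCell_self a δ)
          subst this
          have hne : outer δ (atomCell (⟨j, a⟩ : Σ i, P.Atom i).2 ε (j + 1)) = ∅ := by
            rw [atomCell_of_lt _ ε (Nat.lt_succ_self j), outer_empty]
          rw [hne] at ha
          exact ha
      · rintro ⟨⟨z, hz, ha⟩, hall⟩
        refine ⟨⟨z, hz, ?_⟩, fun w hw haw => hall ⟨w, hw, hout w hw _ haw⟩⟩
        rcases (le_dim_of_mem_atomCell ha).lt_or_eq with hjz | hjz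
        · rwa [hP.outer_atomCell z.2 ε δ hjz]
        · obtain ⟨i, z⟩ := z
          simp only at hjz
          subst hjz
          have hz' : a = z := eq_of_mem_atomCell ha
          subst hz'
          exact absurd ⟨_, hz, mem_atomCell_self a δ.flip⟩ hall
  refine ⟨fun ε j hj => ?_, ?_, fun ε j => ?_, fun ε j hj => ?_, fun ε j hj =>
    ⟨hmoves ε .neg j hj, hmoves ε .pos j hj⟩⟩
  · exact Set.subset_empty_iff.1
      ((hs.piece_subset (by omega) ε).trans (hμ.empty_above ε j hj).subset)
  · rw [piece_of_gt hqn, piece_of_gt hqn]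
    have hM : ∀ z ∈ atomsBetween μ U V, ∀ ε, ∀ a : P.Atom n, a ∈ atomCell z.2 ε n →
        z = ⟨n, a⟩ := by
      rintro z hz ε a ha
      have h1 := le_dim_of_mem_atomCell ha
      have h2 := InClosure.le_dim hμ (maxAtoms.inClosure hz.1)
      obtain ⟨i, z⟩ := z
      obtain rfl : i = n := by simp only at h1 h2; omega
      have : a = z := eq_of_mem_atomCell ha
      rw [this]
    ext a
    constructor <;> rintro ⟨z, hz, ha⟩ <;> refine ⟨z, hz, ?_⟩ <;>
      (have := hM z hz _ a ha; subst this; exact mem_atomCell_self a _)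
  · rcases lt_trichotomy j q with hjq | rfl | hqj
    · rw [piece_of_lt hjq]; exact hμ.finite _ _
    · obtain ⟨C, hC, -, htop⟩ := hq ε
      rw [← htop]; exact hC.finite _ _
    · exact (hμ.finite _ _).subset (hs.piece_subset hqj ε)
  · rcases lt_trichotomy j q with hjq | rfl | hqj
    · rw [piece_of_lt hjq]; exact hμ.forkFree _ _ hj
    · obtain ⟨C, hC, -, htop⟩ := hq ε
      rw [← htop]; exact hC.forkFree _ _ le_rfl
    · obtain ⟨l, rfl⟩ : ∃ l, j = l + 1 := ⟨j - 1, by omega⟩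
      exact (hμ.forkFree _ _ hj).subset (hs.piece_subset hqj ε)

/-! ### Decompositions into two pieces -/

variable {c d : P.PreCell} {m m' : ℕ}

/-- A maximal atom belongs to c or to d, together with its whole closure above dimension q, because
the closures of c and d are disjoint there. Closure under predecessors is noninterference: no target
face of d is a source face of c. -/
theorem IsSplit.cut (hP : P.IsRegular) (hs : IsSplit μ (q + 1)) (hc : IsCell m c) (hd : IsCell m' d)
    (hcd : bd .pos q c = bd .neg q d) (h : comp q d c = μ) :
    IsInitial μ (c .pos (q + 1)) ∧ c = piece μ q ∅ (c .pos (q + 1)) := by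
  have hdis : ∀ {j : ℕ}, q < j → ∀ {a : P.Atom j}, InClosure c a → ¬ InClosure d a :=
    fun hj _ => hP.disjoint_closure hc hd hcd hj
  have hcomp : ∀ ε j, q < j → μ ε j = c ε j ∪ d ε j := fun ε j hj => by
    rw [← h, comp_of_gt hj]
  have hdim : ∀ z ∈ maxAtoms μ, ∀ {j ε} {a : P.Atom j}, q < j → a ∈ atomCell z.2 ε j →
      InClosure c z.2 ∨ InClosure d z.2 := by
    intro z hz j ε a hj ha
    have hz' := hz.1
    rw [hcomp _ _ (hj.trans_le (le_dim_of_mem_atomCell ha))] at hz'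
    exact hz'.imp (.base _) (.base _)
  -- a maximal atom that has one atom in common with `c` belongs to `c`
  have hcl : ∀ z ∈ maxAtoms μ, ∀ {j ε} {a : P.Atom j}, q < j → a ∈ c ε j → a ∈ atomCell z.2 ε j →
      ∀ {l δ} {b : P.Atom l}, q < l → b ∈ atomCell z.2 δ l → b ∈ c δ l := by
    intro z hz j ε a hj hac haz l δ b hl hb
    rcases hdim z hz hj haz with hzc | hzd
    · have hbμ : b ∈ μ δ l := (hs.mem_iff l hl δ b).2 ⟨z, hz, hb⟩
      rw [hcomp _ _ hl] at hbμ
      exact hbμ.resolve_right fun hbd => hdis hl (.of_atomCell hzc (.base _ hb)) (.base _ hbd)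
    · exact absurd (InClosure.of_atomCell hzd (.base _ haz)) (hdis hj (.base _ hac))
  have hcsub : ∀ {ε j}, q < j → c ε j ⊆ μ ε j := fun hj => by
    rw [hcomp _ _ hj]; exact Set.subset_union_left
  refine ⟨⟨hcsub (Nat.lt_succ_self q), ?_, ?_⟩, ?_⟩
  · rintro a ha b hb ⟨e, hea, heb⟩
    rw [hcomp _ _ (Nat.lt_succ_self q)] at ha
    refine ha.resolve_right fun had => ?_
    have hM := Gluing.noninterfering hP (hc.mono (le_max_left m (max m' (q + 1))))
      (hd.mono ((le_max_left m' (q + 1)).trans (le_max_right m _)))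
      (by omega) (bd_eq_bd_iff.1 hcd).2 .pos .pos
    exact hM.1 e ⟨b, hb, heb⟩ ⟨a, had, hea⟩
  · exact fun z hz a hac haz b hb => hcl z hz (Nat.lt_succ_self q) hac haz (Nat.lt_succ_self q) hb
  · have hcneg : c .neg q = μ .neg q := by rw [← h, comp_neg]
    funext ε j
    rcases lt_trichotomy j q with hj | rfl | hj
    · rw [piece_of_lt hj, ← h, comp_of_lt hj]
    · cases ε
      · rw [piece_neg, act_empty, hcneg]
      · rw [piece_pos, ← hcneg]
        exact hP.pos_eq_act (hc.mono (le_max_left m (j + 1))) (by omega) .pos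
    · ext a
      rw [mem_piece hj]
      constructor
      · intro ha
        obtain ⟨z, hz, haz⟩ := (hs.mem_iff j hj ε a).1 (hcsub hj ha)
        exact ⟨z, ⟨hz, fun b hb => ⟨hcl z hz hj ha haz (Nat.lt_succ_self q) hb, fun h => h⟩⟩, haz⟩
      · rintro ⟨z, ⟨hz, hzs⟩, haz⟩
        obtain ⟨b, hb⟩ := hP.atomCell_nonempty z.2 .pos
          (hj.trans_le (le_dim_of_mem_atomCell haz) : q + 1 ≤ z.1)
        exact hcl z hz (Nat.lt_succ_self q) (hzs hb).1 hb hj haz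

/-- Above dimension q the two factors are disjoint, so d is the complement of c in the composite. -/
theorem IsSplit.cut_sdiff (hP : P.IsRegular) (hc : IsCell m c) (hd : IsCell m' d)
    (hcd : bd .pos q c = bd .neg q d) (hU : IsInitial μ U)
    (hs : IsSplit μ (q + 1))
    (hcU : c = piece μ q ∅ U) (h : comp q d c = piece μ q ∅ V) : d = piece μ q U V := by
  have hbd := bd_eq_bd_iff.1 hcd
  funext ε j
  rcases lt_trichotomy j q with hj | rfl | hj
  · rw [piece_of_lt hj, ← hbd.1 _ _ hj, hcU, piece_of_lt hj]
  · cases ε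
    · rw [← hbd.2, hcU, piece_pos, piece_neg]
    · have := congrFun (congrFun h .pos) j
      rwa [comp_pos, piece_pos, ← piece_pos (U := U) (V := V)] at this
  · have hun := congrFun (congrFun h ε) j
    rw [comp_of_gt hj] at hun
    ext a
    have hdis : a ∈ c ε j → a ∉ d ε j := fun h1 h2 =>
      hP.disjoint_closure hc hd hcd hj (.base _ h1) (.base _ h2)
    rw [mem_piece hj]
    constructor
    · intro ha
      have ha' : a ∈ piece μ q ∅ V ε j := by rw [← hun]; exact .inr ha
      obtain ⟨z, ⟨hz, hzs⟩, haz⟩ := (mem_piece hj).1 ha'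
      refine ⟨z, ⟨hz, fun b hb => ⟨(hzs hb).1, fun hbU => hdis ?_ ha⟩⟩, haz⟩
      rw [hcU, mem_piece hj]
      exact ⟨z, ⟨hz, fun b' hb' => ⟨hU.atom z hz b hbU hb hb', fun h => h⟩⟩, haz⟩
    · rintro ⟨z, ⟨hz, hzs⟩, haz⟩
      have ha' : a ∈ piece μ q ∅ V ε j :=
        (mem_piece hj).2 ⟨z, ⟨hz, fun b hb => ⟨(hzs hb).1, fun h => h⟩⟩, haz⟩
      rw [← hun] at ha'
      refine ha'.resolve_left fun hac => ?_
      rw [hcU, mem_piece hj] at hac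
      obtain ⟨w, ⟨hw, hws⟩, haw⟩ := hac
      obtain rfl := hs.unique j hj ε a z hz w hw haz haw
      obtain ⟨b, hb⟩ := hP.atomCell_nonempty z.2 .pos
        (hj.trans_le (le_dim_of_mem_atomCell haz) : q + 1 ≤ z.1)
      exact (hzs hb).2 (hws hb).1

end

end OmegaHypergraph

/-! ### Shapes assembled along one dimension -/

namespace ThetaShape

/-- The path underlying a cell that starts at the first object (junk otherwise). -/
def Cell.path {T : ThetaShape} : Cell T → Path T
  | .start p => p
  | .skip _ => .here

theorem Cell.comp_zero_start {T : ThetaShape} (d : Cell T) (p : Path T) :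
    Cell.comp 0 d (.start p) = .start (p.append d) := by
  cases d <;> simp [Cell.comp]

theorem Cell.eq_of_pt (c : Cell pt) : c = .start .here := by
  cases c with
  | start p => cases p; rfl

theorem Path.eq_of_pt (p : Path pt) : p = .here := by cases p; rfl

/-- Without permitted compositions every wedge has at most one summand, so T is a globe. -/
theorem exists_top {n : ℕ} {S : Set ℕ} {T : ThetaShape} (hT : T.InTheta n S) (hS : ∀ i, i ∉ S) :
    ∃ x : Cell T, ∀ y : Cell T, ∃ ε i, y = x.bd ε i := by
  induction T generalizing n S with
  | pt => exact ⟨.start .here, fun y => ⟨.neg, 0, by rw [y.eq_of_pt]; simp [Cell.bd]⟩⟩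
  | cons A T ihA _ =>
    obtain ⟨-, hA, -, h0⟩ := hT
    obtain rfl := h0.resolve_right (hS 0)
    obtain ⟨a, ha⟩ := ihA hA fun i => hS (i + 1)
    refine ⟨.start (.step a .here), fun y => ?_⟩
    match y with
    | .start .here => exact ⟨.neg, 0, by simp [Cell.bd]⟩
    | .start (.step b p) =>
      obtain ⟨ε, i, rfl⟩ := ha b
      exact ⟨ε, i + 1, by rw [p.eq_of_pt]; simp [Cell.bd, Path.bdSucc]⟩
    | .skip c => exact ⟨.pos, 0, by rw [c.eq_of_pt]; simp [Cell.bd, Path.last]⟩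

/-- `T` is a string of `r` shapes composed along `∘_q`, where `t p s` is the composite of the
shapes from the `p`-th up to the `s`-th. -/
structure IsString (T : ThetaShape) (q r : ℕ) (t : ℕ → ℕ → Cell T) : Prop where
  bd_neg : ∀ p s, p ≤ s → s ≤ r → (t p s).bd .neg q = t p p
  bd_pos : ∀ p s, p ≤ s → s ≤ r → (t p s).bd .pos q = t s s
  comp : ∀ p s w, p ≤ s → s ≤ w → w ≤ r → Cell.comp q (t s w) (t p s) = t p w
  inj : ∀ p s, p ≤ r → s ≤ r → t p p = t s s → p = s
  cell : ∀ x, (∃ ε i, i < q ∧ x = (t 0 r).bd ε i) ∨ ∃ p s, p ≤ s ∧ s ≤ r ∧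
    x.bd .neg q = t p p ∧ x.bd .pos q = t s s ∧ (s = p → x = t p p) ∧
    (s = p + 1 → ∃ ε i, x = (t p s).bd ε i) ∧
    (p + 1 < s → ∃ y z, y.bd .neg q = t p p ∧ y.bd .pos q = t (p + 1) (p + 1) ∧
      z.bd .neg q = t (p + 1) (p + 1) ∧ z.bd .pos q = t s s ∧ x = Cell.comp q z y)

/-- The composites in a wedge sum `ΣA ∨ T`. -/
def wedgeString {A T : ThetaShape} (a : Cell A) (t : ℕ → ℕ → Cell T) :
    ℕ → ℕ → Cell (cons A T)
  | 0, 0 => .start .here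
  | 0, s + 1 => .start (.step a (t 0 s).path)
  -- Junk: only indices p ≤ s are meaningful.
  | _ + 1, 0 => .start .here
  | p + 1, s + 1 => .skip (t p s)

/-- Prepending ΣA shifts the indices by one, and A is a globe because no positive index is allowed.
The extra conclusions say that composites from the first cut are paths and that this cut is the
first object, as needed to attach the new step. -/
theorem exists_isString_zero {n : ℕ} {S : Set ℕ} {T : ThetaShape} (hT : T.InTheta n S)
    (hS : ∀ i ∈ S, i = 0) :
    ∃ r t, IsString T 0 r t ∧ (∀ s ≤ r, t 0 s = .start (t 0 s).path) ∧ t 0 0 = .start .here := by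
  induction T with
  | pt =>
    refine ⟨0, fun _ _ => .start .here, ⟨fun _ _ _ _ => ?_, fun _ _ _ _ => ?_, fun _ _ _ _ _ _ => ?_,
      fun p s hp hs _ => by omega, fun x => .inr ⟨0, 0, le_rfl, le_rfl, ?_⟩⟩, fun _ _ => rfl, rfl⟩
    · simp [Cell.bd]
    · simp [Cell.bd, Path.last]
    · simp [Cell.comp, Path.append]
    · rw [x.eq_of_pt]
      simp [Cell.bd, Path.last]
  | cons A T _ ihT =>
    obtain ⟨-, hA, hT, -⟩ := hT
    obtain ⟨a, ha⟩ := exists_top hA fun i hi => by simpa using hS _ hi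
    obtain ⟨r, t, ht, hst, h00⟩ := ihT hT
    have hneg : ∀ p : Path T, (Cell.start p).bd .neg 0 = .start .here := fun p => by simp [Cell.bd]
    have hpos : ∀ p : Path T, (Cell.start p).bd .pos 0 = p.last := fun p => by simp [Cell.bd]
    refine ⟨r + 1, wedgeString a t, ⟨?_, ?_, ?_, ?_, ?_⟩, ?_, rfl⟩
    · intro p s hps hsr
      match p, s with
      | 0, 0 => simp [wedgeString, Cell.bd]
      | 0, s + 1 => simp [wedgeString, Cell.bd]
      | p + 1, s + 1 =>
        simp only [wedgeString, Cell.bd]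
        rw [ht.bd_neg p s (by omega) (by omega)]
    · intro p s hps hsr
      match p, s with
      | 0, 0 => simp [wedgeString, Cell.bd, Path.last]
      | 0, s + 1 =>
        simp only [wedgeString, Cell.bd, Path.last]
        rw [← hpos, ← hst s (by omega), ht.bd_pos 0 s (by omega) (by omega)]
      | p + 1, s + 1 =>
        simp only [wedgeString, Cell.bd]
        rw [ht.bd_pos p s (by omega) (by omega)]
    · intro p s w hps hsw hwr
      match p, s, w with
      | 0, 0, 0 => simp [wedgeString, Cell.comp, Path.append]
      | 0, 0, w + 1 => simp [wedgeString, Cell.comp, Path.append]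
      | 0, s + 1, w + 1 =>
        simp only [wedgeString, Cell.comp, Path.append]
        have h := ht.comp 0 s w (by omega) (by omega) (by omega)
        rw [hst s (by omega), hst w (by omega), Cell.comp_zero_start] at h
        injection h with _ h
        rw [h]
      | p + 1, s + 1, w + 1 =>
        simp only [wedgeString, Cell.comp]
        rw [ht.comp p s w (by omega) (by omega) (by omega)]
    · intro p s hp hs h
      match p, s with
      | 0, 0 => rfl
      | 0, s + 1 => simp [wedgeString] at h
      | p + 1, 0 => simp [wedgeString] at h
      | p + 1, s + 1 =>
        simp only [wedgeString, Cell.skip.injEq] at h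
        rw [ht.inj p s (by omega) (by omega) h]
    · intro x
      right
      match x with
      | .start .here =>
        exact ⟨0, 0, le_rfl, by omega, by simp [wedgeString, Cell.bd], by
          simp [wedgeString, Cell.bd, Path.last], fun _ => rfl, by omega, by omega⟩
      | .start (.step b π) =>
        obtain ⟨ε, i, rfl⟩ := ha b
        obtain ⟨_, _, h, -⟩ | ⟨p, s, hps, hsr, h1, h2, h3, -, -⟩ := ht.cell (.start π)
        · omega
        · rw [hneg, ← h00] at h1
          obtain rfl := ht.inj 0 p (by omega) (by omega) h1
          rw [hpos] at h2
          refine ⟨0, s + 1, by omega, by omega, by simp [wedgeString, Cell.bd], ?_, by omega, ?_, ?_⟩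
          · simp only [wedgeString, Cell.bd, Path.last]
            rw [h2]
          · intro hs
            obtain rfl : s = 0 := by omega
            have h := h3 rfl
            rw [h00] at h
            injection h with _ h
            subst h
            exact ⟨ε, i + 1, by simp [wedgeString, Cell.bd, Path.bdSucc, h00, Cell.path]⟩
          -- A longer path splits after its first step; this is why strings are only required to
          -- split at the cut p + 1.
          · intro _
            refine ⟨.start (.step (a.bd ε i) .here), .skip (.start π), ?_, ?_, ?_, ?_, ?_⟩
            · simp [wedgeString, Cell.bd]
            · simp [wedgeString, Cell.bd, Path.last, h00]
            · simp [wedgeString, Cell.bd, h00]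
            · simp only [wedgeString, Cell.bd]
              rw [h2]
            · simp [Cell.comp, Path.append]
      | .skip c =>
        obtain ⟨_, _, h, -⟩ | ⟨p, s, hps, hsr, h1, h2, h3, h4, h5⟩ := ht.cell c
        · omega
        · refine ⟨p + 1, s + 1, by omega, by omega, ?_, ?_, ?_, ?_, ?_⟩
          · simp only [wedgeString, Cell.bd, h1]
          · simp only [wedgeString, Cell.bd, h2]
          · intro hs
            simp only [wedgeString, h3 (by omega)]
          · intro hs
            obtain ⟨ε, i, h⟩ := h4 (by omega)
            exact ⟨ε, i, by simp only [wedgeString, Cell.bd, h]⟩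
          · intro hs
            obtain ⟨y, z, e1, e2, e3, e4, e5⟩ := h5 (by omega)
            exact ⟨.skip y, .skip z, by simp only [wedgeString, Cell.bd, e1],
              by simp only [wedgeString, Cell.bd, e2], by simp only [wedgeString, Cell.bd, e3],
              by simp only [wedgeString, Cell.bd, e4], by simp only [Cell.comp, e5]⟩
    · intro s hs
      match s with
      | 0 => rfl
      | s + 1 => rfl

/-- In the inductive step 0 is not an allowed index, so T is trivial or a single suspension ΣA, and
a string for A is suspended. The two new points are boundaries of dimension below q + 1. -/
theorem exists_isString {n : ℕ} {S : Set ℕ} {T : ThetaShape} {q : ℕ} (hT : T.InTheta n S)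
    (hS : ∀ i ∈ S, i = q) : ∃ r t, IsString T q r t := by
  induction q generalizing n S T with
  | zero =>
    obtain ⟨r, t, h, -⟩ := exists_isString_zero hT hS
    exact ⟨r, t, h⟩
  | succ q ih =>
    cases T with
    | pt =>
      refine ⟨0, fun _ _ => .start .here, fun _ _ _ _ => ?_, fun _ _ _ _ => ?_, fun _ _ _ _ _ _ => ?_,
        fun p s hp hs _ => by omega, fun x => .inl ⟨.neg, 0, by omega, ?_⟩⟩
      · simp [Cell.bd, Path.bdSucc]
      · simp [Cell.bd, Path.bdSucc]
      · simp [Cell.comp, Path.compSucc]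
      · rw [x.eq_of_pt]
        simp [Cell.bd]
    | cons A T =>
      obtain ⟨-, hA, -, h0⟩ := hT
      obtain rfl := h0.resolve_right fun h => by simpa using hS _ h
      obtain ⟨r, t, ht⟩ := ih hA fun i hi => by simpa using hS _ hi
      let σ : Cell A → Cell (cons A pt) := fun a => .start (.step a .here)
      have hbd : ∀ a ε i, (σ a).bd ε (i + 1) = σ (a.bd ε i) := fun a ε i => by
        simp [σ, Cell.bd, Path.bdSucc]
      have hcomp : ∀ a b i, Cell.comp (i + 1) (σ b) (σ a) = σ (Cell.comp i b a) := fun a b i => by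
        simp [σ, Cell.comp, Path.compSucc]
      refine ⟨r, fun p s => σ (t p s), fun p s hp hs => ?_, fun p s hp hs => ?_,
        fun p s w hp hs hw => ?_, fun p s hp hs h => ?_, fun x => ?_⟩
      · rw [hbd, ht.bd_neg p s hp hs]
      · rw [hbd, ht.bd_pos p s hp hs]
      · rw [hcomp, ht.comp p s w hp hs hw]
      · simp only [σ, Cell.start.injEq, Path.step.injEq, and_true] at h
        exact ht.inj p s hp hs h
      · match x with
        | .start .here => exact .inl ⟨.neg, 0, by omega, by simp [σ, Cell.bd]⟩
        | .skip c => exact .inl ⟨.pos, 0, by omega, by rw [c.eq_of_pt]; simp [σ, Cell.bd, Path.last]⟩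
        | .start (.step a p) =>
          rw [p.eq_of_pt]
          change (∃ ε i, i < q + 1 ∧ σ a = _) ∨ ∃ p s, p ≤ s ∧ s ≤ r ∧ (σ a).bd _ _ = _ ∧
            (σ a).bd _ _ = _ ∧ (s = p → σ a = _) ∧ (s = p + 1 → ∃ ε i, σ a = _) ∧
            (p + 1 < s → ∃ y z, _ ∧ _ ∧ _ ∧ _ ∧ σ a = _)
          obtain ⟨ε, i, hi, h⟩ | ⟨p, s, hps, hsr, h1, h2, h3, h4, h5⟩ := ht.cell a
          · exact .inl ⟨ε, i + 1, by omega, by rw [hbd, ← h]⟩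
          · refine .inr ⟨p, s, hps, hsr, by rw [hbd, h1], by rw [hbd, h2], fun hs => by rw [← h3 hs],
              fun hs => ?_, fun hs => ?_⟩
            · obtain ⟨ε, i, h⟩ := h4 hs
              exact ⟨ε, i + 1, by rw [hbd, ← h]⟩
            · obtain ⟨y, z, e1, e2, e3, e4, e5⟩ := h5 hs
              exact ⟨σ y, σ z, by rw [hbd, e1], by rw [hbd, e2], by rw [hbd, e3], by rw [hbd, e4],
                by rw [hcomp, ← e5]⟩

end ThetaShape

namespace OmegaHypergraph
variable {P : OmegaHypergraph.{u}}

/-! ### Decompositions along one dimension -/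

theorem bd_bd_of_lt {i j : ℕ} (h : i < j) (ε δ : Sgn) (c : P.PreCell) :
    bd δ j (bd ε i c) = bd ε i c := by
  funext γ l
  rcases lt_trichotomy l j with hl | rfl | hl
  · rw [bd_of_lt hl]
  · rw [bd_self, bd_of_gt h, bd_of_gt h]
  · rw [bd_of_gt hl, bd_of_gt (h.trans hl)]

theorem bd_bd_self (i : ℕ) (ε δ : Sgn) (c : P.PreCell) : bd δ i (bd ε i c) = bd ε i c :=
  bd_eq_bd_iff.2 ⟨fun _ _ h => bd_of_lt h, bd_self⟩

theorem bd_bd_of_gt {i j : ℕ} (h : j < i) (ε δ : Sgn) (c : P.PreCell) :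
    bd δ j (bd ε i c) = bd δ j c :=
  bd_eq_bd_iff.2 ⟨fun _ _ hl => bd_of_lt (hl.trans h), bd_of_lt h⟩

theorem InClosure.le_of_bd {m i j : ℕ} {ε : Sgn} {c : P.PreCell} (hc : IsCell m c) {a : P.Atom j}
    (h : InClosure (bd ε i c) a) : j ≤ i :=
  h.le_dim ((hc.mono (le_max_left m i)).bd (le_max_right m i) ε)

theorem bd_neg_eq_bd_pos_of_empty {m q : ℕ} {c : P.PreCell} (hc : IsCell m c) {δ : Sgn}
    (h : c δ (q + 1) = ∅) : bd .neg q c = bd .pos q c := by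
  have hc' := hc.mono (le_max_left m (q + 1))
  have hlt : q < max m (q + 1) := by omega
  refine bd_eq_bd_iff.2 ⟨fun _ _ _ => rfl, ?_⟩
  have h1 := hc'.outer hlt δ .neg
  have h2 := hc'.outer hlt δ .pos
  rw [h, outer_empty] at h1 h2
  exact Set.Subset.antisymm (Set.sdiff_eq_empty.1 h1.symm) (Set.sdiff_eq_empty.1 h2.symm)

/-- `θ` is the decomposition of `μ` along `∘_q` determined by the chain `∅ = U 0 ⊂ ⋯ ⊂ U r` of
initial segments of the set of `(q+1)`-atoms of the target of `μ`. -/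
structure IsDecomposition (μ : P.PreCell) (q r : ℕ) (U : ℕ → Set (P.Atom (q + 1)))
    (θ : Set P.PreCell) : Prop where
  subcategory : IsSubcategory μ θ
  initial : ∀ p ≤ r, IsInitial μ (U p)
  strict : ∀ p < r, U p ⊂ U (p + 1)
  zero : U 0 = ∅
  last : U r = μ .pos (q + 1)
  two_le : 2 ≤ r
  piece_mem : ∀ p s, p ≤ s → s ≤ r → piece μ q (U p) (U s) ∈ θ
  cell : ∀ c ∈ θ, (∃ ε i, i < q ∧ c = bd ε i μ) ∨ ∃ p s, p ≤ s ∧ s ≤ r ∧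
    bd .neg q c = piece μ q (U p) (U p) ∧ bd .pos q c = piece μ q (U s) (U s) ∧
    (s = p → c = piece μ q (U p) (U p)) ∧
    (s = p + 1 → ∃ ε i, c = bd ε i (piece μ q (U p) (U s))) ∧
    (p + 1 < s → ∃ y ∈ θ, ∃ z ∈ θ, bd .neg q y = piece μ q (U p) (U p) ∧
      bd .pos q y = piece μ q (U (p + 1)) (U (p + 1)) ∧
      bd .neg q z = piece μ q (U (p + 1)) (U (p + 1)) ∧
      bd .pos q z = piece μ q (U s) (U s) ∧ c = comp q z y)

/-- The string is transported to composites F p s in θ. The main point is that μ, known only to be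
some member of θ, is the full composite F 0 r: all of θ lies in the closure of μ, while composable
cells have disjoint closures above q. Then `cut` and `cut_sdiff` identify each F p s with a piece.
-/
theorem exists_isDecomposition (hP : P.IsRegular) {q : ℕ} {μ : P.PreCell}
    (hs : IsSplit μ (q + 1)) {N : ℕ} {θ : Set P.PreCell} (hθ : θ ∈ Sd N {q} μ) :
    ∃ r U, IsDecomposition μ q r U θ := by
  obtain ⟨hsub, hμθ, ⟨T, hT, f, hinj, hrange, hfbd, hfcomp⟩, hne⟩ := hθ
  obtain ⟨r, t, ht⟩ := ThetaShape.exists_isString (q := q) hT fun i hi => hi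
  have hmem : ∀ x, f x ∈ θ := fun x => hrange ▸ Set.mem_range_self x
  have hcell : ∀ c ∈ θ, ∃ m, IsCell m c := fun c hc => (hsub.cell c hc).1
  let F : ℕ → ℕ → P.PreCell := fun p s => f (t p s)
  have hF : ∀ p s, F p s ∈ θ := fun p s => hmem _
  have hneg : ∀ p s, p ≤ s → s ≤ r → bd .neg q (F p s) = F p p := fun p s hps hsr => by
    rw [← hfbd, ht.bd_neg p s hps hsr]
  have hpos : ∀ p s, p ≤ s → s ≤ r → bd .pos q (F p s) = F s s := fun p s hps hsr => by
    rw [← hfbd, ht.bd_pos p s hps hsr]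
  have hcomp : ∀ p s w, p ≤ s → s ≤ w → w ≤ r → comp q (F s w) (F p s) = F p w := by
    intro p s w hps hsw hwr
    rw [← hfcomp q _ _ (by rw [ht.bd_pos p s hps (hsw.trans hwr), ht.bd_neg s w hsw hwr]),
      ht.comp p s w hps hsw hwr]
  have hFinj : ∀ p s, p ≤ r → s ≤ r → F p p = F s s → p = s := fun p s hp hs h =>
    ht.inj p s hp hs (hinj h)
  have hFcell : ∀ c ∈ θ, (∃ ε i, i < q ∧ c = bd ε i (F 0 r)) ∨ ∃ p s, p ≤ s ∧ s ≤ r ∧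
      bd .neg q c = F p p ∧ bd .pos q c = F s s ∧ (s = p → c = F p p) ∧
      (s = p + 1 → ∃ ε i, c = bd ε i (F p s)) ∧
      (p + 1 < s → ∃ y ∈ θ, ∃ z ∈ θ, bd .neg q y = F p p ∧ bd .pos q y = F (p + 1) (p + 1) ∧
        bd .neg q z = F (p + 1) (p + 1) ∧ bd .pos q z = F s s ∧ c = comp q z y) := by
    intro c hc
    obtain ⟨x, rfl⟩ : c ∈ Set.range f := hrange.symm ▸ hc
    obtain ⟨ε, i, hi, rfl⟩ | ⟨p, s, hps, hsr, h1, h2, h3, h4, h5⟩ := ht.cell x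
    · exact .inl ⟨ε, i, hi, hfbd _ _ _⟩
    · refine .inr ⟨p, s, hps, hsr, by rw [← hfbd, h1], by rw [← hfbd, h2],
        fun h => congrArg f (h3 h), fun h => ?_, fun h => ?_⟩
      · obtain ⟨ε, i, e⟩ := h4 h
        exact ⟨ε, i, by rw [e, hfbd]⟩
      · obtain ⟨y, z, e1, e2, e3, e4, e5⟩ := h5 h
        exact ⟨f y, hmem y, f z, hmem z, by rw [← hfbd, e1], by rw [← hfbd, e2],
          by rw [← hfbd, e3], by rw [← hfbd, e4], by rw [e5, hfcomp _ _ _ (e2.trans e3.symm)]⟩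
  have hempty : ∀ p ≤ r, ∀ δ j, q < j → F p p δ j = ∅ := fun p hp δ j hj => by
    rw [← hneg p p le_rfl hp, bd_of_gt hj]
  have hnonempty : ∀ p s, p < s → s ≤ r → (F p s .pos (q + 1)).Nonempty := by
    intro p s hps hsr
    by_contra h
    obtain ⟨m, hm⟩ := hcell _ (hF p s)
    have := bd_neg_eq_bd_pos_of_empty hm (Set.not_nonempty_iff_eq_empty.1 h)
    rw [hneg p s hps.le hsr, hpos p s hps.le hsr] at this
    exact hps.ne (hFinj p s (hps.le.trans hsr) hsr this)
  have hdis : ∀ c ∈ θ, ∀ d ∈ θ, bd .pos q c = bd .neg q d → ∀ {j} {a : P.Atom j}, q < j →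
      InClosure c a → ¬ InClosure d a := by
    intro c hc d hd h j a hj
    obtain ⟨m, hm⟩ := hcell c hc
    obtain ⟨m', hm'⟩ := hcell d hd
    exact hP.disjoint_closure hm hm' h hj
  -- a cell of `θ` whose closure contains `F p s` is equal to it
  have hfull : ∀ e p s, s - p = e → p ≤ s → s ≤ r → ∀ c ∈ θ, bd .neg q c = F p p →
      bd .pos q c = F s s → (∀ δ j, q < j → ∀ a ∈ F p s δ j, InClosure c a) → c = F p s := by
    intro e
    induction e using Nat.strong_induction_on with
    | _ e ih =>
      intro p s he hps hsr c hc hcneg hcpos hcl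
      have hlow : ∀ ε i, i < q → c = bd ε i (F 0 r) → c = F p s := by
        rintro ε i hi rfl
        rw [bd_bd_of_lt hi] at hcneg hcpos
        have := hFinj p s (hps.trans hsr) hsr (hcneg.symm.trans hcpos)
        subst this
        exact hcneg
      obtain ⟨ε, i, hi, h⟩ | ⟨p', s', hps', hsr', h1, h2, h3, h4, h5⟩ := hFcell c hc
      · exact hlow ε i hi h
      · obtain rfl := hFinj p p' (by omega) (by omega) (hcneg.symm.trans h1)
        obtain rfl := hFinj s s' (by omega) (by omega) (hcpos.symm.trans h2)
        rcases lt_trichotomy s (p + 1) with hs' | hs' | hs'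
        · obtain rfl : s = p := by omega
          exact h3 rfl
        · obtain ⟨ε, i, rfl⟩ := h4 hs'
          obtain ⟨m, hm⟩ := hcell _ (hF p s)
          have hle : ∀ {j} {a : P.Atom j}, InClosure (bd ε i (F p s)) a → j ≤ i :=
            InClosure.le_of_bd hm
          obtain ⟨a, ha⟩ := hnonempty p s (by omega) hsr
          have hqi := hle (hcl _ _ (Nat.lt_succ_self q) a ha)
          refine bd_eq_self_of_empty hm (fun δ j hj => ?_) ε
          rw [Set.eq_empty_iff_forall_notMem]
          intro b hb
          have := hle (hcl δ j (by omega) b hb)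
          omega
        · obtain ⟨y, hy, z, hz, e1, e2, e3, e4, rfl⟩ := h5 hs'
          have hpc := hcomp p (p + 1) s (by omega) (by omega) hsr
          have hy' : y = F p (p + 1) := by
            refine ih (p + 1 - p) (by omega) p (p + 1) rfl (by omega) (by omega) y hy e1 e2 ?_
            intro δ j hj a ha
            refine ((hcl δ j hj a ?_).of_comp hj.le).resolve_right (hdis _ (hF p (p + 1)) z hz ?_ hj
              (.base _ ha))
            · rw [← hpc, comp_of_gt hj]; exact .inl ha
            · rw [hpos p (p + 1) (by omega) (by omega), e3]
          have hz' : z = F (p + 1) s := by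
            refine ih (s - (p + 1)) (by omega) (p + 1) s rfl (by omega) hsr z hz e3 e4 ?_
            intro δ j hj a ha
            refine ((hcl δ j hj a ?_).of_comp hj.le).resolve_left fun hya =>
              hdis y hy _ (hF (p + 1) s) ?_ hj hya (.base _ ha)
            · rw [← hpc, comp_of_gt hj]; exact .inr ha
            · rw [hneg (p + 1) s (by omega) hsr, e2]
          rw [hy', hz', hpc]
  -- the cell `μ` is the composite of everything
  have hμF : μ = F 0 r := by
    have hbelow : ∀ p s δ j, ∀ a ∈ F p s δ j, InClosure μ a := fun p s => (hsub.cell _ (hF p s)).2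
    obtain ⟨ε, i, hi, h⟩ | ⟨p, s, hps, hsr, h1, h2, -⟩ := hFcell μ hμθ
    · obtain ⟨m, hm⟩ := hcell _ (hF 0 r)
      rw [h]
      refine bd_eq_self_of_empty hm (fun δ j hj => ?_) ε
      rw [Set.eq_empty_iff_forall_notMem]
      intro b hb
      have := hbelow 0 r δ j b hb
      rw [h] at this
      have := this.le_of_bd hm
      omega
    -- If μ started at a later cut, F 0 p would be composable with μ and yet have (q+1)-atoms in the
    -- closure of μ.
    · have hp : p = 0 := by
        by_contra hp
        obtain ⟨a, ha⟩ := hnonempty 0 p (by omega) (by omega)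
        exact hdis _ (hF 0 p) μ hμθ (by rw [hpos 0 p (by omega) (by omega), h1])
          (Nat.lt_succ_self q) (.base _ ha) (hbelow _ _ _ _ a ha)
      have hr : s = r := by
        by_contra hr
        obtain ⟨a, ha⟩ := hnonempty s r (by omega) le_rfl
        exact hdis μ hμθ _ (hF s r) (by rw [hneg s r (by omega) le_rfl, h2])
          (Nat.lt_succ_self q) (hbelow _ _ _ _ a ha) (.base _ ha)
      subst hp hr
      exact hfull _ 0 s rfl (by omega) le_rfl μ hμθ h1 h2 fun δ j _ => hbelow 0 s δ j
  -- With at most one layer every cell of θ is an iterated boundary of μ, so θ would be the excluded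
  -- globe.
  have hr2 : 2 ≤ r := by
    by_contra hr
    refine hne (Set.Subset.antisymm (fun c hc => ?_) ?_)
    · obtain ⟨ε, i, hi, h⟩ | ⟨p, s, hps, hsr, h1, h2, h3, h4, -⟩ := hFcell c hc
      · exact ⟨ε, i, by rw [h, ← hμF]⟩
      · by_cases hsp : s = p
        · rw [h3 hsp]
          rcases Nat.eq_zero_or_pos p with rfl | hp
          · exact ⟨.neg, q, by rw [hμF, hneg 0 r (by omega) le_rfl]⟩
          · obtain rfl : p = r := by omega
            exact ⟨.pos, q, by rw [hμF, hpos 0 p (by omega) le_rfl]⟩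
        · obtain ⟨ε, i, h⟩ := h4 (by omega)
          obtain rfl : p = 0 := by omega
          obtain rfl : s = r := by omega
          exact ⟨ε, i, by rw [h, hμF]⟩
    · rintro c ⟨ε, i, rfl⟩
      exact hsub.bd_mem μ hμθ ε i
  let U : ℕ → Set (P.Atom (q + 1)) := fun p => F 0 p .pos (q + 1)
  have hcut : ∀ p ≤ r, IsInitial μ (U p) ∧ F 0 p = piece μ q ∅ (U p) := by
    intro p hp
    obtain ⟨m, hm⟩ := hcell _ (hF 0 p)
    obtain ⟨m', hm'⟩ := hcell _ (hF p r)
    refine hs.cut hP hm hm' ?_ ((hcomp 0 p r (by omega) hp le_rfl).trans hμF.symm)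
    rw [hpos 0 p (by omega) hp, hneg p r hp le_rfl]
  have hUsucc : ∀ p s, p ≤ s → s ≤ r → U s = U p ∪ F p s .pos (q + 1) := by
    intro p s hps hsr
    have := congrFun (congrFun (hcomp 0 p s (by omega) hps hsr) .pos) (q + 1)
    rw [comp_of_gt (Nat.lt_succ_self q)] at this
    exact this.symm
  have hpiece : ∀ p s, p ≤ s → s ≤ r → F p s = piece μ q (U p) (U s) := by
    intro p s hps hsr
    obtain ⟨m, hm⟩ := hcell _ (hF 0 p)
    obtain ⟨m', hm'⟩ := hcell _ (hF p s)
    refine hs.cut_sdiff hP hm hm' ?_ (hcut p (hps.trans hsr)).1 (hcut p (hps.trans hsr)).2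
      ((hcomp 0 p s (by omega) hps hsr).trans (hcut s hsr).2)
    rw [hpos 0 p (by omega) (hps.trans hsr), hneg p s hps hsr]
  refine ⟨r, U, hsub, fun p hp => (hcut p hp).1, fun p hp => ?_, hempty 0 (by omega) _ _ (by omega),
    by rw [hμF], hr2, fun p s hps hsr => hpiece p s hps hsr ▸ hF p s, fun c hc => ?_⟩
  · have hU := hUsucc p (p + 1) (by omega) hp
    refine ⟨by rw [hU]; exact Set.subset_union_left, fun hsubset => ?_⟩
    obtain ⟨a, ha⟩ := hnonempty p (p + 1) (by omega) hp
    refine hdis _ (hF 0 p) _ (hF p (p + 1)) ?_ (Nat.lt_succ_self q)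
      (.base .pos (hsubset (by rw [hU]; exact .inr ha))) (.base _ ha)
    rw [hpos 0 p (by omega) (by omega), hneg p (p + 1) (by omega) hp]
  · obtain ⟨ε, i, hi, h⟩ | ⟨p, s, hps, hsr, h1, h2, h3, h4, h5⟩ := hFcell c hc
    · exact .inl ⟨ε, i, hi, by rw [h, hμF]⟩
    · refine .inr ⟨p, s, hps, hsr, ?_⟩
      rw [← hpiece p p le_rfl (by omega), ← hpiece s s le_rfl hsr, ← hpiece p s hps hsr]
      refine ⟨h1, h2, h3, h4, fun h => ?_⟩
      rw [← hpiece (p + 1) (p + 1) le_rfl (by omega)]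
      exact h5 h

/-- Slices have atoms in dimension q; boundaries of dimension below q do not. -/
theorem piece_ne_bd (hP : P.IsRegular) {n q : ℕ} {μ : P.PreCell} (hμ : IsCell n μ)
    (hne : (μ .pos (q + 1)).Nonempty) {V W : Set (P.Atom (q + 1))} (hV : IsInitial μ V) {i : ℕ} (hi : i < q) (ε : Sgn) :
    piece μ q V W ≠ bd ε i μ := by
  intro e
  have hq := congrFun (congrFun e .neg) q
  rw [piece_neg, bd_of_gt hi] at hq
  rcases V.eq_empty_or_nonempty with rfl | hVne
  · rw [act_empty] at hq
    exact (hP.nonempty_below hμ hne (Nat.lt_succ_self q) .neg).ne_empty hq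
  · obtain ⟨b, hb⟩ := hP.outer_nonempty ((hμ.finite _ _).subset hV.subset) hVne .pos
    exact (hq.subset (show b ∈ act (μ .neg q) V from ⟨.inr hb.1, hb.2⟩)).elim

-- Generators, preorder and cuts of a decomposition

namespace IsDecomposition

variable {n q r r' : ℕ} {μ : P.PreCell} {U U' : ℕ → Set (P.Atom (q + 1))} {θ θ' : Set P.PreCell}

theorem mono (h : IsDecomposition μ q r U θ) {p s : ℕ} (hps : p ≤ s) (hsr : s ≤ r) :
    U p ⊆ U s := by
  induction s, hps using Nat.le_induction with
  | base => exact subset_rfl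
  | succ s _ ih => exact (ih (by omega)).trans (h.strict s (by omega)).1

theorem injective (h : IsDecomposition μ q r U θ) {p s : ℕ} (hp : p ≤ r) (hs : s ≤ r)
    (e : U p = U s) : p = s := by
  rcases lt_trichotomy p s with hlt | rfl | hlt
  · exact absurd ((h.mono hlt hs).trans e.symm.subset) (h.strict p (by omega)).2
  · rfl
  · exact absurd ((h.mono hlt hp).trans e.subset) (h.strict s (by omega)).2

theorem index_injective (hP : P.IsRegular) (hμ : IsCell n μ) (hqn : q < n)
    (h : IsDecomposition μ q r U θ) {p s : ℕ} (hp : p ≤ r) (hs : s ≤ r)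
    (e : piece μ q (U p) (U p) = piece μ q (U s) (U s)) : p = s :=
  h.injective hp hs (piece_injective hP hμ hqn (h.initial p hp) (h.initial s hs) e)

theorem exists_layer (h : IsDecomposition μ q r U θ) (a : μ .pos (q + 1)) :
    ∃ p < r, a.1 ∉ U p ∧ a.1 ∈ U (p + 1) := by
  classical
  have hex : ∃ s, s ≤ r ∧ a.1 ∈ U s := ⟨r, le_rfl, by rw [h.last]; exact a.2⟩
  obtain ⟨h1, h2⟩ := Nat.find_spec hex
  obtain ⟨p, hp⟩ : ∃ p, Nat.find hex = p + 1 := by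
    refine Nat.exists_eq_succ_of_ne_zero fun h0 => ?_
    rw [h0, h.zero] at h2
    exact h2
  rw [hp] at h1 h2
  exact ⟨p, by omega, fun ha => Nat.find_min hex (m := p) (by omega) ⟨by omega, ha⟩, h2⟩

/-- The atoms of a generator lie in one layer of the decomposition. -/
theorem generator_layer (hP : P.IsRegular) (hμ : IsCell n μ) (hqn : q < n)
    (hs : IsSplit μ (q + 1)) (h : IsDecomposition μ q r U θ) {g : P.PreCell}
    (hg : IsGenerator θ g) (hne : (g .pos (q + 1)).Nonempty) :
    ∃ p < r, bd .neg q g = piece μ q (U p) (U p) ∧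
      bd .pos q g = piece μ q (U (p + 1)) (U (p + 1)) ∧
      ∀ a ∈ μ .pos (q + 1), a ∈ g .pos (q + 1) → a ∉ U p ∧ a ∈ U (p + 1) := by
  obtain ⟨hgθ, hg⟩ := hg
  obtain ⟨ε, i, hi, rfl⟩ | ⟨p, s, hps, hsr, h1, h2, h3, -, h5⟩ := h.cell g hgθ
  · rw [bd_of_gt (by omega)] at hne
    exact absurd rfl hne.ne_empty
  · rcases lt_trichotomy s (p + 1) with hs' | rfl | hs'
    · rw [h3 (by omega), piece_self_of_gt hP (Nat.lt_succ_self q)] at hne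
      exact absurd rfl hne.ne_empty
    · refine ⟨p, by omega, h1, h2, fun a haμ hag => ?_⟩
      obtain ⟨m, hm⟩ := (h.subcategory.cell g hgθ).1
      have hcell : ∀ p s, p ≤ s → s ≤ r → IsCell n (piece μ q (U p) (U s)) := fun p s hps hsr =>
        hs.isCell_piece hP hμ hqn (h.initial p (by omega)) (h.initial s hsr) (h.mono hps hsr)
      constructor
      -- An atom of g in U p would also belong to the piece from U 0 to U p, which is composable
      -- with g.
      · intro hap
        refine hP.disjoint_closure (hcell 0 p (by omega) (by omega)) hm
          (by rw [bd_pos_piece hP, h1]) (Nat.lt_succ_self q) (.base .pos ?_) (.base .pos hag)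
        rw [hs.piece_top (h.initial 0 (by omega)) (h.initial p (by omega)), h.zero]
        exact ⟨hap, fun h => h⟩
      · by_contra hap
        refine hP.disjoint_closure hm (hcell (p + 1) r (by omega) le_rfl)
          (by rw [bd_neg_piece hP, h2]) (Nat.lt_succ_self q) (.base .pos hag) (.base .pos ?_)
        rw [hs.piece_top (h.initial _ (by omega)) (h.initial r le_rfl), h.last]
        exact ⟨haμ, hap⟩
    -- A cell across several layers splits at the next cut. If one factor were an identity, two
    -- different cuts would coincide.
    · obtain ⟨y, hy, z, hz, e1, e2, e3, e4, e5⟩ := h5 hs'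
      rcases hg q y hy z hz (e2.trans e3.symm) e5.symm with hy' | hz'
      · rw [← hy', e2, bd_neg_piece hP] at e1
        have := h.index_injective hP hμ hqn (by omega) (by omega) e1
        omega
      · rw [← hz', e3, bd_pos_piece hP] at e4
        have := h.index_injective hP hμ hqn (by omega) (by omega) e4
        omega

/-- Along ∘_q a single layer leaves room for only one nontrivial factor. Above q both factors are
boundaries of the layer itself, and below q everything in θ has the boundaries of μ. -/
theorem isGenerator_piece (hP : P.IsRegular) (hμ : IsCell n μ) (hqn : q < n)
    (h : IsDecomposition μ q r U θ) {p : ℕ} (hp : p < r) :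
    IsGenerator θ (piece μ q (U p) (U (p + 1))) := by
  have hcell : ∀ c ∈ θ, ∃ m, IsCell m c := fun c hc => (h.subcategory.cell c hc).1
  refine ⟨h.piece_mem p (p + 1) (by omega) hp, fun i c hc d hd hcd hg => ?_⟩
  have hlowc : ∀ c : P.PreCell, ∀ ε j, j < q → c = bd ε j μ → ∀ δ, (bd δ i c = c) ∨
      (i < q ∧ bd δ i c = bd δ i μ) := by
    rintro c ε j hj rfl δ
    rcases lt_trichotomy j i with hji | rfl | hij
    · exact .inl (bd_bd_of_lt hji _ _ _)
    · exact .inl (bd_bd_self _ _ _ _)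
    · exact .inr ⟨by omega, bd_bd_of_gt hij _ _ _⟩
  by_cases hiq : i < q
  · -- below dimension `q` all cells of `θ` have the same boundaries
    have hmid : ∀ c ∈ θ, ∀ δ, bd δ i c = c ∨ bd δ i c = bd δ i μ := by
      intro c hc δ
      obtain ⟨ε, j, hj, e⟩ | ⟨p', s', -, -, h1, -⟩ := h.cell c hc
      · exact (hlowc c ε j hj e δ).imp_right And.right
      · right
        rw [← bd_bd_of_gt hiq .neg δ c, h1, bd_piece_of_lt hiq]
    rcases hmid c hc .pos with h1 | h1
    · exact .inl h1
    rcases hmid d hd .neg with h2 | h2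
    · exact .inr h2
    -- Equality of the i-dimensional source and target of μ would leave μ without (q+1)-atoms, but U
    -- 1 is nonempty.
    exfalso
    rw [h1, h2] at hcd
    have hempty := hP.empty_of_neg_eq_pos hμ (bd_eq_bd_iff.1 hcd).2.symm .pos
      (j := q + 1) (by omega)
    have := h.two_le
    obtain ⟨a, ha, -⟩ := Set.exists_of_ssubset (h.strict 0 (by omega))
    have := (h.initial 1 (by omega)).subset ha
    rw [hempty] at this
    exact this
  have hgneg : bd .neg q (comp i d c) = piece μ q (U p) (U p) := by rw [hg, bd_neg_piece hP]
  have hgpos : bd .pos q (comp i d c) = piece μ q (U (p + 1)) (U (p + 1)) := by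
    rw [hg, bd_pos_piece hP]
  obtain ⟨ε, j, hj, e⟩ | ⟨p₁, s₁, hps₁, hsr₁, c1, c2, c3, c4, -⟩ := h.cell c hc
  · exact .inl ((hlowc c ε j hj e .pos).resolve_right fun h => hiq h.1)
  obtain ⟨ε, j, hj, e⟩ | ⟨p₂, s₂, hps₂, hsr₂, d1, d2, d3, d4, -⟩ := h.cell d hd
  · exact .inr ((hlowc d ε j hj e .neg).resolve_right fun h => hiq h.1)
  rcases (not_lt.1 hiq).eq_or_lt with rfl | hqi
  · have e1 : bd .neg q (comp q d c) = bd .neg q c :=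
      bd_eq_bd_iff.2 ⟨fun _ _ hl => comp_of_lt hl, comp_neg⟩
    have e2 : bd .pos q (comp q d c) = bd .pos q d :=
      bd_eq_bd_iff.2 ⟨fun _ _ hl => (comp_of_lt hl).trans ((bd_eq_bd_iff.1 hcd).1 _ _ hl), comp_pos⟩
    obtain rfl := h.index_injective hP hμ hqn (by omega) (by omega)
      (c1.symm.trans (e1.symm.trans hgneg))
    obtain rfl := h.index_injective hP hμ hqn (by omega) (by omega)
      (d2.symm.trans (e2.symm.trans hgpos))
    obtain rfl := h.index_injective hP hμ hqn (by omega) (by omega)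
      (c2.symm.trans (hcd.trans d1))
    rcases (by omega : s₁ = p₁ ∨ s₁ = p₁ + 1) with rfl | rfl
    · left; rw [c3 rfl, bd_pos_piece hP]
    · right; rw [d3 rfl, bd_neg_piece hP]
  · have e1 : bd .neg q (comp i d c) = bd .neg q c :=
      bd_eq_bd_iff.2 ⟨fun _ _ hl => comp_of_lt (hl.trans hqi), comp_of_lt hqi⟩
    have e2 : bd .pos q (comp i d c) = bd .pos q c :=
      bd_eq_bd_iff.2 ⟨fun _ _ hl => comp_of_lt (hl.trans hqi), comp_of_lt hqi⟩
    have e3 : ∀ δ, bd δ q d = bd δ q c := fun δ => by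
      rw [← bd_bd_of_gt hqi .neg δ d, ← hcd, bd_bd_of_gt hqi]
    obtain rfl := h.index_injective hP hμ hqn (by omega) (by omega)
      (c1.symm.trans (e1.symm.trans hgneg))
    obtain rfl := h.index_injective hP hμ hqn (by omega) (by omega)
      (c2.symm.trans (e2.symm.trans hgpos))
    obtain rfl := h.index_injective hP hμ hqn (by omega) (by omega)
      (d1.symm.trans ((e3 .neg).trans c1))
    obtain rfl := h.index_injective hP hμ hqn (by omega) (by omega)
      (d2.symm.trans ((e3 .pos).trans c2))
    obtain ⟨ε, j, hcj⟩ := c4 rfl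
    obtain ⟨ε', j', hdj⟩ := d4 rfl
    rcases lt_trichotomy j i with hji | rfl | hij
    · left; rw [hcj, bd_bd_of_lt hji]
    · left; rw [hcj, bd_bd_self]
    rcases lt_trichotomy j' i with hji' | rfl | hij'
    · right; rw [hdj, bd_bd_of_lt hji']
    · right; rw [hdj, bd_bd_self]
    -- Both factors are now boundaries of the piece of dimension above i. Composability says that
    -- its i-dimensional source and target agree, so it has no atoms above dimension i and
    -- everything is an identity.
    left
    rw [hcj, hdj, bd_bd_of_gt hij, bd_bd_of_gt hij'] at hcd
    obtain ⟨m, hm⟩ := hcell _ (h.piece_mem p₂ (p₂ + 1) (by omega) hp)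
    have hempty := fun δ l hl => hP.empty_of_neg_eq_pos hm (bd_eq_bd_iff.1 hcd).2.symm δ (j := l) hl
    have hself := bd_eq_self_of_empty hm hempty
    rw [hcj, bd_bd_of_gt hij, hself]
    exact (bd_eq_self_of_empty hm (fun δ l hl => hempty δ l (by omega)) ε).symm

/-- The preorder associated with a decomposition. -/
theorem L_iff (hP : P.IsRegular) (hμ : IsCell n μ) (hqn : q < n)
    (hs : IsSplit μ (q + 1)) (h : IsDecomposition μ q r U θ) (a b : μ .pos (q + 1)) :
    L μ (q + 1) θ a b ↔ ∀ p ≤ r, b.1 ∈ U p → a.1 ∈ U p := by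
  constructor
  -- A generator occupies one layer and composable generators occupy consecutive ones, so each
  -- generating relation respects membership in every U p.
  · intro hL
    induction hL with
    | refl => exact fun _ _ h => h
    | @tail b c _ hbc ih =>
      refine fun p hp hc => ih p hp ?_
      obtain ⟨g, hg, hb, hc'⟩ | ⟨g, g', hg, hg', hb, hc', hgg'⟩ := hbc
      · obtain ⟨l, hl, -, -, hall⟩ := h.generator_layer hP hμ hqn hs hg ⟨_, hb⟩
        by_contra hbp
        have hlp : ¬ p ≤ l := fun hpl => (hall _ c.2 hc').1 (h.mono hpl hl.le hc)
        exact hbp (h.mono (by omega) hp (hall _ b.2 hb).2)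
      · obtain ⟨l, hl, -, e, hall⟩ := h.generator_layer hP hμ hqn hs hg ⟨_, hb⟩
        obtain ⟨l', hl', e', -, hall'⟩ := h.generator_layer hP hμ hqn hs hg' ⟨_, hc'⟩
        have := h.index_injective hP hμ hqn (by omega) (by omega)
          (e.symm.trans (Eq.trans hgg' e'))
        by_contra hbp
        have hlp : ¬ p ≤ l' := fun hpl => (hall' _ c.2 hc').1 (h.mono hpl hl'.le hc)
        exact hbp (h.mono (by omega) hp (hall _ b.2 hb).2)
  · intro hab
    obtain ⟨s, hsr, hbs, hbs'⟩ := h.exists_layer b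
    obtain ⟨p, hpr, hap, hap'⟩ := h.exists_layer a
    have hps : p ≤ s := by
      by_contra hps
      exact hap (h.mono (by omega) (by omega) (hab (s + 1) (by omega) hbs'))
    clear hab
    have htop : ∀ l < r, ∀ c : μ .pos (q + 1), c.1 ∉ U l → c.1 ∈ U (l + 1) →
        c.1 ∈ piece μ q (U l) (U (l + 1)) .pos (q + 1) := fun l hl c hc hc' => by
      rw [hs.piece_top (h.initial l hl.le) (h.initial (l + 1) hl)]
      exact ⟨hc', hc⟩
    have hgen := fun l (hl : l < r) => h.isGenerator_piece hP hμ hqn hl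
    -- Climb one layer at a time: adjacent pieces are composable generators, and every layer
    -- contains an atom to pass through.
    induction s, hps using Nat.le_induction generalizing b with
    | base => exact .single (.inl ⟨_, hgen p hpr, htop p hpr a hap hap', htop p hpr b hbs hbs'⟩)
    | succ s hps ih =>
      obtain ⟨c, hc', hc⟩ := Set.exists_of_ssubset (h.strict s (by omega))
      have hcμ := (h.initial (s + 1) (by omega)).subset hc'
      refine (ih ⟨c, hcμ⟩ (by omega) hc hc').tail (.inr ⟨_, _, hgen s (by omega), hgen (s + 1) hsr,
        htop s (by omega) ⟨c, hcμ⟩ hc hc', htop (s + 1) hsr b hbs hbs', ?_⟩)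
      rw [Nat.add_sub_cancel, bd_pos_piece hP, bd_neg_piece hP]

/-- The cuts can thus be read off from θ: V is one of the U s as soon as its slice is in θ. -/
theorem exists_eq_of_piece_mem (hP : P.IsRegular) (hμ : IsCell n μ) (hqn : q < n)
    (h : IsDecomposition μ q r U θ) {V : Set (P.Atom (q + 1))} (hV : IsInitial μ V)
    (hmem : piece μ q V V ∈ θ) : ∃ s ≤ r, V = U s := by
  obtain ⟨ε, i, hi, e⟩ | ⟨p, s, -, hsr, -, e, -⟩ := h.cell _ hmem
  · have hr := h.two_le
    obtain ⟨a, ha, -⟩ := Set.exists_of_ssubset (h.strict 0 (by omega))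
    exact absurd e (piece_ne_bd hP hμ ⟨a, (h.initial 1 (by omega)).subset ha⟩ hV hi ε)
  · rw [bd_pos_piece hP] at e
    exact ⟨s, hsr, piece_injective hP hμ hqn hV (h.initial s hsr) e⟩

theorem mu_mem (hP : P.IsRegular) (hμ : IsCell n μ) (hqn : q < n)
    (hs : IsSplit μ (q + 1)) (h : IsDecomposition μ q r U θ) : μ ∈ θ := by
  have := h.piece_mem 0 r (by omega) le_rfl
  rwa [h.zero, h.last, hs.piece_univ hP hμ hqn] at this

/-- A decomposition is contained in every decomposition with more cuts. -/
theorem subset_of_cuts (hP : P.IsRegular) (hμ : IsCell n μ) (hqn : q < n)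
    (hs : IsSplit μ (q + 1)) (h : IsDecomposition μ q r U θ) (h' : IsDecomposition μ q r' U' θ')
    (hcuts : ∀ p ≤ r, ∃ s ≤ r', U p = U' s) : θ ⊆ θ' := by
  have hpiece : ∀ p s, p ≤ s → s ≤ r → piece μ q (U p) (U s) ∈ θ' := by
    intro p s hps hsr
    obtain ⟨p', hp', ep⟩ := hcuts p (by omega)
    obtain ⟨s', hs', es⟩ := hcuts s hsr
    have hps' : p' ≤ s' := by
      by_contra hlt
      have h1 := h'.mono (by omega : s' ≤ p') hp'
      rw [← ep, ← es] at h1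
      have h2 := h.injective (by omega) hsr (Set.Subset.antisymm (h.mono hps hsr) h1)
      subst h2
      exact hlt (h'.injective hp' hs' (ep.symm.trans es)).le
    rw [ep, es]
    exact h'.piece_mem p' s' hps' hs'
  have hmid : ∀ e, ∀ c ∈ θ, ∀ p s, s - p = e → p ≤ s → s ≤ r →
      bd .neg q c = piece μ q (U p) (U p) → bd .pos q c = piece μ q (U s) (U s) → c ∈ θ' := by
    intro e
    induction e using Nat.strong_induction_on with
    | _ e ih =>
      intro c hc p s he hps hsr hneg hpos
      obtain ⟨ε, i, hi, rfl⟩ | ⟨p', s', hps', hsr', h1, h2, h3, h4, h5⟩ := h.cell c hc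
      · exact h'.subcategory.bd_mem _ (h'.mu_mem hP hμ hqn hs) _ _
      · obtain rfl := h.index_injective hP hμ hqn (by omega) (by omega) (hneg.symm.trans h1)
        obtain rfl := h.index_injective hP hμ hqn (by omega) (by omega) (hpos.symm.trans h2)
        rcases lt_trichotomy s (p + 1) with hs' | hs' | hs'
        · rw [h3 (by omega)]
          exact hpiece p p le_rfl (by omega)
        · obtain ⟨ε, i, e⟩ := h4 hs'
          rw [e]
          exact h'.subcategory.bd_mem _ (hpiece p s hps hsr) _ _
        · obtain ⟨y, hy, z, hz, e1, e2, e3, e4, e5⟩ := h5 hs'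
          rw [e5]
          exact h'.subcategory.comp_mem _
            (ih _ (by omega) y hy p (p + 1) rfl (by omega) (by omega) e1 e2) _
            (ih _ (by omega) z hz (p + 1) s rfl (by omega) hsr e3 e4) q (e2.trans e3.symm)
  intro c hc
  obtain ⟨ε, i, -, rfl⟩ | ⟨p, s, hps, hsr, h1, h2, -⟩ := h.cell c hc
  · exact h'.subcategory.bd_mem _ (h'.mu_mem hP hμ hqn hs) _ _
  · exact hmid _ c hc p s rfl hps hsr h1 h2

end IsDecomposition

/-! ### Realizations of shapes -/

/-- This and most of the laws below are componentwise identities of sets, valid for pre-cells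
without composability; the target of a composite is the exception. -/
theorem comp_self (i : ℕ) (c : P.PreCell) : comp i c c = c := by
  funext δ j
  rcases lt_trichotomy j i with hj | rfl | hj
  · rw [comp_of_lt hj]
  · cases δ <;> simp
  · rw [comp_of_gt hj, Set.union_self]

theorem comp_bd_neg (i : ℕ) (d : P.PreCell) : comp i d (bd .neg i d) = d := by
  funext δ j
  rcases lt_trichotomy j i with hj | rfl | hj
  · rw [comp_of_lt hj, bd_of_lt hj]
  · cases δ <;> simp
  · rw [comp_of_gt hj, bd_of_gt hj, Set.empty_union]

theorem comp_bd_pos (i : ℕ) (c : P.PreCell) : comp i (bd .pos i c) c = c := by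
  funext δ j
  rcases lt_trichotomy j i with hj | rfl | hj
  · rw [comp_of_lt hj]
  · cases δ <;> simp
  · rw [comp_of_gt hj, bd_of_gt hj, Set.union_empty]

theorem bd_neg_comp (i : ℕ) (c d : P.PreCell) : bd .neg i (comp i d c) = bd .neg i c :=
  bd_eq_bd_iff.2 ⟨fun _ _ h => comp_of_lt h, comp_neg⟩

theorem bd_pos_comp {i : ℕ} {c d : P.PreCell} (h : bd .pos i c = bd .neg i d) :
    bd .pos i (comp i d c) = bd .pos i d :=
  bd_eq_bd_iff.2 ⟨fun _ _ hl => (comp_of_lt hl).trans ((bd_eq_bd_iff.1 h).1 _ _ hl), comp_pos⟩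

theorem bd_comp_of_gt {i j : ℕ} (h : i < j) (ε : Sgn) (c d : P.PreCell) :
    bd ε j (comp i d c) = comp i (bd ε j d) (bd ε j c) := by
  funext δ l
  rcases lt_trichotomy l i with hl | rfl | hl
  · rw [comp_of_lt hl, bd_of_lt (hl.trans h), bd_of_lt (hl.trans h), comp_of_lt hl]
  · rw [bd_of_lt h]; cases δ <;> simp [bd_of_lt h]
  · rw [comp_of_gt hl]
    rcases lt_trichotomy l j with hl' | rfl | hl'
    · rw [bd_of_lt hl', bd_of_lt hl', bd_of_lt hl', comp_of_gt hl]
    · rw [bd_self, bd_self, bd_self, comp_of_gt hl]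
    · rw [bd_of_gt hl', bd_of_gt hl', bd_of_gt hl', Set.union_empty]

theorem comp_assoc (i : ℕ) (c d e : P.PreCell) :
    comp i (comp i e d) c = comp i e (comp i d c) := by
  funext δ j
  rcases lt_trichotomy j i with hj | rfl | hj
  · rw [comp_of_lt hj, comp_of_lt hj, comp_of_lt hj]
  · cases δ <;> simp
  · rw [comp_of_gt hj, comp_of_gt hj, comp_of_gt hj, comp_of_gt hj, Set.union_assoc]

theorem comp_comp_comp {i j : ℕ} (h : i < j) (a b p r : P.PreCell) :
    comp i (comp j r p) (comp j b a) = comp j (comp i r b) (comp i p a) := by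
  funext δ l
  rcases lt_trichotomy l i with hl | rfl | hl
  · simp only [comp_of_lt hl, comp_of_lt (hl.trans h)]
  · cases δ <;> simp [comp_of_lt h]
  · rw [comp_of_gt hl]
    rcases lt_trichotomy l j with hl' | rfl | hl'
    · simp only [comp_of_lt hl', comp_of_gt hl]
    · cases δ <;> simp [comp_of_gt hl]
    · simp only [comp_of_gt hl', comp_of_gt hl]
      exact Set.union_union_union_comm _ _ _ _

/-- In a composite of cells, the factors are determined by the common boundary. -/
theorem IsRegular.comp_injective (hP : P.IsRegular) {i m₁ m₂ m₃ m₄ : ℕ} {c c' d d' : P.PreCell}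
    (hc : IsCell m₁ c) (hc' : IsCell m₂ c') (hd : IsCell m₃ d) (hd' : IsCell m₄ d')
    (h₁ : bd .pos i c = bd .pos i c') (h₂ : bd .pos i c = bd .neg i d)
    (h₃ : bd .pos i c = bd .neg i d') (h : comp i d c = comp i d' c') : c = c' ∧ d = d' := by
  have e₁ := bd_eq_bd_iff.1 h₁
  have e₂ := bd_eq_bd_iff.1 h₂
  have e₃ := bd_eq_bd_iff.1 h₃
  have hgt : ∀ δ j, i < j → c δ j = c' δ j ∧ d δ j = d' δ j := by
    intro δ j hj
    have hun := congrFun (congrFun h δ) j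
    rw [comp_of_gt hj, comp_of_gt hj] at hun
    have k₁ : ∀ a, a ∈ c δ j → a ∉ d δ j := fun a h1 h2 =>
      hP.disjoint_closure hc hd h₂ hj (.base _ h1) (.base _ h2)
    have k₂ : ∀ a, a ∈ c δ j → a ∉ d' δ j := fun a h1 h2 =>
      hP.disjoint_closure hc hd' h₃ hj (.base _ h1) (.base _ h2)
    have k₃ : ∀ a, a ∈ c' δ j → a ∉ d δ j := fun a h1 h2 =>
      hP.disjoint_closure hc' hd (h₁.symm.trans h₂) hj (.base _ h1) (.base _ h2)
    have k₄ : ∀ a, a ∈ c' δ j → a ∉ d' δ j := fun a h1 h2 =>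
      hP.disjoint_closure hc' hd' (h₁.symm.trans h₃) hj (.base _ h1) (.base _ h2)
    have hun' : ∀ a, (a ∈ c δ j ∨ a ∈ d δ j) ↔ (a ∈ c' δ j ∨ a ∈ d' δ j) := fun a =>
      Set.ext_iff.1 hun a
    constructor <;> ext a
    all_goals
      have := k₁ a
      have := k₂ a
      have := k₃ a
      have := k₄ a
      have := hun' a
      tauto
  have hi := fun δ => congrFun (congrFun h δ) i
  constructor <;> funext δ j
  · rcases lt_trichotomy j i with hj | rfl | hj
    · exact e₁.1 δ j hj
    · cases δ
      · have := hi .neg; rwa [comp_neg, comp_neg] at this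
      · exact e₁.2
    · exact (hgt δ j hj).1
  · rcases lt_trichotomy j i with hj | rfl | hj
    · rw [← e₂.1 δ j hj, e₃.1 δ j hj]
    · cases δ
      · rw [← e₂.2, e₃.2]
      · have := hi .pos; rwa [comp_pos, comp_pos] at this
    · exact (hgt δ j hj).2

open ThetaShape

/-- `f` is an isomorphism of the `m`-fold suspension of `T` onto a set of cells, apart from the cells
of dimension less than `m`. -/
structure IsRealization (m : ℕ) (T : ThetaShape) (f : Cell T → P.PreCell) : Prop where
  injective : Function.Injective f
  bd : ∀ ε i x, f (x.bd ε i) = bd ε (i + m) (f x)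
  comp : ∀ i x y, x.bd .pos i = y.bd .neg i → f (.comp i y x) = comp (i + m) (f y) (f x)
  cell : ∀ x, ∃ N, IsCell N (f x)

/-- The realization of `ΣA ∨ T`. -/
def wedgeMap (m : ℕ) {A T : ThetaShape} (s : P.PreCell) (fA : Cell A → P.PreCell)
    (fT : Cell T → P.PreCell) : Cell (.cons A T) → P.PreCell
  | .start .here => s
  | .start (.step a p) => comp m (fT (.start p)) (fA a)
  | .skip c => fT c

/-- `hsT` keeps the new first object s apart from the cells of T, so comparing m-dimensional
boundaries separates the three kinds of cells of ΣA ∨ T. Cells of the middle kind are told apart by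
`comp_injective`. Compatibility with composition is associativity and interchange. -/
theorem isRealization_wedgeMap (hP : P.IsRegular) {m : ℕ} {A T : ThetaShape} {s : P.PreCell}
    {fA : Cell A → P.PreCell} {fT : Cell T → P.PreCell} (hA : IsRealization (m + 1) A fA)
    (hT : IsRealization m T fT) (hsA : ∀ a, bd .neg m (fA a) = s)
    (htA : ∀ a, bd .pos m (fA a) = fT (.start .here)) (hsT : ∀ c, fT c ≠ s) :
    IsRealization m (.cons A T) (wedgeMap m s fA fT) := by
  have hs : ∀ ε j, m ≤ j → bd ε j s = s := by
    intro ε j hj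
    rw [← hsA (.start .here)]
    rcases hj.eq_or_lt with rfl | hj
    · exact bd_bd_self _ _ _ _
    · exact bd_bd_of_lt hj _ _ _
  have hT0 : ∀ ε c, bd ε m (fT c) = fT (c.bd ε 0) := fun ε c => by rw [hT.bd, Nat.zero_add]
  have hfT : ∀ p : Path T, bd .neg m (fT (.start p)) = fT (.start .here) := fun p => by
    rw [hT0]; simp [Cell.bd]
  have hglue : ∀ a p, bd .pos m (fA a) = bd .neg m (fT (.start p)) := fun a p => by
    rw [htA, hfT]
  have hneg : ∀ a p, bd .neg m (comp m (fT (.start p)) (fA a)) = s := fun a p => by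
    rw [bd_neg_comp, hsA]
  have hpos : ∀ a p, bd .pos m (comp m (fT (.start p)) (fA a)) = fT p.last := fun a p => by
    rw [bd_pos_comp (hglue a p), hT0]; simp [Cell.bd]
  refine ⟨?_, ?_, ?_, ?_⟩
  · intro x y h
    match x, y with
    | .start .here, .start .here => rfl
    | .start .here, .start (.step a p) =>
      have := congrArg (OmegaHypergraph.bd .pos m) h
      simp only [wedgeMap] at this
      rw [hpos, hs _ _ le_rfl] at this
      exact absurd this.symm (hsT _)
    | .start .here, .skip c => exact absurd h.symm (hsT c)
    | .start (.step a p), .start .here =>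
      have := congrArg (OmegaHypergraph.bd .pos m) h
      simp only [wedgeMap] at this
      rw [hpos, hs _ _ le_rfl] at this
      exact absurd this (hsT _)
    | .start (.step a p), .start (.step a' p') =>
      obtain ⟨_, h1⟩ := hA.cell a
      obtain ⟨_, h2⟩ := hA.cell a'
      obtain ⟨_, h3⟩ := hT.cell (.start p)
      obtain ⟨_, h4⟩ := hT.cell (.start p')
      obtain ⟨e1, e2⟩ := hP.comp_injective h1 h2 h3 h4 (by rw [htA, htA]) (hglue a p) (hglue a p') h
      have e2' := hT.injective e2
      injection e2' with _ e2'
      rw [hA.injective e1, e2']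
    | .start (.step a p), .skip c =>
      have := congrArg (OmegaHypergraph.bd .neg m) h
      simp only [wedgeMap] at this
      rw [hneg, hT0] at this
      exact absurd this.symm (hsT _)
    | .skip c, .start .here => exact absurd h (hsT c)
    | .skip c, .start (.step a p) =>
      have := congrArg (OmegaHypergraph.bd .neg m) h
      simp only [wedgeMap] at this
      rw [hneg, hT0] at this
      exact absurd this (hsT _)
    | .skip c, .skip d => rw [hT.injective h]
  · intro ε i x
    match x, i, ε with
    | .start .here, 0, .neg => simp [wedgeMap, Cell.bd, hs]
    | .start .here, 0, .pos => simp [wedgeMap, Cell.bd, Path.last, hs]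
    | .start .here, i + 1, ε => simp [wedgeMap, Cell.bd, Path.bdSucc, hs]
    | .start (.step a p), 0, .neg =>
      simp only [wedgeMap, Cell.bd, Nat.zero_add]; rw [hneg]
    | .start (.step a p), 0, .pos =>
      simp only [wedgeMap, Cell.bd, Path.last, Nat.zero_add]; rw [hpos]
    | .start (.step a p), i + 1, ε =>
      have h1 := hT.bd ε (i + 1) (.start p)
      simp only [Cell.bd] at h1
      simp only [wedgeMap, Cell.bd, Path.bdSucc]
      rw [h1, hA.bd, bd_comp_of_gt (by omega), show i + 1 + m = i + (m + 1) by omega]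
    | .skip c, i, ε => simp only [wedgeMap, Cell.bd]; exact hT.bd ε i c
  · intro i x y h
    match x, y, i with
    | .skip c, .skip d, i =>
      simp only [Cell.bd, Cell.skip.injEq] at h
      simp only [wedgeMap, Cell.comp]
      exact hT.comp i c d h
    | .skip c, .start p, 0 => simp [Cell.bd] at h
    | .skip c, .start p, i + 1 => simp [Cell.bd] at h
    | .start p, .skip d, i + 1 => simp [Cell.bd] at h
    | .start .here, .skip d, 0 => simp [Cell.bd, Path.last] at h
    | .start (.step a p), .skip d, 0 =>
      simp only [Cell.bd, Path.last, Cell.skip.injEq] at h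
      have h1 := hT.comp 0 (.start p) d (by simpa [Cell.bd] using h)
      rw [Cell.comp_zero_start, Nat.zero_add] at h1
      simp only [wedgeMap, Cell.comp, Path.append, Nat.zero_add]
      rw [h1, comp_assoc]
    | .start (.step a p), .start p', 0 => simp [Cell.bd, Path.last] at h
    | .start .here, .start p', 0 =>
      simp only [Cell.comp, Path.append, Nat.zero_add]
      have h1 : bd .neg m (wedgeMap m s fA fT (.start p')) = s := by
        match p' with
        | .here => exact hs _ _ le_rfl
        | .step a p => exact hneg a p
      have h2 := comp_bd_neg m (wedgeMap m s fA fT (.start p'))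
      rw [h1] at h2
      exact h2.symm
    | .start .here, .start .here, i + 1 =>
      simp [wedgeMap, Cell.comp, Path.compSucc, comp_self]
    | .start .here, .start (.step b p), i + 1 => simp [Cell.bd, Path.bdSucc] at h
    | .start (.step b p), .start .here, i + 1 => simp [Cell.bd, Path.bdSucc] at h
    | .start (.step a p), .start (.step b p'), i + 1 =>
      simp only [Cell.bd, Path.bdSucc, Cell.start.injEq, Path.step.injEq] at h
      have h1 := hT.comp (i + 1) (.start p) (.start p') (by simpa [Cell.bd] using h.2)
      simp only [Cell.comp] at h1
      simp only [wedgeMap, Cell.comp, Path.compSucc]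
      rw [h1, hA.comp i a b h.1, show i + (m + 1) = i + 1 + m by omega,
        comp_comp_comp (by omega)]
  · intro x
    match x with
    | .start .here =>
      obtain ⟨N, hN⟩ := hA.cell (.start .here)
      exact ⟨m, hsA (.start .here) ▸ (hN.mono (le_max_left N m)).bd (le_max_right N m) .neg⟩
    | .start (.step a p) =>
      obtain ⟨_, h1⟩ := hA.cell a
      obtain ⟨_, h2⟩ := hT.cell (.start p)
      exact ⟨_, hP.isCell_comp h1 h2 (hglue a p)⟩
    | .skip c => exact hT.cell c

theorem isRealization_pt {m N : ℕ} {c : P.PreCell} (hc : IsCell N c)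
    (h : ∀ ε j, m ≤ j → bd ε j c = c) : IsRealization m .pt fun _ => c where
  injective x y _ := by rw [x.eq_of_pt, y.eq_of_pt]
  bd ε i _ := (h ε _ (by omega)).symm
  comp i _ _ _ := (comp_self _ c).symm
  cell _ := ⟨N, hc⟩

/-- A realization of `A` by cells with the same `m`-dimensional boundaries as `g` extends to a
realization of the suspension of `A`. -/
theorem IsRealization.exists_suspension (hP : P.IsRegular) {m N : ℕ} {A : ThetaShape}
    {fA : Cell A → P.PreCell} (hA : IsRealization (m + 1) A fA) {g : P.PreCell} (hg : IsCell N g)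
    (hbd : ∀ a ε, OmegaHypergraph.bd ε m (fA a) = OmegaHypergraph.bd ε m g)
    (hne : g .neg m ≠ g .pos m) :
    ∃ f : Cell (.cons A .pt) → P.PreCell, IsRealization m (.cons A .pt) f ∧
      ∀ c, c ∈ Set.range f ↔ c ∈ Set.range fA ∨ ∃ ε, c = OmegaHypergraph.bd ε m g := by
  have hpt : IsRealization m .pt fun _ => OmegaHypergraph.bd .pos m g := by
    refine isRealization_pt ((hg.mono (le_max_left N m)).bd (le_max_right N m) .pos) fun ε j hj => ?_
    rcases hj.eq_or_lt with rfl | hj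
    · exact bd_bd_self _ _ _ _
    · exact bd_bd_of_lt hj _ _ _
  refine ⟨_, isRealization_wedgeMap hP hA hpt (s := OmegaHypergraph.bd .neg m g)
    (fun a => hbd a .neg) (fun a => hbd a .pos)
    (fun _ h => hne (bd_eq_bd_iff.1 h).2.symm), fun c => ?_⟩
  have hstep : ∀ a, OmegaHypergraph.comp m (OmegaHypergraph.bd .pos m g) (fA a) = fA a := fun a => by
    rw [← hbd a .pos, comp_bd_pos]
  constructor
  · rintro ⟨x, rfl⟩
    match x with
    | .start .here => exact .inr ⟨.neg, rfl⟩
    | .start (.step a p) => exact .inl ⟨a, (hstep a).symm⟩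
    | .skip c => exact .inr ⟨.pos, rfl⟩
  · rintro (⟨a, rfl⟩ | ⟨ε, rfl⟩)
    · exact ⟨.start (.step a .here), hstep a⟩
    · cases ε
      · exact ⟨.start .here, rfl⟩
      · exact ⟨.skip (.start .here), rfl⟩

/-- Every cell is the top cell of a realization of a globe. -/
theorem IsRegular.exists_globe (hP : P.IsRegular) {n N m : ℕ} {g : P.PreCell} (hg : IsCell n g)
    {δ : Sgn} (hN : (g δ N).Nonempty) (habove : ∀ δ j, N < j → g δ j = ∅) (hm : m ≤ N) :
    ∃ (T : ThetaShape) (f : Cell T → P.PreCell), T.InTheta (N - m) ∅ ∧ IsRealization m T f ∧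
      (∃ x, f x = g) ∧ (∀ x, ∃ ε i, m ≤ i ∧ f x = bd ε i g) := by
  have hself : ∀ ε j, N ≤ j → bd ε j g = g := fun ε j hj =>
    bd_eq_self_of_empty hg (fun δ l hl => habove δ l (by omega)) ε
  induction hm using Nat.decreasingInduction with
  | self =>
    exact ⟨.pt, fun _ => g, trivial, isRealization_pt hg hself, ⟨.start .here, rfl⟩,
      fun _ => ⟨.pos, N, le_rfl, (hself _ _ le_rfl).symm⟩⟩
  | of_succ m hmN ih =>
    obtain ⟨A, fA, hAθ, hA, ⟨x, hx⟩, hAbd⟩ := ih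
    have hbd : ∀ a ε, bd ε m (fA a) = bd ε m g := fun a ε => by
      obtain ⟨ε', i, hi, e⟩ := hAbd a
      rw [e, bd_bd_of_gt hi]
    obtain ⟨f, hf, hrange⟩ := hA.exists_suspension hP hg hbd fun h =>
      hN.ne_empty (hP.empty_of_neg_eq_pos hg h δ hmN)
    refine ⟨.cons A .pt, f, ⟨by omega, ?_, trivial, .inl rfl⟩, hf, ?_, fun y => ?_⟩
    · rw [show N - m - 1 = N - (m + 1) by omega]
      exact hAθ
    · exact (hrange g).2 (.inl ⟨x, hx⟩)
    · rcases (hrange (f y)).1 ⟨y, rfl⟩ with ⟨a, ha⟩ | ⟨ε, e⟩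
      · obtain ⟨ε', i, hi, e⟩ := hAbd a
        exact ⟨ε', i, by omega, by rw [← ha, e]⟩
      · exact ⟨ε, m, le_rfl, e⟩

/-! ### The decomposition associated with a linear preorder -/

section

variable {μ : P.PreCell} {n q : ℕ}

/-- The initial segments of a linear preorder on the `k`-atoms of the target of `μ`. -/
structure IsSegmentOf {k : ℕ} (l : Lin (At μ k)) (V : Set (P.Atom k)) : Prop where
  subset : V ⊆ μ .pos k
  lower : ∀ a b : μ .pos k, l.le a b → b.1 ∈ V → a.1 ∈ V

/-- The preorder contains ◁ and, for a maximal atom z of dimension above k, identifies all of ⟨z⟩_k.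
If z has dimension k then ⟨z⟩_k is a single atom. -/
theorem IsSegmentOf.isInitial {k : ℕ} (hs : IsSplit μ k) {l : Lin (At μ k)} {V : Set (P.Atom k)}
    (hV : IsSegmentOf l V) : IsInitial μ V := by
  refine ⟨hV.subset, fun a ha b hb hab => ?_, fun z hz a ha haz b hb => ?_⟩
  · exact hV.lower ⟨a, ha⟩ ⟨b, hV.subset hb⟩ (l.refines _ _ (.single (.inr hab))) hb
  · have hbμ : b ∈ μ .pos k := (hs.mem_iff k le_rfl _ b).2 ⟨z, hz, hb⟩
    rcases (le_dim_of_mem_atomCell haz).eq_or_lt with h | h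
    · obtain ⟨i, z⟩ := z
      simp only at h
      subst h
      have h1 : a = z := eq_of_mem_atomCell haz
      have h2 : b = z := eq_of_mem_atomCell hb
      rw [h2, ← h1]
      exact ha
    · exact hV.lower ⟨b, hbμ⟩ ⟨a, hV.subset ha⟩ (l.refines _ _ (.single (.inl
        (.rel _ _ ⟨z.1, z.2, h, maxAtoms.inClosure hz, hb, haz⟩)))) ha

theorem isSegmentOf_empty {k : ℕ} (l : Lin (At μ k)) : IsSegmentOf l ∅ :=
  ⟨Set.empty_subset _, fun _ _ _ h => h.elim⟩

theorem isSegmentOf_univ {k : ℕ} (l : Lin (At μ k)) : IsSegmentOf l (μ .pos k) :=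
  ⟨subset_rfl, fun a _ _ _ => a.2⟩

theorem isSegmentOf_Iic {k : ℕ} (l : Lin (At μ k)) (b : μ .pos k) :
    IsSegmentOf l {x | ∃ a : μ .pos k, a.1 = x ∧ l.le a b} := by
  refine ⟨?_, ?_⟩
  · rintro x ⟨a, rfl, -⟩
    exact a.2
  · rintro a c hac ⟨c', hc', hcb⟩
    obtain rfl : c' = c := Subtype.ext hc'
    exact ⟨a, rfl, l.trans _ _ _ hac hcb⟩

theorem IsSegmentOf.total {k : ℕ} {l : Lin (At μ k)} {V W : Set (P.Atom k)} (hV : IsSegmentOf l V)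
    (hW : IsSegmentOf l W) : V ⊆ W ∨ W ⊆ V := by
  by_contra! h
  obtain ⟨a, haV, haW⟩ := Set.not_subset.1 h.1
  obtain ⟨b, hbW, hbV⟩ := Set.not_subset.1 h.2
  rcases l.total ⟨a, hV.subset haV⟩ ⟨b, hW.subset hbW⟩ with hab | hab
  · exact haW (hW.lower _ _ hab hbW)
  · exact hbV (hV.lower _ _ hab haV)

/-- The successor of a proper initial segment. -/
theorem IsSegmentOf.exists_succ {k : ℕ} (hfin : (μ .pos k).Finite) {l : Lin (At μ k)}
    {V : Set (P.Atom k)} (hV : IsSegmentOf l V) (hne : V ≠ μ .pos k) :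
    ∃ V', IsSegmentOf l V' ∧ V ⊂ V' ∧ ∀ W, IsSegmentOf l W → V ⊆ W → W = V ∨ V' ⊆ W := by
  let D : Set (Set (P.Atom k)) := {W | IsSegmentOf l W ∧ V ⊂ W}
  have hD : D.Finite := hfin.finite_subsets.subset fun W hW => hW.1.subset
  obtain ⟨V', hV'⟩ := hD.exists_minimal
    ⟨μ .pos k, isSegmentOf_univ l, hV.subset.ssubset_of_ne hne⟩
  refine ⟨V', hV'.prop.1, hV'.prop.2, fun W hW hVW => ?_⟩
  rcases hVW.eq_or_ssubset with h | h
  · exact .inl h.symm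
  · right
    rcases hV'.prop.1.total hW with h' | h'
    · exact h'
    · exact hV'.le_of_le ⟨hW, h⟩ h'

theorem isCellBelow_bd {c : P.PreCell} (h : IsCellBelow μ c) (ε : Sgn) (i : ℕ) :
    IsCellBelow μ (bd ε i c) := by
  obtain ⟨⟨m, hm⟩, hcl⟩ := h
  exact ⟨⟨i, (hm.mono (le_max_left m i)).bd (le_max_right m i) ε⟩, fun δ j a ha =>
    InClosure.trans hcl (InClosure.of_bd (.base δ ha))⟩

theorem isCellBelow_comp (hP : P.IsRegular) {c d : P.PreCell} (hc : IsCellBelow μ c)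
    (hd : IsCellBelow μ d) {i : ℕ} (h : bd .pos i c = bd .neg i d) :
    IsCellBelow μ (comp i d c) := by
  obtain ⟨⟨m, hm⟩, hcl⟩ := hc
  obtain ⟨⟨m', hm'⟩, hdl⟩ := hd
  refine ⟨⟨_, hP.isCell_comp hm hm' h⟩, fun δ j a ha => ?_⟩
  rcases lt_trichotomy j i with hj | rfl | hj
  · rw [comp_of_lt hj] at ha; exact hcl _ _ a ha
  · cases δ
    · rw [comp_neg] at ha; exact hcl _ _ a ha
    · rw [comp_pos] at ha; exact hdl _ _ a ha
  · rw [comp_of_gt hj] at ha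
    exact ha.elim (hcl _ _ a) (hdl _ _ a)

theorem isCellBelow_piece (hP : P.IsRegular) (hμ : IsCell n μ) (hqn : q < n)
    (hs : IsSplit μ (q + 1)) {U V : Set (P.Atom (q + 1))} (hU : IsInitial μ U)
    (hV : IsInitial μ V) (hUV : U ⊆ V) : IsCellBelow μ (piece μ q U V) :=
  ⟨⟨n, hs.isCell_piece hP hμ hqn hU hV hUV⟩, fun _ _ _ ha => hs.inClosure_piece hU hV ha⟩

theorem inTheta_mono {m m' : ℕ} {S : Set ℕ} {T : ThetaShape} (h : T.InTheta m S) (hmm' : m ≤ m') :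
    T.InTheta m' S := by
  induction T generalizing m m' S with
  | pt => trivial
  | cons A T ihA ihT =>
    exact ⟨by have := h.1; omega, ihA h.2.1 (by omega), ihT h.2.2.1 hmm', h.2.2.2⟩

/-- The part of `μ` above an initial segment `V` of a linear preorder, subdivided according to the
linear preorder, realizes a wedge sum of globes. -/
theorem exists_realization_above (hP : P.IsRegular) (hμ : IsCell n μ) (hqn : q < n)
    (hs : IsSplit μ (q + 1)) (l : Lin (At μ (q + 1))) {V : Set (P.Atom (q + 1))}
    (hV : IsSegmentOf l V) :
    ∃ (T : ThetaShape) (f : Cell T → P.PreCell), T.InTheta (n - q) {0} ∧ IsRealization q T f ∧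
      f (.start .here) = piece μ q V V ∧ (∃ p, f (.start p) = piece μ q V (μ .pos (q + 1))) ∧
      (∀ x, IsCellBelow μ (f x)) ∧
      (∀ ε x, ∃ W, IsSegmentOf l W ∧ V ⊆ W ∧ bd ε q (f x) = piece μ q W W) ∧
      ∀ W, IsSegmentOf l W → V ⊆ W → piece μ q W W ∈ Set.range f := by
  have hfin : (μ .pos (q + 1)).Finite := hμ.finite _ _
  induction hc : (μ .pos (q + 1) \ V).ncard using Nat.strong_induction_on generalizing V with
  | _ e ih =>
  have hVi := hV.isInitial hs
  have hVV : bd .neg q (piece μ q V V) = piece μ q V V := bd_neg_piece hP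
  have hcut : ∀ ε j, q ≤ j → bd ε j (piece μ q V V) = piece μ q V V := by
    intro ε j hj
    rw [← hVV]
    rcases hj.eq_or_lt with rfl | hj
    · exact bd_bd_self _ _ _ _
    · exact bd_bd_of_lt hj _ _ _
  have hVc := isCellBelow_piece hP hμ hqn hs hVi hVi subset_rfl
  by_cases hne : V = μ .pos (q + 1)
  · refine ⟨.pt, fun _ => piece μ q V V, trivial,
      isRealization_pt (hs.isCell_piece hP hμ hqn hVi hVi subset_rfl) hcut, rfl,
      ⟨.here, by rw [← hne]⟩, fun _ => hVc, fun ε _ => ⟨V, hV, subset_rfl, hcut ε q le_rfl⟩,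
      fun W hW hVW => ?_⟩
    rw [Set.Subset.antisymm (hne ▸ hW.subset) hVW]
    exact ⟨.start .here, rfl⟩
  · obtain ⟨V', hV', hVV', hsucc⟩ := hV.exists_succ hfin hne
    have hVi' := hV'.isInitial hs
    obtain ⟨T, fT, hTθ, hT, hT0, ⟨p, hp⟩, hTbelow, hTbd, hTcut⟩ := ih (μ .pos (q + 1) \ V').ncard
      (by
        rw [← hc]
        obtain ⟨a, ha, haV⟩ := Set.exists_of_ssubset hVV'
        exact Set.ncard_lt_ncard ⟨Set.sdiff_subset_sdiff_right hVV'.1, fun h =>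
          (h ⟨hV'.subset ha, haV⟩).2 ha⟩ (hfin.subset Set.sdiff_subset)) hV' rfl
    set g := piece μ q V V' with hg
    have hgc : IsCell n g := hs.isCell_piece hP hμ hqn hVi hVi' hVV'.1
    have hgb : IsCellBelow μ g := isCellBelow_piece hP hμ hqn hs hVi hVi' hVV'.1
    -- N is the actual dimension of the layer. A globe of larger dimension would have distinct cells
    -- with the same image.
    obtain ⟨N, hqN, hNn, hN, habove⟩ : ∃ N, q + 1 ≤ N ∧ N ≤ n ∧ (∃ δ, (g δ N).Nonempty) ∧
        ∀ δ j, N < j → g δ j = ∅ := by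
      classical
      have hq1 : ∃ δ, (g δ (q + 1)).Nonempty := by
        obtain ⟨a, ha, haV⟩ := Set.exists_of_ssubset hVV'
        exact ⟨.pos, a, by rw [hg, hs.piece_top hVi hVi']; exact ⟨ha, haV⟩⟩
      refine ⟨Nat.findGreatest (fun j => ∃ δ, (g δ j).Nonempty) n, Nat.le_findGreatest hqn hq1,
        Nat.findGreatest_le n, Nat.findGreatest_spec (P := fun j => ∃ δ, (g δ j).Nonempty) hqn hq1,
        fun δ j hj => ?_⟩
      rcases le_or_gt j n with hjn | hjn
      · by_contra hne
        exact Nat.findGreatest_is_greatest hj hjn ⟨δ, Set.nonempty_iff_ne_empty.2 hne⟩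
      · exact hgc.empty_above _ _ hjn
    obtain ⟨δ, hN⟩ := hN
    obtain ⟨A, fA, hAθ, hA, ⟨x, hx⟩, hAbd⟩ := hP.exists_globe hgc hN habove hqN
    have hgneg : bd .neg q g = piece μ q V V := bd_neg_piece hP
    have hgpos : bd .pos q g = piece μ q V' V' := bd_pos_piece hP
    have hAq : ∀ a ε, bd ε q (fA a) = bd ε q g := fun a ε => by
      obtain ⟨ε', i, hi, e⟩ := hAbd a
      rw [e, bd_bd_of_gt hi]
    have hAb : ∀ a, IsCellBelow μ (fA a) := fun a => by
      obtain ⟨ε', i, hi, e⟩ := hAbd a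
      rw [e]
      exact isCellBelow_bd hgb _ _
    have htA : ∀ a, bd .pos q (fA a) = fT (.start .here) := fun a => by rw [hAq, hgpos, hT0]
    -- The source cut of every cell above V' contains V', which is strictly larger than V.
    have hsT : ∀ c, fT c ≠ piece μ q V V := by
      intro c h
      obtain ⟨W, hW, hVW, e⟩ := hTbd .neg c
      rw [h, hVV] at e
      have := piece_injective hP hμ hqn hVi (hW.isInitial hs) e
      subst this
      exact hVV'.2 hVW
    have hglue : ∀ a p, bd .pos q (fA a) = bd .neg q (fT (.start p)) := fun a p => by
      rw [htA]
      have := hT.bd .neg 0 (.start p)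
      rw [Nat.zero_add] at this
      rw [← this]
      simp [Cell.bd]
    refine ⟨.cons A T, wedgeMap q (piece μ q V V) fA fT, ⟨by omega, ?_, hTθ, .inr rfl⟩,
      isRealization_wedgeMap hP hA hT (fun a => by rw [hAq, hgneg]) htA hsT, rfl,
      ⟨.step x p, ?_⟩, fun y => ?_, fun ε y => ?_, fun W hW hVW => ?_⟩
    · have : {i | i + 1 ∈ ({0} : Set ℕ)} = ∅ := by ext i; simp
      rw [this]
      exact inTheta_mono hAθ (by omega)
    · simp only [wedgeMap]
      rw [hx, hp, hg, comp_piece hVi' hVV'.1 hV'.subset]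
    · match y with
      | .start .here => exact hVc
      | .start (.step a p) => exact isCellBelow_comp hP (hAb a) (hTbelow _) (hglue a p)
      | .skip c => exact hTbelow c
    · match y, ε with
      | .start .here, ε => exact ⟨V, hV, subset_rfl, hcut ε q le_rfl⟩
      | .start (.step a p), .neg =>
        exact ⟨V, hV, subset_rfl, by simp only [wedgeMap]; rw [bd_neg_comp, hAq, hgneg]⟩
      | .start (.step a p), .pos =>
        obtain ⟨W, hW, hVW, e⟩ := hTbd .pos (.start p)
        exact ⟨W, hW, hVV'.1.trans hVW, by simp only [wedgeMap]; rw [bd_pos_comp (hglue a p), e]⟩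
      | .skip c, ε =>
        obtain ⟨W, hW, hVW, e⟩ := hTbd ε c
        exact ⟨W, hW, hVV'.1.trans hVW, e⟩
    · rcases hsucc W hW hVW with rfl | h
      · exact ⟨.start .here, rfl⟩
      · obtain ⟨c, hc⟩ := hTcut W hW h
        exact ⟨.skip c, hc⟩

/-- Start at m = q with the wedge of globes above the empty segment and suspend down to m = 0; each
suspension adds the source and target of μ in one dimension. These are never slices, so the cuts do
not change. -/
theorem exists_realization (hP : P.IsRegular) (hμ : IsCell n μ) (hqn : q < n)
    (hs : IsSplit μ (q + 1)) (l : Lin (At μ (q + 1))) (hne : (μ .pos (q + 1)).Nonempty) {m : ℕ}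
    (hm : m ≤ q) :
    ∃ (T : ThetaShape) (f : Cell T → P.PreCell), T.InTheta (n - m) {q - m} ∧ IsRealization m T f ∧
      μ ∈ Set.range f ∧ (∀ x, IsCellBelow μ (f x)) ∧
      (∀ ε i x, i < m → bd ε i (f x) = bd ε i μ) ∧
      ∀ W, IsInitial μ W → (piece μ q W W ∈ Set.range f ↔ IsSegmentOf l W) := by
  induction hm using Nat.decreasingInduction with
  | self =>
    obtain ⟨T, f, hTθ, hf, -, ⟨p, hp⟩, hbelow, hbd, hcut⟩ :=
      exists_realization_above hP hμ hqn hs l (isSegmentOf_empty l)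
    refine ⟨T, f, by rwa [Nat.sub_self], hf, ⟨_, hp.trans (hs.piece_univ hP hμ hqn)⟩, hbelow,
      fun ε i x hi => ?_, fun W hW => ⟨?_, fun h => hcut W h (Set.empty_subset _)⟩⟩
    · obtain ⟨W, hW, -, e⟩ := hbd .neg x
      rw [← bd_bd_of_gt hi .neg ε, e, bd_piece_of_lt hi]
    · rintro ⟨x, hx⟩
      obtain ⟨W', hW', -, e⟩ := hbd .neg x
      rw [hx, bd_neg_piece hP] at e
      rwa [piece_injective hP hμ hqn hW (hW'.isInitial hs) e]
  | of_succ m hmq ih =>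
    obtain ⟨A, fA, hAθ, hA, hμA, hbelow, hbd, hcut⟩ := ih
    obtain ⟨f, hf, hrange⟩ := hA.exists_suspension hP hμ (fun a ε => hbd ε m a (by omega)) fun h =>
      hne.ne_empty (hP.empty_of_neg_eq_pos hμ h .pos (by omega))
    have hμb : IsCellBelow μ μ := ⟨⟨n, hμ⟩, fun _ _ _ ha => .base _ ha⟩
    refine ⟨.cons A .pt, f, ⟨by omega, ?_, trivial, .inl rfl⟩, hf, (hrange μ).2 (.inl hμA),
      fun x => ?_, fun ε i x hi => ?_, fun W hW => ?_⟩
    · have : {i | i + 1 ∈ ({q - m} : Set ℕ)} = {q - (m + 1)} := by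
        ext i
        change i + 1 = q - m ↔ i = q - (m + 1)
        omega
      rw [this, show n - m - 1 = n - (m + 1) by omega]
      exact hAθ
    · rcases (hrange (f x)).1 ⟨x, rfl⟩ with ⟨a, ha⟩ | ⟨ε, e⟩
      · rw [← ha]; exact hbelow a
      · rw [e]; exact isCellBelow_bd hμb _ _
    · rcases (hrange (f x)).1 ⟨x, rfl⟩ with ⟨a, ha⟩ | ⟨ε', e⟩
      · rw [← ha]; exact hbd ε i a (by omega)
      · rw [e, bd_bd_of_gt hi]
    · rw [← hcut W hW, hrange]
      exact or_iff_left fun ⟨ε, e⟩ => piece_ne_bd hP hμ hne hW hmq ε e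

theorem exists_mem_Sd (hP : P.IsRegular) (hμ : IsCell n μ) (hqn : q < n)
    (hs : IsSplit μ (q + 1)) (l : Lin (At μ (q + 1))) :
    ∃ θ ∈ Sd n {q} μ, ∀ W, IsInitial μ W → (piece μ q W W ∈ θ ↔ IsSegmentOf l W) := by
  obtain ⟨a, b, hab⟩ : ∃ a b, ¬ l.le a b := by
    have := l.not_codiscrete
    push Not at this
    exact this
  have hne : (μ .pos (q + 1)).Nonempty := ⟨a, a.2⟩
  obtain ⟨T, f, hTθ, hf, hμf, hbelow, -, hcut⟩ :=
    exists_realization hP hμ hqn hs l hne (Nat.zero_le q)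
  refine ⟨Set.range f, ⟨⟨?_, ?_, ?_⟩, hμf, ⟨T, hTθ, f, hf.injective, rfl, hf.bd, hf.comp⟩, ?_⟩, hcut⟩
  · rintro _ ⟨x, rfl⟩
    exact hbelow x
  · rintro _ ⟨x, rfl⟩ ε i
    exact ⟨_, hf.bd ε i x⟩
  · rintro _ ⟨x, rfl⟩ _ ⟨y, rfl⟩ i h
    exact ⟨_, hf.comp i x y (hf.injective (by rw [hf.bd, hf.bd]; exact h))⟩
  · intro hglobe
    -- As b is in W and a is not, W is neither empty nor everything. But the only cuts among the
    -- boundaries of μ are its q-dimensional source and target, which belong to ∅ and to the full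
    -- set.
    set W := {x | ∃ c : μ .pos (q + 1), c.1 = x ∧ l.le c b} with hWdef
    have hW : IsSegmentOf l W := isSegmentOf_Iic l b
    have hWi := hW.isInitial hs
    have hbW : b.1 ∈ W := ⟨b, rfl, l.refl b⟩
    have haW : a.1 ∉ W := by
      rintro ⟨c, hc, hcb⟩
      obtain rfl : c = a := Subtype.ext hc
      exact hab hcb
    have hmem := (hcut W hWi).2 hW
    rw [hglobe] at hmem
    obtain ⟨ε, i, e⟩ := hmem
    rcases lt_trichotomy i q with hi | rfl | hi
    · exact piece_ne_bd hP hμ hne hWi hi ε e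
    · have hμ' := hs.piece_univ hP hμ hqn
      cases ε
      · rw [piece_injective hP hμ hqn hWi isInitial_empty
          (e.trans ((congrArg (bd .neg _) hμ').symm.trans (bd_neg_piece hP)))] at hbW
        exact hbW
      · rw [piece_injective hP hμ hqn hWi hs.isInitial_univ
          (e.trans ((congrArg (bd .pos _) hμ').symm.trans (bd_pos_piece hP)))] at haW
        exact haW a.2
    · have h1 := congrFun (congrFun e .pos) (q + 1)
      rw [piece_self_of_gt hP (Nat.lt_succ_self q)] at h1
      rcases (Nat.succ_le_of_lt hi).eq_or_lt with rfl | hi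
      · rw [bd_self] at h1
        have hne' : (μ ε (q + 1)).Nonempty := by
          by_contra h
          have h2 := bd_neg_eq_bd_pos_of_empty hμ (Set.not_nonempty_iff_eq_empty.1 h)
          exact hne.ne_empty
            (hP.empty_of_neg_eq_pos hμ (bd_eq_bd_iff.1 h2).2 .pos (Nat.lt_succ_self q))
        exact hne'.ne_empty h1.symm
      · rw [bd_of_lt hi] at h1
        exact hne.ne_empty h1.symm

-- Comparing decompositions with linear preorders

namespace IsDecomposition

variable {r r' : ℕ} {U U' : ℕ → Set (P.Atom (q + 1))} {θ θ' : Set P.PreCell}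

/-- The linear preorder associated with a decomposition. -/
theorem exists_lin (hP : P.IsRegular) (hμ : IsCell n μ) (hqn : q < n)
    (hs : IsSplit μ (q + 1)) (h : IsDecomposition μ q r U θ) :
    ∃ l : Lin (At μ (q + 1)), l.le = L μ (q + 1) θ := by
  have hL := h.L_iff hP hμ hqn hs
  refine ⟨⟨L μ (q + 1) θ, fun _ => .refl, fun _ _ _ => .trans, fun a b => ?_, fun a b hab => ?_,
    fun hall => ?_⟩, rfl⟩
  · rw [hL, hL]
    by_contra! hn
    obtain ⟨⟨p, hp, hb, ha⟩, ⟨s, hsr, ha', hb'⟩⟩ := hn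
    rcases le_total p s with hps | hps
    · exact hb' (h.mono hps hsr hb)
    · exact ha (h.mono hps hp ha')
  · rw [hL]
    intro p hp
    induction hab with
    | refl => exact fun h => h
    | @tail b c _ hbc ih =>
      intro hc
      refine ih ?_
      rcases hbc with hbc | hbc
      · obtain ⟨z, hz, hcz⟩ := (hs.mem_iff _ le_rfl _ c.1).1 c.2
        have hbz := (hs.eq_of_atEquiv hP hμ hqn hbc z hz).2 hcz
        exact (h.initial p hp).atom z hz c.1 hc hcz hbz
      · exact (h.initial p hp).tri b.1 b.2 c.1 hc hbc
  -- Two layers suffice: an atom of the second is not below an atom of the first.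
  · have hr := h.two_le
    obtain ⟨a, ha, -⟩ := Set.exists_of_ssubset (h.strict 0 (by omega))
    obtain ⟨b, hb, hb'⟩ := Set.exists_of_ssubset (h.strict 1 (by omega))
    have := (hL ⟨b, (h.initial 2 hr).subset hb⟩ ⟨a, (h.initial 1 (by omega)).subset ha⟩).1
      (hall _ _) 1 (by omega) ha
    exact hb' this

/-- The cuts of a decomposition are the initial segments of its linear preorder. -/
theorem exists_eq_iff (hP : P.IsRegular) (hμ : IsCell n μ) (hqn : q < n)
    (hs : IsSplit μ (q + 1)) (h : IsDecomposition μ q r U θ) (V : Set (P.Atom (q + 1))) :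
    (∃ s ≤ r, V = U s) ↔ V ⊆ μ .pos (q + 1) ∧
      ∀ a b : μ .pos (q + 1), L μ (q + 1) θ a b → b.1 ∈ V → a.1 ∈ V := by
  constructor
  · rintro ⟨s, hsr, rfl⟩
    exact ⟨(h.initial s hsr).subset, fun a b hab => (h.L_iff hP hμ hqn hs a b).1 hab s hsr⟩
  · rintro ⟨hVμ, hV⟩
    -- Take the least such s. Then V contains an atom of the last layer of U s, and all of U s is
    -- below that atom.
    have hex : ∃ s, s ≤ r ∧ V ⊆ U s := ⟨r, le_rfl, h.last ▸ hVμ⟩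
    classical
    obtain ⟨hsr, hsub⟩ := Nat.find_spec hex
    refine ⟨_, hsr, Set.Subset.antisymm hsub fun a ha => ?_⟩
    obtain ⟨s, hs'⟩ : ∃ s, Nat.find hex = s := ⟨_, rfl⟩
    rw [hs'] at hsr hsub ha
    cases s with
    | zero => rw [h.zero] at ha; exact ha.elim
    | succ s =>
      have hmin : ¬ V ⊆ U s := fun hc => Nat.find_min hex (m := s) (by omega) ⟨by omega, hc⟩
      obtain ⟨b, hbV, hbs⟩ := Set.not_subset.1 hmin
      refine hV ⟨a, (h.initial _ hsr).subset ha⟩ ⟨b, hVμ hbV⟩ ?_ hbV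
      rw [h.L_iff hP hμ hqn hs]
      intro p hp hbp
      have : s + 1 ≤ p := by
        by_contra hlt
        exact hbs (h.mono (by omega) (by omega) hbp)
      exact h.mono this hp ha

/-- Inclusion of decompositions is inclusion of their sets of cuts, and more cuts mean fewer
relations a ≤ b. -/
theorem subset_iff (hP : P.IsRegular) (hμ : IsCell n μ) (hqn : q < n)
    (hs : IsSplit μ (q + 1)) (h : IsDecomposition μ q r U θ) (h' : IsDecomposition μ q r' U' θ') :
    θ ⊆ θ' ↔ ∀ a b, L μ (q + 1) θ' a b → L μ (q + 1) θ a b := by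
  constructor
  · intro hsub a b hab
    rw [h.L_iff hP hμ hqn hs]
    intro p hp
    obtain ⟨s, hs', e⟩ := h'.exists_eq_of_piece_mem hP hμ hqn (h.initial p hp)
      (hsub (h.piece_mem p p le_rfl hp))
    rw [e]
    exact (h'.L_iff hP hμ hqn hs a b).1 hab s hs'
  · intro hsub
    refine h.subset_of_cuts hP hμ hqn hs h' fun p hp => ?_
    have := (h.exists_eq_iff hP hμ hqn hs (U p)).1 ⟨p, hp, rfl⟩
    exact (h'.exists_eq_iff hP hμ hqn hs (U p)).2
      ⟨this.1, fun a b hab => this.2 a b (hsub a b hab)⟩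

end IsDecomposition

/-- The relation is recovered from the principal segments: a ≤ b exactly when a is in the one
generated by b. -/
theorem Lin.ext_of_segments {k : ℕ} {l l' : Lin (At μ k)}
    (h : ∀ V, IsSegmentOf l V ↔ IsSegmentOf l' V) : l = l' := by
  have key : ∀ l l' : Lin (At μ k), (∀ V, IsSegmentOf l V → IsSegmentOf l' V) →
      ∀ a b, l'.le a b → l.le a b := by
    intro l l' h a b hab
    obtain ⟨c, hc, hcb⟩ := (h _ (isSegmentOf_Iic l b)).lower a b hab ⟨b, rfl, l.refl b⟩
    obtain rfl : c = a := Subtype.ext hc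
    exact hcb
  exact Lin.le_injective (funext fun a => funext fun b => propext
    ⟨key l' l (fun V => (h V).2) a b, key l l' (fun V => (h V).1) a b⟩)

/-- Comparing cuts shows that the map preserves and reflects order, hence is injective. It is
surjective because the decomposition realizing l has the segments of l as cuts, and these determine
l. -/
theorem IsSplit.exists_orderIso_lin (hP : P.IsRegular) (hμ : IsCell n μ) (hqn : q < n)
    (hs : IsSplit μ (q + 1)) :
    ∃ e : Sd n {q} μ ≃o Lin (At μ (q + 1)), ∀ θ, (e θ).le = L μ (q + 1) θ.1 := by
  have hdec : ∀ θ : Sd n {q} μ, ∃ r U, IsDecomposition μ q r U θ.1 := fun θ =>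
    exists_isDecomposition hP hs θ.2
  have hlin : ∀ θ : Sd n {q} μ, ∃ l : Lin (At μ (q + 1)), l.le = L μ (q + 1) θ.1 := fun θ => by
    obtain ⟨r, U, h⟩ := hdec θ
    exact h.exists_lin hP hμ hqn hs
  choose e he using hlin
  have hle : ∀ θ θ', e θ ≤ e θ' ↔ θ ≤ θ' := by
    intro θ θ'
    obtain ⟨r, U, h⟩ := hdec θ
    obtain ⟨r', U', h'⟩ := hdec θ'
    change (∀ a b, (e θ').le a b → (e θ).le a b) ↔ θ.1 ⊆ θ'.1
    rw [he, he, h.subset_iff hP hμ hqn hs h']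
  have hinj : Function.Injective e := fun θ θ' h =>
    le_antisymm ((hle θ θ').1 h.le) ((hle θ' θ).1 h.ge)
  have hsurj : Function.Surjective e := by
    intro l
    obtain ⟨θ, hθ, hcut⟩ := exists_mem_Sd hP hμ hqn hs l
    obtain ⟨r, U, h⟩ := hdec ⟨θ, hθ⟩
    refine ⟨⟨θ, hθ⟩, Lin.ext_of_segments fun V => ?_⟩
    have hseg : IsSegmentOf (e ⟨θ, hθ⟩) V ↔ ∃ s ≤ r, V = U s := by
      rw [h.exists_eq_iff hP hμ hqn hs, ← he ⟨θ, hθ⟩]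
      exact ⟨fun h => ⟨h.1, h.2⟩, fun h => ⟨h.1, h.2⟩⟩
    rw [hseg]
    constructor
    · rintro ⟨s, hsr, rfl⟩
      exact (hcut _ (h.initial s hsr)).1 (h.piece_mem s s le_rfl hsr)
    · intro hV
      have hVi := hV.isInitial hs
      exact h.exists_eq_of_piece_mem hP hμ hqn hVi ((hcut V hVi).2 hV)
  exact ⟨⟨Equiv.ofBijective e ⟨hinj, hsurj⟩, fun {θ θ'} => hle θ θ'⟩, he⟩

end

end OmegaHypergraph

theorem proposition4p14 (P : OmegaHypergraph.{u}) (hP : P.IsTorsionFreeComplex)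
    (n k : ℕ) (μ : P.PreCell) (hμ : OmegaHypergraph.IsCell n μ) (hk : 1 ≤ k) (hkn : k ≤ n)
    (hAt : ∀ i, k < i → OmegaHypergraph.AtIsEquivalence μ i) :
    ∃ e : OmegaHypergraph.Sd n {k - 1} μ ≃o OmegaHypergraph.Lin (OmegaHypergraph.At μ k),
      ∀ θ, (e θ).le = OmegaHypergraph.L μ k θ.1 := by
  -- With k = q + 1 the truncated subtraction in `Sd` and `L` evaluates to q.
  obtain ⟨q, rfl⟩ : ∃ q, k = q + 1 := ⟨k - 1, by omega⟩
  exact (OmegaHypergraph.isSplit hP.isRegular hμ hkn hAt).exists_orderIso_lin hP.isRegular hμ hkn
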